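/- Let $k$ be a field and $H$ a Hopf $k$-algebra with coproduct $f\mapsto f_{(1)}\otimes f_{(2)}$, counit $\epsilon$ and antipode $S$ (not assumed bijective). Let $L$, $R$ be unital associative $k$-algebras. Let $(L,\triangleright)$ be a left $H$-module algebra with smash product algebra $L\sharp H$ (the space $L\otimes H$ with $(a\sharp h)(b\sharp g)=a(h_{(1)}\triangleright b)\sharp h_{(2)}g$), and let $\rho\colon L\to L\otimes H$, $x\mapsto x_{[0]}\otimes x_{[1]}$, be a right $H$-comodule structure on $L$. Let $(R,\triangleleft)$ be a right $H$-module algebra with smash product algebra $H\sharp R$ (the space $H\otimes R$ with $(h\sharp a)(g\sharp b)=hg_{(1)}\sharp (a\triangleleft g_{(2)})b$), and let $\lambda\colon R\to H\otimes R$, $y\mapsto y_{[-1]}\otimes y_{[0]}$, be a left $H$-comodule structure on $R$. A dot denotes multiplication in a smash product, in which $H$, $L$, $R$ are regarded as embedded. Assume that $\rho\colon L\to L\sharp H$ and $\lambda\colon R\to H\sharp R$ are unital antihomomorphisms of algebras. Let $\Psi\colon L\sharp H\to H\sharp R$ be an isomorphism of algebras such that $\Psi(1\sharp f)=f\sharp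 1$ for all $f\in H$, $\Psi(L\sharp 1)=\operatorname{Im}\lambda$ and $\Psi^{-1}(1\sharp R)=\operatorname{Im}\rho$. Then there are unique antiisomorphisms of algebras $\phi\colon L\to R$ and $\theta\colon R\to L$ with $\Psi(x\sharp 1)=\lambda(\phi(x))$ and $\Psi^{-1}(1\sharp y)=\rho(\theta(y))$ for all $x\in L$, $y\in R$, and the following holds. (1) The Yetter-Drinfeld conditions $$(h_{(1)}\triangleright x_{[0]})\otimes h_{(2)}x_{[1]}=(h_{(2)}\triangleright x)_{[0]}\otimes(h_{(2)}\triangleright x)_{[1]}h_{(1)},$$ $$y_{[-1]}h_{(1)}\otimes(y_{[0]}\triangleleft h_{(2)})=h_{(2)}(y\triangleleft h_{(1)})_{[-1]}\otimes(y\triangleleft h_{(1)})_{[0]}$$ hold; moreover $(L,\triangleright,\rho)$ and $(R,\triangleleft,\lambda)$ are braided commutative Yetter-Drinfeld module algebras, that is, also $\rho(xx')=x_{[0]}x'_{[0]}\otimes x'_{[1]}x_{[1]}$, $\rho(1)=1\otimes 1$, $x_{[0]}(x_{[1]}\triangleright a)=ax$ for $a,x,x'\in L$, and $\lambda(yy')=y'_{[-1]}y_{[-1]}\otimes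 y_{[0]}y'_{[0]}$, $\lambda(1)=1\otimes 1$, $(b\triangleleft y_{[-1]})y_{[0]}=yb$ for $b,y,y'\in R$. The actions are compatible via $\phi$ and via $\theta$: $\phi(f\triangleright x)=\phi(x)\triangleleft S(f)$ and $\theta(y\triangleleft f)=S(f)\triangleright\theta(y)$. Consequently $L\sharp H$ with $$\alpha_L(x)=x\sharp 1,\quad \beta_L=\rho,\quad \Delta_L(x\sharp f)=(x\sharp f_{(1)})\otimes_L(1\sharp f_{(2)}),\quad \epsilon_L(x\sharp f)=\epsilon(f)x$$ is a left bialgebroid over $L$, and $H\sharp R$ with $$\alpha'_R(y)=1\sharp y,\quad \beta'_R=\lambda,\quad \Delta'_R(f\sharp y)=(f_{(1)}\sharp 1)\otimes_R(f_{(2)}\sharp y),\quad \epsilon'_R(f\sharp y)=\epsilon(f)y$$ is a right bialgebroid over $R$. (2) Let $\tau(x\sharp f)=S(f)S^2(x_{[1]})\cdot x_{[0]}$ on $L\sharp H$ and $\tau'(f\sharp y)=y_{[0]}\cdot S^2(y_{[-1]})S(f)$ on $H\sharp R$. If moreover $\Psi\circ\tau=\tau'\circ\Psi$, then the coactions are compatible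 via $\phi$ and via $\theta$: $$\phi(x)_{[-1]}\otimes\phi(x)_{[0]}=S(x_{[1]})\otimes\phi(x_{[0]}),\qquad \theta(y)_{[0]}\otimes\theta(y)_{[1]}=\theta(y_{[0]})\otimes S(y_{[-1]}).$$ In this case $L\sharp H$ is a symmetric Hopf algebroid (left base $L$, right base $R$, in the sense of Böhm and Szlachányi) with the left bialgebroid structure of (1), antipode $\tau$, $\Delta_R(x\sharp f)=(x\sharp f_{(1)})\otimes_R(1\sharp f_{(2)})$ and the remaining structure maps given - via $\phi$ by $\alpha_R(y)=S(y_{[-1]})\cdot\phi^{-1}(y_{[0]})$, $\beta_R(y)=\phi^{-1}(y)\sharp 1$, $\epsilon_R(x\sharp f)=\phi(x)\triangleleft f$; - or via $\theta$ by $\alpha_R(y)=\rho(\theta(y))$, $\beta_R(y)=(y_{[-1]}\triangleright\theta(y_{[0]}))\sharp 1$, $\epsilon_R(x\sharp f)=\theta^{-1}(x_{[0]})\triangleleft(S(x_{[1]})f)$. Likewise $H\sharp R$ is a symmetric Hopf algebroid with the right bialgebroid structure of (1), antipode $\tau'$, $\Delta'_L(f\sharp y)=(f_{(1)}\sharp 1)\otimes_L(f_{(2)}\sharp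 y)$ and the remaining structure maps given - via $\phi$ by $\alpha'_L(x)=\lambda(\phi(x))$, $\beta'_L(x)=1\sharp(\phi(x_{[0]})\triangleleft x_{[1]})$, $\epsilon'_L(f\sharp y)=(fS(y_{[-1]}))\triangleright\phi^{-1}(y_{[0]})$; - or via $\theta$ by $\alpha'_L(x)=\theta^{-1}(x_{[0]})\cdot S(x_{[1]})$, $\beta'_L(x)=1\sharp\theta^{-1}(x)$, $\epsilon'_L(f\sharp y)=f\triangleright\theta(y)$. The structure defined via $\phi$ and the structure defined via $\theta$ coincide, on $L\sharp H$ as well as on $H\sharp R$, and $\Psi$ carries the structure on $L\sharp H$ to the one on $H\sharp R$. -/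

import Mathlib

open scoped TensorProduct

namespace ScalarExt

noncomputable section

open Coalgebra

/-- A left `H`-module algebra structure on the `k`-algebra `L`; `act h x` is `h ▹ x`. -/
structure LeftModuleAlgebra (k H L : Type*) [CommRing k] [Ring H] [Bialgebra k H]
    [Ring L] [Algebra k L] where
  act : H →ₗ[k] L →ₗ[k] L
  one_act : ∀ x, act 1 x = x
  mul_act : ∀ h g x, act (h * g) x = act h (act g x)
  act_one : ∀ h, act h 1 = (counit h : k) • (1 : L)
  /-- `h ▹ (x y) = (h₁ ▹ x) (h₂ ▹ y)` -/
  act_mul : ∀ h x y, act h (x * y) =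
    LinearMap.mul' k L (TensorProduct.map (act.flip x) (act.flip y) (comul h))

/-- A right `H`-module algebra structure on the `k`-algebra `R`; `act y h` is `y ◃ h`. -/
structure RightModuleAlgebra (k H R : Type*) [CommRing k] [Ring H] [Bialgebra k H]
    [Ring R] [Algebra k R] where
  act : R →ₗ[k] H →ₗ[k] R
  act_one : ∀ y, act y 1 = y
  act_mul : ∀ y h g, act y (h * g) = act (act y h) g
  one_act : ∀ h, act 1 h = (counit h : k) • (1 : R)
  /-- `(x y) ◃ h = (x ◃ h₁) (y ◃ h₂)` -/
  mul_act : ∀ x y h, act (x * y) h =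
    LinearMap.mul' k R (TensorProduct.map (act x) (act y) (comul h))

/-- A right `H`-comodule structure `x ↦ x₀ ⊗ x₁` on `L`. -/
structure RightComodule (k H L : Type*) [CommRing k] [AddCommGroup H] [Module k H]
    [Coalgebra k H] [AddCommGroup L] [Module k L] where
  coact : L →ₗ[k] L ⊗[k] H
  coassoc : ∀ x, TensorProduct.assoc k L H H (coact.rTensor H (coact x)) =
    (comul (R := k) (A := H)).lTensor L (coact x)
  counit_coact : ∀ x, TensorProduct.rid k L ((counit (R := k) (A := H)).lTensor L (coact x)) = x

/-- A left `H`-comodule structure `y ↦ y₋₁ ⊗ y₀` on `R`. -/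
structure LeftComodule (k H R : Type*) [CommRing k] [AddCommGroup H] [Module k H]
    [Coalgebra k H] [AddCommGroup R] [Module k R] where
  coact : R →ₗ[k] H ⊗[k] R
  coassoc : ∀ y, TensorProduct.assoc k H H R ((comul (R := k) (A := H)).rTensor R (coact y)) =
    coact.lTensor H (coact y)
  counit_coact : ∀ y, TensorProduct.lid k R ((counit (R := k) (A := H)).rTensor R (coact y)) = y

namespace LeftModuleAlgebra

variable {k H L : Type*} [CommRing k] [Ring H] [Bialgebra k H] [Ring L] [Algebra k L]
variable (A : LeftModuleAlgebra k H L)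

/-- The operator `a ⊗ g ↦ (h₁ ▹ a) ⊗ h₂ g` on `L ⊗ H`. -/
def diag : H →ₗ[k] (L ⊗[k] H →ₗ[k] L ⊗[k] H) :=
  TensorProduct.homTensorHomMap (RingHom.id k) L H L H ∘ₗ
    TensorProduct.map A.act (LinearMap.mul k H) ∘ₗ comul

/-- `(a ⊗ h) (b ⊗ g) = a (h₁ ▹ b) ⊗ h₂ g` -/
def smashMul : L ⊗[k] H →ₗ[k] (L ⊗[k] H →ₗ[k] L ⊗[k] H) :=
  TensorProduct.lift (LinearMap.mk₂ k
    (fun a h => (LinearMap.mul k L a).rTensor H ∘ₗ A.diag h)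
    (fun a a' h => by rw [map_add, LinearMap.rTensor_add, LinearMap.add_comp])
    (fun c a h => by rw [map_smul, LinearMap.rTensor_smul, LinearMap.smul_comp])
    (fun a h h' => by rw [map_add, LinearMap.comp_add])
    (fun c a h => by rw [map_smul, LinearMap.comp_smul]))

theorem diag_tmul (h : H) (b : L) (g : H) : A.diag h (b ⊗ₜ g) =
    TensorProduct.map (A.act.flip b) ((LinearMap.mul k H).flip g) (comul h) := by
  simp only [diag, LinearMap.comp_apply]
  induction comul (R := k) h using TensorProduct.induction_on with
  | zero => simp
  | tmul x y => simp
  | add x y hx hy => simp [hx, hy]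

theorem smashMul_tmul (a : L) (h : H) (t : L ⊗[k] H) :
   A.smashMul (a ⊗ₜ h) t = (LinearMap.mul k L a).rTensor H (A.diag h t) := rfl

theorem smashMul_rTensor (a : L) (s t : L ⊗[k] H) :
    A.smashMul ((LinearMap.mul k L a).rTensor H s) t =
      (LinearMap.mul k L a).rTensor H (A.smashMul s t) := by
  induction s using TensorProduct.induction_on with
  | zero => simp
  | add x y hx hy => simp [hx, hy]
  | tmul b h =>
    simp only [LinearMap.rTensor_tmul, LinearMap.mul_apply', smashMul_tmul]
    have : (LinearMap.mul k L (a * b)).rTensor H =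
        (LinearMap.mul k L a).rTensor H ∘ₗ (LinearMap.mul k L b).rTensor H := by
      rw [← LinearMap.rTensor_comp]
      congr 1
      ext c
      simp [mul_assoc]
    rw [this, LinearMap.comp_apply]

theorem diag_mul (h g : H) (t : L ⊗[k] H) : A.diag (h * g) t = A.diag h (A.diag g t) := by
  simp only [diag, LinearMap.comp_apply, Bialgebra.comul_mul]
  generalize comul (R := k) h = u
  generalize comul (R := k) g = v
  induction u using TensorProduct.induction_on with
  | zero => simp
  | add x y hx hy => simp [hx, hy, add_mul]
  | tmul x y =>
    induction v using TensorProduct.induction_on with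
    | zero => simp
    | add x y hx hy => simp [hx, hy, mul_add]
    | tmul x' y' =>
      induction t using TensorProduct.induction_on with
      | zero => simp
      | add p q hp hq => simp only [map_add, hp, hq]
      | tmul b f => simp [A.mul_act, mul_assoc]

theorem diag_rTensor (h : H) (b : L) (t : L ⊗[k] H) :
    A.diag h ((LinearMap.mul k L b).rTensor H t) = A.smashMul (A.diag h (b ⊗ₜ 1)) t := by
  induction t using TensorProduct.induction_on with
  | zero => simp
  | add x y hx hy => simp [hx, hy]
  | tmul c g =>
    -- both sides are images of the iterated coproduct of `h`
    let F : H ⊗[k] (H ⊗[k] H) →ₗ[k] L ⊗[k] H :=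
      (LinearMap.mul' k L).rTensor H ∘ₗ (TensorProduct.assoc k L L H).symm.toLinearMap ∘ₗ
        TensorProduct.map (A.act.flip b)
          (TensorProduct.map (A.act.flip c) ((LinearMap.mul k H).flip g))
    have h1 : A.diag h ((b * c) ⊗ₜ g) =
        F (TensorProduct.assoc k H H H ((comul (R := k)).rTensor H (comul h))) := by
      rw [diag_tmul]
      induction comul (R := k) h using TensorProduct.induction_on with
      | zero => simp
      | add x y hx hy => simp only [map_add, hx, hy]
      | tmul x y =>
        simp only [TensorProduct.map_tmul, LinearMap.flip_apply, LinearMap.rTensor_tmul, A.act_mul]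
        induction comul (R := k) x using TensorProduct.induction_on with
        | zero => simp
        | add x y hx hy => simp only [map_add, hx, hy, TensorProduct.add_tmul]
        | tmul x' y' => simp [F]
    have h2 : A.smashMul (A.diag h (b ⊗ₜ 1)) (c ⊗ₜ g) =
        F ((comul (R := k)).lTensor H (comul h)) := by
      rw [diag_tmul]
      induction comul (R := k) h using TensorProduct.induction_on with
      | zero => simp
      | add x y hx hy => simp only [map_add, hx, hy, LinearMap.add_apply]
      | tmul x y =>
        simp only [TensorProduct.map_tmul, LinearMap.flip_apply, LinearMap.lTensor_tmul,
          smashMul_tmul, LinearMap.mul_apply', mul_one, diag_tmul]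
        induction comul (R := k) y using TensorProduct.induction_on with
        | zero => simp
        | add x y hx hy => simp only [map_add, hx, hy, TensorProduct.tmul_add]
        | tmul x' y' => simp [F]
    rw [LinearMap.rTensor_tmul, LinearMap.mul_apply', h1, h2, Coalgebra.coassoc_apply]

theorem diag_smashMul (h : H) (s t : L ⊗[k] H) :
    A.diag h (A.smashMul s t) = A.smashMul (A.diag h s) t := by
  induction s using TensorProduct.induction_on with
  | zero => simp
  | add x y hx hy => simp [hx, hy]
  | tmul b g =>
    rw [smashMul_tmul, diag_rTensor, diag_tmul, diag_tmul]
    induction comul (R := k) h using TensorProduct.induction_on with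
    | zero => simp
    | add x y hx hy => simp only [map_add, hx, hy, LinearMap.add_apply]
    | tmul x y => simp [smashMul_tmul, diag_mul]

theorem smashMul_assoc (s t u : L ⊗[k] H) :
    A.smashMul (A.smashMul s t) u = A.smashMul s (A.smashMul t u) := by
  induction s using TensorProduct.induction_on with
  | zero => simp
  | add x y hx hy => simp [hx, hy]
  | tmul a h => rw [smashMul_tmul, smashMul_tmul, smashMul_rTensor, diag_smashMul]

theorem one_smashMul (t : L ⊗[k] H) : A.smashMul (1 ⊗ₜ 1) t = t := by
  induction t using TensorProduct.induction_on with
  | zero => simp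
  | add x y hx hy => simp [hx, hy]
  | tmul a h => simp [smashMul_tmul, diag_tmul, Algebra.TensorProduct.one_def, A.one_act]

theorem smashMul_one (t : L ⊗[k] H) : A.smashMul t (1 ⊗ₜ 1) = t := by
  induction t using TensorProduct.induction_on with
  | zero => simp
  | add x y hx hy => simp [hx, hy]
  | tmul a h =>
    have key : A.diag h (1 ⊗ₜ 1) = (1 : L) ⊗ₜ[k] h := by
      have := congrArg ((Algebra.linearMap k L).rTensor H)
        (Coalgebra.rTensor_counit_comul (R := k) h)
      rw [LinearMap.rTensor_tmul, Algebra.linearMap_apply, map_one] at this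
      rw [diag_tmul, ← this]
      induction comul (R := k) h using TensorProduct.induction_on with
      | zero => simp
      | add x y hx hy => simp only [map_add, hx, hy]
      | tmul x y => simp [A.act_one, Algebra.algebraMap_eq_smul_one]
    rw [smashMul_tmul, key]
    simp

/-- The smash product algebra `L ♯ H`: the vector space `L ⊗ H` with the product
`(a ⊗ h) (b ⊗ g) = a (h₁ ▹ b) ⊗ h₂ g`. -/
@[nolint unusedArguments]
def Smash (_ : LeftModuleAlgebra k H L) : Type _ := L ⊗[k] H

instance : AddCommGroup A.Smash := inferInstanceAs (AddCommGroup (L ⊗[k] H))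

instance : Module k A.Smash := inferInstanceAs (Module k (L ⊗[k] H))

/-- The underlying linear identification of `L ⊗ H` with `L ♯ H`. -/
def of : L ⊗[k] H ≃ₗ[k] A.Smash := LinearEquiv.refl k (L ⊗[k] H)

instance : Ring A.Smash where
  __ := (inferInstance : AddCommGroup A.Smash)
  mul s t := A.of (A.smashMul (A.of.symm s) (A.of.symm t))
  one := A.of (1 ⊗ₜ 1)
  left_distrib s t u := by
    change A.of _ = A.of _ + A.of _
    simp
  right_distrib s t u := by
    change A.of _ = A.of _ + A.of _
    simp
  zero_mul s := by
    change A.of _ = _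
    simp
  mul_zero s := by
    change A.of _ = _
    simp
  mul_assoc s t u := congrArg A.of (A.smashMul_assoc _ _ _)
  one_mul s := A.one_smashMul s
  mul_one s := A.smashMul_one s

theorem mul_def (s t : A.Smash) : s * t = A.of (A.smashMul (A.of.symm s) (A.of.symm t)) := rfl

theorem one_def : (1 : A.Smash) = A.of (1 ⊗ₜ 1) := rfl

instance : Algebra k A.Smash :=
  Algebra.ofModule (fun c s t => by simp [mul_def]) (fun c s t => by simp [mul_def])

theorem of_mul_of (a b : L) (h g : H) : A.of (a ⊗ₜ h) * A.of (b ⊗ₜ g) =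
    A.of (TensorProduct.map (LinearMap.mul k L a ∘ₗ A.act.flip b) ((LinearMap.mul k H).flip g)
      (comul h)) := by
  rw [mul_def, LinearEquiv.symm_apply_apply, LinearEquiv.symm_apply_apply, smashMul_tmul, diag_tmul,
    ← LinearMap.comp_apply, LinearMap.rTensor_comp_map]

end LeftModuleAlgebra

namespace RightModuleAlgebra

variable {k H R : Type*} [CommRing k] [Ring H] [Bialgebra k H] [Ring R] [Algebra k R]
variable (B : RightModuleAlgebra k H R)

/-- The operator `g ⊗ a ↦ g h₁ ⊗ (a ◃ h₂)` on `H ⊗ R`. -/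
def diag : H →ₗ[k] (H ⊗[k] R →ₗ[k] H ⊗[k] R) :=
  TensorProduct.homTensorHomMap (RingHom.id k) H R H R ∘ₗ
    TensorProduct.map (LinearMap.mul k H).flip B.act.flip ∘ₗ comul

/-- `(g ⊗ a) (h ⊗ b) = g h₁ ⊗ (a ◃ h₂) b` -/
def smashMul : H ⊗[k] R →ₗ[k] (H ⊗[k] R →ₗ[k] H ⊗[k] R) :=
  LinearMap.flip <| TensorProduct.lift (LinearMap.mk₂ k
    (fun h b => ((LinearMap.mul k R).flip b).lTensor H ∘ₗ B.diag h)
    (fun h h' b => by rw [map_add, LinearMap.comp_add])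
    (fun c h b => by rw [map_smul, LinearMap.comp_smul])
    (fun h b b' => by rw [map_add, LinearMap.lTensor_add, LinearMap.add_comp])
    (fun c h b => by rw [map_smul, LinearMap.lTensor_smul, LinearMap.smul_comp]))

theorem diag_tmul (h g : H) (a : R) : B.diag h (g ⊗ₜ a) =
    TensorProduct.map (LinearMap.mul k H g) (B.act a) (comul h) := by
  simp only [diag, LinearMap.comp_apply]
  induction comul (R := k) h using TensorProduct.induction_on with
  | zero => simp
  | tmul x y => simp
  | add x y hx hy => simp [hx, hy]

theorem smashMul_tmul (s : H ⊗[k] R) (h : H) (b : R) :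
    B.smashMul s (h ⊗ₜ b) = ((LinearMap.mul k R).flip b).lTensor H (B.diag h s) := rfl

theorem smashMul_lTensor (b : R) (s t : H ⊗[k] R) :
    B.smashMul s (((LinearMap.mul k R).flip b).lTensor H t) =
      ((LinearMap.mul k R).flip b).lTensor H (B.smashMul s t) := by
  induction t using TensorProduct.induction_on with
  | zero => simp
  | add x y hx hy => simp [hx, hy]
  | tmul h a =>
    simp only [LinearMap.lTensor_tmul, LinearMap.flip_apply, LinearMap.mul_apply', smashMul_tmul]
    have : ((LinearMap.mul k R).flip (a * b)).lTensor H =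
        ((LinearMap.mul k R).flip b).lTensor H ∘ₗ ((LinearMap.mul k R).flip a).lTensor H := by
      rw [← LinearMap.lTensor_comp]
      congr 1
      ext c
      simp [mul_assoc]
    rw [this, LinearMap.comp_apply]

theorem diag_mul (h g : H) (t : H ⊗[k] R) : B.diag (h * g) t = B.diag g (B.diag h t) := by
  simp only [diag, LinearMap.comp_apply, Bialgebra.comul_mul]
  generalize comul (R := k) h = u
  generalize comul (R := k) g = v
  induction u using TensorProduct.induction_on with
  | zero => simp
  | add x y hx hy => simp [hx, hy, add_mul]
  | tmul x y =>
    induction v using TensorProduct.induction_on with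
    | zero => simp
    | add x y hx hy => simp [hx, hy, mul_add]
    | tmul x' y' =>
      induction t using TensorProduct.induction_on with
      | zero => simp
      | add p q hp hq => simp only [map_add, hp, hq]
      | tmul b f => simp [B.act_mul, mul_assoc]

theorem diag_lTensor (h : H) (a : R) (t : H ⊗[k] R) :
    B.diag h (((LinearMap.mul k R).flip a).lTensor H t) = B.smashMul t (B.diag h (1 ⊗ₜ a)) := by
  induction t using TensorProduct.induction_on with
  | zero => simp
  | add x y hx hy => simp [hx, hy]
  | tmul f c =>
    -- both sides are images of the iterated coproduct of `h`
    let F : H ⊗[k] (H ⊗[k] H) →ₗ[k] H ⊗[k] R :=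
      (LinearMap.mul' k R).lTensor H ∘ₗ
        TensorProduct.map (LinearMap.mul k H f) (TensorProduct.map (B.act c) (B.act a))
    have h1 : B.diag h (f ⊗ₜ (c * a)) = F ((comul (R := k)).lTensor H (comul h)) := by
      rw [diag_tmul]
      induction comul (R := k) h using TensorProduct.induction_on with
      | zero => simp
      | add x y hx hy => simp only [map_add, hx, hy]
      | tmul x y =>
        simp only [TensorProduct.map_tmul, LinearMap.lTensor_tmul, B.mul_act]
        simp [F]
    have h2 : B.smashMul (f ⊗ₜ c) (B.diag h (1 ⊗ₜ a)) =
        F (TensorProduct.assoc k H H H ((comul (R := k)).rTensor H (comul h))) := by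
      rw [diag_tmul]
      induction comul (R := k) h using TensorProduct.induction_on with
      | zero => simp
      | add x y hx hy => simp only [map_add, hx, hy]
      | tmul x y =>
        simp only [TensorProduct.map_tmul, LinearMap.rTensor_tmul,
          smashMul_tmul, LinearMap.mul_apply', one_mul, diag_tmul]
        induction comul (R := k) x using TensorProduct.induction_on with
        | zero => simp
        | add x y hx hy => simp only [map_add, hx, hy, TensorProduct.add_tmul]
        | tmul x' y' => simp [F]
    rw [LinearMap.lTensor_tmul, LinearMap.flip_apply, LinearMap.mul_apply', h1, h2,
      Coalgebra.coassoc_apply]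

theorem diag_smashMul (h : H) (s t : H ⊗[k] R) :
    B.diag h (B.smashMul s t) = B.smashMul s (B.diag h t) := by
  induction t using TensorProduct.induction_on with
  | zero => simp
  | add x y hx hy => simp [hx, hy]
  | tmul g a =>
    rw [smashMul_tmul, diag_lTensor, diag_tmul, diag_tmul]
    induction comul (R := k) h using TensorProduct.induction_on with
    | zero => simp
    | add x y hx hy => simp only [map_add, hx, hy]
    | tmul x y => simp [smashMul_tmul, diag_mul]

theorem smashMul_assoc (s t u : H ⊗[k] R) :
    B.smashMul (B.smashMul s t) u = B.smashMul s (B.smashMul t u) := by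
  induction u using TensorProduct.induction_on with
  | zero => simp
  | add x y hx hy => simp [hx, hy]
  | tmul h b => rw [smashMul_tmul, smashMul_tmul, smashMul_lTensor, diag_smashMul]

theorem smashMul_one (t : H ⊗[k] R) : B.smashMul t (1 ⊗ₜ 1) = t := by
  induction t using TensorProduct.induction_on with
  | zero => simp
  | add x y hx hy => simp [hx, hy]
  | tmul h a => simp [smashMul_tmul, diag_tmul, Algebra.TensorProduct.one_def, B.act_one]

theorem one_smashMul (t : H ⊗[k] R) : B.smashMul (1 ⊗ₜ 1) t = t := by
  induction t using TensorProduct.induction_on with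
  | zero => simp
  | add x y hx hy => simp [hx, hy]
  | tmul h a =>
    have key : B.diag h (1 ⊗ₜ 1) = h ⊗ₜ[k] (1 : R) := by
      have := congrArg ((Algebra.linearMap k R).lTensor H)
        (Coalgebra.lTensor_counit_comul (R := k) h)
      rw [LinearMap.lTensor_tmul, Algebra.linearMap_apply, map_one] at this
      rw [diag_tmul, ← this]
      induction comul (R := k) h using TensorProduct.induction_on with
      | zero => simp
      | add x y hx hy => simp only [map_add, hx, hy]
      | tmul x y => simp [B.one_act, Algebra.algebraMap_eq_smul_one]
    rw [smashMul_tmul, key]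
    simp

/-- The smash product algebra `H ♯ R`: the vector space `H ⊗ R` with the product
`(g ⊗ a) (h ⊗ b) = g h₁ ⊗ (a ◃ h₂) b`. -/
@[nolint unusedArguments]
def Smash (_ : RightModuleAlgebra k H R) : Type _ := H ⊗[k] R

instance : AddCommGroup B.Smash := inferInstanceAs (AddCommGroup (H ⊗[k] R))

instance : Module k B.Smash := inferInstanceAs (Module k (H ⊗[k] R))

/-- The underlying linear identification of `H ⊗ R` with `H ♯ R`. -/
def of : H ⊗[k] R ≃ₗ[k] B.Smash := LinearEquiv.refl k (H ⊗[k] R)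

instance : Ring B.Smash where
  __ := (inferInstance : AddCommGroup B.Smash)
  mul s t := B.of (B.smashMul (B.of.symm s) (B.of.symm t))
  one := B.of (1 ⊗ₜ 1)
  left_distrib s t u := by
    change B.of _ = B.of _ + B.of _
    simp
  right_distrib s t u := by
    change B.of _ = B.of _ + B.of _
    simp
  zero_mul s := by
    change B.of _ = _
    simp
  mul_zero s := by
    change B.of _ = _
    simp
  mul_assoc s t u := congrArg B.of (B.smashMul_assoc _ _ _)
  one_mul s := B.one_smashMul s
  mul_one s := B.smashMul_one s

theorem mul_def (s t : B.Smash) : s * t = B.of (B.smashMul (B.of.symm s) (B.of.symm t)) := rfl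

theorem one_def : (1 : B.Smash) = B.of (1 ⊗ₜ 1) := rfl

instance : Algebra k B.Smash :=
  Algebra.ofModule (fun c s t => by simp [mul_def]) (fun c s t => by simp [mul_def])

theorem of_mul_of (g h : H) (a b : R) : B.of (g ⊗ₜ a) * B.of (h ⊗ₜ b) =
    B.of (TensorProduct.map (LinearMap.mul k H g) ((LinearMap.mul k R).flip b ∘ₗ B.act a)
      (comul h)) := by
  rw [mul_def, LinearEquiv.symm_apply_apply, LinearEquiv.symm_apply_apply, smashMul_tmul, diag_tmul,
    ← LinearMap.comp_apply, LinearMap.lTensor_comp_map]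

end RightModuleAlgebra

/-! ### Antihomomorphisms -/

/-- A linear map of algebras that is a unital antihomomorphism. -/
structure IsAntiHom {k P Q : Type*} [CommRing k] [Ring P] [Algebra k P] [Ring Q] [Algebra k Q]
    (f : P →ₗ[k] Q) : Prop where
  map_one : f 1 = 1
  map_mul : ∀ a b, f (a * b) = f b * f a

/-- The linear bijection `P → Q` underlying an antiisomorphism of algebras. -/
def antiLin {k P Q : Type*} [CommRing k] [Ring P] [Algebra k P] [Ring Q] [Algebra k Q]
    (φ : P ≃ₐ[k] Qᵐᵒᵖ) : P ≃ₗ[k] Q :=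
  φ.toLinearEquiv.trans (MulOpposite.opLinearEquiv k).symm

/-! ### Yetter-Drinfeld module algebras -/

section YetterDrinfeld

variable {k H L R : Type*} [CommRing k] [Ring H] [Bialgebra k H]
  [Ring L] [Algebra k L] [Ring R] [Algebra k R]

/-- The left-right Yetter-Drinfeld condition
`(h₁ ▹ x₀) ⊗ h₂ x₁ = (h₂ ▹ x)₀ ⊗ (h₂ ▹ x)₁ h₁`. -/
def LeftRightYDCondition (A : LeftModuleAlgebra k H L) (ρ : RightComodule k H L) : Prop :=
  ∀ (h : H) (x : L),
    TensorProduct.homTensorHomMap (RingHom.id k) L H L H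
        (TensorProduct.map A.act (LinearMap.mul k H) (comul h)) (ρ.coact x) =
      (LinearMap.mul' k H).lTensor L (TensorProduct.assoc k L H H
        ((ρ.coact ∘ₗ A.act.flip x).rTensor H (TensorProduct.comm k H H (comul h))))

/-- The comodule algebra property over `Hᵒᵖ`: `(x y)₀ ⊗ (x y)₁ = x₀ y₀ ⊗ y₁ x₁` and
`ρ 1 = 1 ⊗ 1`. -/
def RightComoduleAlgebraProperty (ρ : RightComodule k H L) : Prop :=
  (∀ x y : L, ρ.coact (x * y) =
    TensorProduct.map (LinearMap.mul' k L) (LinearMap.mul' k H ∘ₗ TensorProduct.comm k H H)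
      (TensorProduct.tensorTensorTensorComm k L H L H (ρ.coact x ⊗ₜ ρ.coact y))) ∧
  ρ.coact 1 = 1 ⊗ₜ 1

/-- Braided commutativity: `x₀ (x₁ ▹ a) = a x`. -/
def LeftRightBraidedCommutative (A : LeftModuleAlgebra k H L) (ρ : RightComodule k H L) : Prop :=
  ∀ a x : L, LinearMap.mul' k L ((A.act.flip a).lTensor L (ρ.coact x)) = a * x

/-- `(L, ▹, ρ)` is a braided commutative left-right Yetter-Drinfeld `H`-module algebra. -/
structure IsBraidedCommLeftRightYD (A : LeftModuleAlgebra k H L) (ρ : RightComodule k H L) :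
    Prop where
  yetterDrinfeld : LeftRightYDCondition A ρ
  comoduleAlgebra : RightComoduleAlgebraProperty ρ
  braidedComm : LeftRightBraidedCommutative A ρ

/-- The right-left Yetter-Drinfeld condition
`y₋₁ h₁ ⊗ (y₀ ◃ h₂) = h₂ (y ◃ h₁)₋₁ ⊗ (y ◃ h₁)₀`. -/
def RightLeftYDCondition (B : RightModuleAlgebra k H R) (lam : LeftComodule k H R) : Prop :=
  ∀ (h : H) (y : R),
    TensorProduct.homTensorHomMap (RingHom.id k) H R H R
        (TensorProduct.map (LinearMap.mul k H).flip B.act.flip (comul h)) (lam.coact y) =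
      (LinearMap.mul' k H).rTensor R ((TensorProduct.assoc k H H R).symm
        ((lam.coact ∘ₗ B.act y).lTensor H (TensorProduct.comm k H H (comul h))))

/-- The comodule algebra property over `Hᵒᵖ`: `(x y)₋₁ ⊗ (x y)₀ = y₋₁ x₋₁ ⊗ x₀ y₀` and
`lam 1 = 1 ⊗ 1`. -/
def LeftComoduleAlgebraProperty (lam : LeftComodule k H R) : Prop :=
  (∀ x y : R, lam.coact (x * y) =
    TensorProduct.map (LinearMap.mul' k H ∘ₗ TensorProduct.comm k H H) (LinearMap.mul' k R)
      (TensorProduct.tensorTensorTensorComm k H R H R (lam.coact x ⊗ₜ lam.coact y))) ∧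
  lam.coact 1 = 1 ⊗ₜ 1

/-- Braided commutativity: `(a ◃ y₋₁) y₀ = y a`. -/
def RightLeftBraidedCommutative (B : RightModuleAlgebra k H R) (lam : LeftComodule k H R) :
    Prop :=
  ∀ a y : R, LinearMap.mul' k R ((B.act a).rTensor R (lam.coact y)) = y * a

/-- `(R, ◃, lam)` is a braided commutative right-left Yetter-Drinfeld `H`-module algebra. -/
structure IsBraidedCommRightLeftYD (B : RightModuleAlgebra k H R) (lam : LeftComodule k H R) :
    Prop where
  yetterDrinfeld : RightLeftYDCondition B lam
  comoduleAlgebra : LeftComoduleAlgebraProperty lam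
  braidedComm : RightLeftBraidedCommutative B lam

end YetterDrinfeld

/-! ### Bialgebroids and symmetric Hopf algebroids -/

section Bialgebroid

variable {k A K M : Type*} [CommRing k] [Ring A] [Algebra k A] [Ring K] [Algebra k K]
  [AddCommGroup M] [Module k M]

/-- The relations defining `K ⊗_A K` inside `K ⊗ K` for the `A`-bimodule structure
`a . x . b = α a * β b * x`: the elements `x . a ⊗ y - x ⊗ a . y`. -/
def leftRel (α β : A →ₗ[k] K) : Submodule k (K ⊗[k] K) :=
  Submodule.span k {t | ∃ (a : A) (x y : K), t = (β a * x) ⊗ₜ y - x ⊗ₜ (α a * y)}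

/-- The relations defining `K ⊗_A K` inside `K ⊗ K` for the `A`-bimodule structure
`b . x . a = x * α a * β b`: the elements `x . a ⊗ y - x ⊗ a . y`. -/
def rightRel (α β : A →ₗ[k] K) : Submodule k (K ⊗[k] K) :=
  Submodule.span k {t | ∃ (a : A) (x y : K), t = (x * α a) ⊗ₜ y - x ⊗ₜ (y * β a)}

/-- `K ⊗_A K` for a left bialgebroid. -/
abbrev LeftTensor (α β : A →ₗ[k] K) : Type _ := (K ⊗[k] K) ⧸ leftRel α β

/-- `K ⊗_A K` for a right bialgebroid. -/
abbrev RightTensor (α β : A →ₗ[k] K) : Type _ := (K ⊗[k] K) ⧸ rightRel α β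

/-- Multiplication from the right by `s ∈ K ⊗ K` on `K ⊗_A K`, for a left bialgebroid. -/
def leftTensorMulRight (α β : A →ₗ[k] K) (s : K ⊗[k] K) : LeftTensor α β →ₗ[k] LeftTensor α β :=
  Submodule.mapQ _ _ (LinearMap.mulRight k s) (by
    rw [leftRel, Submodule.span_le]
    rintro _ ⟨a, x, y, rfl⟩
    induction s using TensorProduct.induction_on with
    | zero => simp
    | add s t hs ht =>
      simp only [SetLike.mem_coe, Submodule.mem_comap, LinearMap.mulRight_apply, mul_add] at hs ht ⊢
      exact Submodule.add_mem _ hs ht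
    | tmul g h =>
      refine Submodule.subset_span ⟨a, x * g, y * h, ?_⟩
      simp [sub_mul, mul_assoc])

/-- Multiplication from the left by `s ∈ K ⊗ K` on `K ⊗_A K`, for a right bialgebroid. -/
def rightTensorMulLeft (α β : A →ₗ[k] K) (s : K ⊗[k] K) :
    RightTensor α β →ₗ[k] RightTensor α β :=
  Submodule.mapQ _ _ (LinearMap.mulLeft k s) (by
    rw [rightRel, Submodule.span_le]
    rintro _ ⟨a, x, y, rfl⟩
    induction s using TensorProduct.induction_on with
    | zero => simp
    | add s t hs ht =>
      simp only [SetLike.mem_coe, Submodule.mem_comap, LinearMap.mulLeft_apply, add_mul] at hs ht ⊢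
      exact Submodule.add_mem _ hs ht
    | tmul g h =>
      refine Submodule.subset_span ⟨a, g * x, h * y, ?_⟩
      simp [mul_sub, mul_assoc])

/-- For relations `P`, `Q` defining tensor products `K ⊗_P K` and `K ⊗_Q K`, the relations
defining `K ⊗_P K ⊗_Q K` inside `K ⊗ (K ⊗ K)`. -/
def tripleRel (P Q : Submodule k (K ⊗[k] K)) : Submodule k (K ⊗[k] (K ⊗[k] K)) :=
  LinearMap.range ((TensorProduct.assoc k K K K).toLinearMap ∘ₗ P.subtype.rTensor K) ⊔
    LinearMap.range (Q.subtype.lTensor K)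

/-- `K ⊗_P K ⊗_Q K` -/
abbrev Triple (P Q : Submodule k (K ⊗[k] K)) : Type _ := (K ⊗[k] (K ⊗[k] K)) ⧸ tripleRel P Q

/-- `[x ⊗ y], z ↦ [x ⊗ y ⊗ z]`, from `(K ⊗_P K) × K` to `K ⊗_P K ⊗_Q K`. -/
def glueRight (P Q : Submodule k (K ⊗[k] K)) :
    (K ⊗[k] K) ⧸ P →ₗ[k] K →ₗ[k] Triple P Q :=
  P.liftQ (TensorProduct.curry
    ((tripleRel P Q).mkQ ∘ₗ (TensorProduct.assoc k K K K).toLinearMap)) (by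
      intro p hp
      ext z
      simp only [TensorProduct.curry_apply, LinearMap.comp_apply, LinearMap.zero_apply,
        Submodule.mkQ_apply, Submodule.Quotient.mk_eq_zero]
      exact Submodule.mem_sup_left ⟨(⟨p, hp⟩ : P) ⊗ₜ z, by simp⟩)

/-- `x, [y ⊗ z] ↦ [x ⊗ y ⊗ z]`, from `K × (K ⊗_Q K)` to `K ⊗_P K ⊗_Q K`. -/
def glueLeft (P Q : Submodule k (K ⊗[k] K)) :
    K →ₗ[k] (K ⊗[k] K) ⧸ Q →ₗ[k] Triple P Q :=
  LinearMap.flip <| Q.liftQ (LinearMap.flip (TensorProduct.curry (tripleRel P Q).mkQ)) (by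
      intro q hq
      ext x
      simp only [LinearMap.flip_apply, TensorProduct.curry_apply, LinearMap.zero_apply,
        Submodule.mkQ_apply, Submodule.Quotient.mk_eq_zero]
      exact Submodule.mem_sup_right ⟨x ⊗ₜ (⟨q, hq⟩ : Q), by simp⟩)

/-- The map `f` on `K ⊗ K` descends to `K ⊗_P K`, and the composite of the resulting map with
`Δ : K → K ⊗_P K` is `g`. -/
def InducedComp {P : Submodule k (K ⊗[k] K)} (f : K ⊗[k] K →ₗ[k] M)
    (Δ : K →ₗ[k] (K ⊗[k] K) ⧸ P) (g : K →ₗ[k] M) : Prop :=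
  ∃ F : (K ⊗[k] K) ⧸ P →ₗ[k] M, F ∘ₗ P.mkQ = f ∧ F ∘ₗ Δ = g

/-- For `Δ₁ : K → K ⊗_P K` and `Δ₂ : K → K ⊗_Q K`, the maps
`Δ₁ ⊗_Q id : K ⊗_Q K → K ⊗_P K ⊗_Q K` and `id ⊗_P Δ₂ : K ⊗_P K → K ⊗_P K ⊗_Q K` are well defined
and satisfy `(Δ₁ ⊗_Q id) ∘ Δ₂ = (id ⊗_P Δ₂) ∘ Δ₁`. -/
def MixedCoassoc {P Q : Submodule k (K ⊗[k] K)} (Δ₁ : K →ₗ[k] (K ⊗[k] K) ⧸ P)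
    (Δ₂ : K →ₗ[k] (K ⊗[k] K) ⧸ Q) : Prop :=
  ∃ (D₁ : (K ⊗[k] K) ⧸ Q →ₗ[k] Triple P Q) (D₂ : (K ⊗[k] K) ⧸ P →ₗ[k] Triple P Q),
    (∀ x y, D₁ (Q.mkQ (x ⊗ₜ y)) = glueRight P Q (Δ₁ x) y) ∧
    (∀ x y, D₂ (P.mkQ (x ⊗ₜ y)) = glueLeft P Q x (Δ₂ y)) ∧
    D₁ ∘ₗ Δ₂ = D₂ ∘ₗ Δ₁

/-- `(K, α, β, Δ, ε)` is a left bialgebroid over `A`. -/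
structure IsLeftBialgebroid (α β : A →ₗ[k] K) (Δ : K →ₗ[k] LeftTensor α β) (ε : K →ₗ[k] A) :
    Prop where
  source_one : α 1 = 1
  source_mul : ∀ a b, α (a * b) = α a * α b
  target : IsAntiHom β
  commute : ∀ a b, α a * β b = β b * α a
  /-- `Δ` is a map of `A`-bimodules. -/
  comul_bimod : ∀ a b, InducedComp ((leftRel α β).mkQ ∘ₗ LinearMap.mulLeft k (α a ⊗ₜ β b)) Δ
    (Δ ∘ₗ LinearMap.mulLeft k (α a * β b))
  /-- `ε` is a map of `A`-bimodules. -/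
  counit_bimod : ∀ a b x, ε (α a * β b * x) = a * ε x * b
  coassoc : MixedCoassoc Δ Δ
  /-- `ε(x₁) . x₂ = x` -/
  counit_left : InducedComp (LinearMap.mul' k K ∘ₗ (α ∘ₗ ε).rTensor K) Δ LinearMap.id
  /-- `x₁ . ε(x₂) = x` -/
  counit_right : InducedComp (LinearMap.mul' k K ∘ₗ (β ∘ₗ ε).rTensor K ∘ₗ
    (TensorProduct.comm k K K).toLinearMap) Δ LinearMap.id
  /-- `x ⊗ (g ⊗ h) ↦ Δ(x) (g ⊗ h)` factors through a left unital action of `K` on `K ⊗_A K`. -/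
  comul_action : ∃ act : K →ₗ[k] LeftTensor α β →ₗ[k] LeftTensor α β,
    (∀ x s, act x ((leftRel α β).mkQ s) = leftTensorMulRight α β s (Δ x)) ∧
    (∀ t, act 1 t = t) ∧ ∀ x y t, act (x * y) t = act x (act y t)
  /-- `x ⊗ a ↦ ε (x * α a)` is a left unital action of `K` on `A`. -/
  counit_action_one : ∀ a, ε (1 * α a) = a
  counit_action_mul : ∀ x y a, ε (x * y * α a) = ε (x * α (ε (y * α a)))

/-- `(K, α, β, Δ, ε)` is a right bialgebroid over `A`. -/
structure IsRightBialgebroid (α β : A →ₗ[k] K) (Δ : K →ₗ[k] RightTensor α β) (ε : K →ₗ[k] A) :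
    Prop where
  source_one : α 1 = 1
  source_mul : ∀ a b, α (a * b) = α a * α b
  target : IsAntiHom β
  commute : ∀ a b, α a * β b = β b * α a
  /-- `Δ` is a map of `A`-bimodules. -/
  comul_bimod : ∀ a b, InducedComp ((rightRel α β).mkQ ∘ₗ LinearMap.mulRight k (β b ⊗ₜ α a)) Δ
    (Δ ∘ₗ LinearMap.mulRight k (α a * β b))
  /-- `ε` is a map of `A`-bimodules. -/
  counit_bimod : ∀ a b x, ε (x * (α a * β b)) = b * ε x * a
  coassoc : MixedCoassoc Δ Δ
  /-- `ε(x₁) . x₂ = x` -/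
  counit_left : InducedComp (LinearMap.mul' k K ∘ₗ (β ∘ₗ ε).lTensor K ∘ₗ
    (TensorProduct.comm k K K).toLinearMap) Δ LinearMap.id
  /-- `x₁ . ε(x₂) = x` -/
  counit_right : InducedComp (LinearMap.mul' k K ∘ₗ (α ∘ₗ ε).lTensor K) Δ LinearMap.id
  /-- `(g ⊗ h) ⊗ x ↦ (g ⊗ h) Δ(x)` factors through a right unital action of `K` on `K ⊗_A K`. -/
  comul_action : ∃ act : RightTensor α β →ₗ[k] K →ₗ[k] RightTensor α β,
    (∀ s x, act ((rightRel α β).mkQ s) x = rightTensorMulLeft α β s (Δ x)) ∧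
    (∀ t, act t 1 = t) ∧ ∀ t x y, act t (x * y) = act (act t x) y
  /-- `a ⊗ x ↦ ε (α a * x)` is a right unital action of `K` on `A`. -/
  counit_action_one : ∀ a, ε (α a * 1) = a
  counit_action_mul : ∀ a x y, ε (α a * (x * y)) = ε (α (ε (α a * x)) * y)

end Bialgebroid

section HopfAlgebroid

variable {k L R K K' : Type*} [CommRing k] [Ring L] [Algebra k L] [Ring R] [Algebra k R]
  [Ring K] [Algebra k K] [Ring K'] [Algebra k K']

/-- Structure maps of the type of those of a symmetric Hopf algebroid with total algebra `K`,
left base algebra `L` and right base algebra `R`. -/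
@[ext]
structure HopfAlgebroidData (k L R K : Type*) [CommRing k] [Ring L] [Algebra k L]
    [Ring R] [Algebra k R] [Ring K] [Algebra k K] where
  αL : L →ₗ[k] K
  βL : L →ₗ[k] K
  ΔL : K →ₗ[k] LeftTensor αL βL
  εL : K →ₗ[k] L
  αR : R →ₗ[k] K
  βR : R →ₗ[k] K
  ΔR : K →ₗ[k] RightTensor αR βR
  εR : K →ₗ[k] R
  τ : K →ₗ[k] K

/-- The structure maps form a symmetric Hopf algebroid. -/
structure IsSymmetricHopfAlgebroid (D : HopfAlgebroidData k L R K) : Prop where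
  left : IsLeftBialgebroid D.αL D.βL D.ΔL D.εL
  right : IsRightBialgebroid D.αR D.βR D.ΔR D.εR
  antipode : IsAntiHom D.τ
  αL_εL_βR : ∀ y, D.αL (D.εL (D.βR y)) = D.βR y
  βL_εL_αR : ∀ y, D.βL (D.εL (D.αR y)) = D.αR y
  αR_εR_βL : ∀ x, D.αR (D.εR (D.βL x)) = D.βL x
  βR_εR_αL : ∀ x, D.βR (D.εR (D.αL x)) = D.αL x
  /-- `(Δ_R ⊗_L id) ∘ Δ_L = (id ⊗_R Δ_L) ∘ Δ_R` -/
  coassoc_RL : MixedCoassoc D.ΔR D.ΔL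
  /-- `(Δ_L ⊗_R id) ∘ Δ_R = (id ⊗_L Δ_R) ∘ Δ_L` -/
  coassoc_LR : MixedCoassoc D.ΔL D.ΔR
  τ_βL : ∀ x, D.τ (D.βL x) = D.αL x
  τ_βR : ∀ y, D.τ (D.βR y) = D.αR y
  /-- `μ ∘ (τ ⊗ id) ∘ Δ_L = α_R ∘ ε_R` -/
  antipode_left : InducedComp (LinearMap.mul' k K ∘ₗ D.τ.rTensor K) D.ΔL (D.αR ∘ₗ D.εR)
  /-- `μ ∘ (id ⊗ τ) ∘ Δ_R = α_L ∘ ε_L` -/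
  antipode_right : InducedComp (LinearMap.mul' k K ∘ₗ D.τ.lTensor K) D.ΔR (D.αL ∘ₗ D.εL)

/-- The algebra isomorphism `Ψ : K → K'` carries the structure maps `D` to `D'`. -/
structure IsHopfAlgebroidIso (D : HopfAlgebroidData k L R K) (D' : HopfAlgebroidData k L R K')
    (Ψ : K ≃ₐ[k] K') : Prop where
  αL : ∀ x, Ψ (D.αL x) = D'.αL x
  βL : ∀ x, Ψ (D.βL x) = D'.βL x
  εL : ∀ z, D'.εL (Ψ z) = D.εL z
  /-- `(Ψ ⊗_L Ψ) ∘ Δ_L = Δ_L' ∘ Ψ` -/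
  ΔL : InducedComp ((leftRel D'.αL D'.βL).mkQ ∘ₗ
    TensorProduct.map Ψ.toLinearMap Ψ.toLinearMap) D.ΔL (D'.ΔL ∘ₗ Ψ.toLinearMap)
  αR : ∀ y, Ψ (D.αR y) = D'.αR y
  βR : ∀ y, Ψ (D.βR y) = D'.βR y
  εR : ∀ z, D'.εR (Ψ z) = D.εR z
  /-- `(Ψ ⊗_R Ψ) ∘ Δ_R = Δ_R' ∘ Ψ` -/
  ΔR : InducedComp ((rightRel D'.αR D'.βR).mkQ ∘ₗ
    TensorProduct.map Ψ.toLinearMap Ψ.toLinearMap) D.ΔR (D'.ΔR ∘ₗ Ψ.toLinearMap)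
  τ : ∀ z, Ψ (D.τ z) = D'.τ (Ψ z)

end HopfAlgebroid

/-! ### Structure maps on the smash product algebras -/

namespace LeftModuleAlgebra

section

variable {k H L : Type*} [CommRing k] [Ring H] [Bialgebra k H] [Ring L] [Algebra k L]
variable (A : LeftModuleAlgebra k H L)

/-- `x ↦ x ♯ 1` -/
def inl : L →ₗ[k] A.Smash := A.of.toLinearMap ∘ₗ (TensorProduct.mk k L H).flip 1

/-- `f ↦ 1 ♯ f` -/
def inr : H →ₗ[k] A.Smash := A.of.toLinearMap ∘ₗ TensorProduct.mk k L H 1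

/-- The linear map on `L ♯ H` with `x ♯ f ↦ F x f`. -/
def lift {M : Type*} [AddCommGroup M] [Module k M] (F : L →ₗ[k] H →ₗ[k] M) :
    A.Smash →ₗ[k] M :=
  TensorProduct.lift F ∘ₗ A.of.symm.toLinearMap

/-- `f ⊗ x ↦ f · x = (1 ♯ f) (x ♯ 1)` -/
def hMul : H ⊗[k] L →ₗ[k] A.Smash :=
  LinearMap.mul' k A.Smash ∘ₗ TensorProduct.map A.inr A.inl

/-- The coaction, as a map `L → L ♯ H`. -/
def target (ρ : RightComodule k H L) : L →ₗ[k] A.Smash := A.of.toLinearMap ∘ₗ ρ.coact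

/-- `x ♯ f ↦ [(x ♯ f₁) ⊗ (1 ♯ f₂)]` in the quotient of `(L ♯ H) ⊗ (L ♯ H)` by `P`. -/
def coprod (P : Submodule k (A.Smash ⊗[k] A.Smash)) :
    A.Smash →ₗ[k] (A.Smash ⊗[k] A.Smash) ⧸ P :=
  P.mkQ ∘ₗ TensorProduct.map A.of.toLinearMap A.inr ∘ₗ
    (TensorProduct.assoc k L H H).symm.toLinearMap ∘ₗ
    (comul (R := k) (A := H)).lTensor L ∘ₗ A.of.symm.toLinearMap

/-- `x ♯ f ↦ ε(f) x` -/
def counit : A.Smash →ₗ[k] L :=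
  A.lift ((LinearMap.lsmul k L).flip.compl₂ (Coalgebra.counit (R := k) (A := H)))

end

section

variable {k H L : Type*} [CommRing k] [Ring H] [HopfAlgebra k H] [Ring L] [Algebra k L]
variable (A : LeftModuleAlgebra k H L)

/-- `τ (x ♯ f) = S f S²(x₁) · x₀` -/
def antipode (ρ : RightComodule k H L) : A.Smash →ₗ[k] A.Smash :=
  A.lift (LinearMap.mk₂ k
    (fun x f => A.hMul (TensorProduct.map
      (LinearMap.mul k H (HopfAlgebra.antipode k f) ∘ₗ HopfAlgebra.antipode k ∘ₗ HopfAlgebra.antipode k) LinearMap.id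
      (TensorProduct.comm k L H (ρ.coact x))))
    (fun x x' f => by simp only [map_add])
    (fun c x f => by simp only [map_smul])
    (fun x f f' => by
      simp only [map_add, LinearMap.add_comp, TensorProduct.map_add_left, LinearMap.add_apply])
    (fun c x f => by
      simp only [map_smul, LinearMap.smul_comp, TensorProduct.map_smul_left, LinearMap.smul_apply]))

end

end LeftModuleAlgebra

namespace RightModuleAlgebra

section

variable {k H R : Type*} [CommRing k] [Ring H] [Bialgebra k H] [Ring R] [Algebra k R]
variable (B : RightModuleAlgebra k H R)

/-- `f ↦ f ♯ 1` -/
def inl : H →ₗ[k] B.Smash := B.of.toLinearMap ∘ₗ (TensorProduct.mk k H R).flip 1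

/-- `y ↦ 1 ♯ y` -/
def inr : R →ₗ[k] B.Smash := B.of.toLinearMap ∘ₗ TensorProduct.mk k H R 1

/-- The linear map on `H ♯ R` with `f ♯ y ↦ F f y`. -/
def lift {M : Type*} [AddCommGroup M] [Module k M] (F : H →ₗ[k] R →ₗ[k] M) :
    B.Smash →ₗ[k] M :=
  TensorProduct.lift F ∘ₗ B.of.symm.toLinearMap

/-- `y ⊗ f ↦ y · f = (1 ♯ y) (f ♯ 1)` -/
def mulH : R ⊗[k] H →ₗ[k] B.Smash :=
  LinearMap.mul' k B.Smash ∘ₗ TensorProduct.map B.inr B.inl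

/-- The coaction, as a map `R → H ♯ R`. -/
def target (lam : LeftComodule k H R) : R →ₗ[k] B.Smash := B.of.toLinearMap ∘ₗ lam.coact

/-- `f ♯ y ↦ [(f₁ ♯ 1) ⊗ (f₂ ♯ y)]` in the quotient of `(H ♯ R) ⊗ (H ♯ R)` by `P`. -/
def coprod (P : Submodule k (B.Smash ⊗[k] B.Smash)) :
    B.Smash →ₗ[k] (B.Smash ⊗[k] B.Smash) ⧸ P :=
  P.mkQ ∘ₗ TensorProduct.map B.inl B.of.toLinearMap ∘ₗ
    (TensorProduct.assoc k H H R).toLinearMap ∘ₗ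
    (comul (R := k) (A := H)).rTensor R ∘ₗ B.of.symm.toLinearMap

/-- `f ♯ y ↦ ε(f) y` -/
def counit : B.Smash →ₗ[k] R :=
  B.lift (LinearMap.lsmul k R ∘ₗ Coalgebra.counit (R := k) (A := H))

end

section

variable {k H R : Type*} [CommRing k] [Ring H] [HopfAlgebra k H] [Ring R] [Algebra k R]
variable (B : RightModuleAlgebra k H R)

/-- `τ' (f ♯ y) = y₀ · S²(y₋₁) S f` -/
def antipode (lam : LeftComodule k H R) : B.Smash →ₗ[k] B.Smash :=
  B.lift (LinearMap.mk₂ k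
    (fun f y => B.mulH (TensorProduct.map LinearMap.id
      ((LinearMap.mul k H).flip (HopfAlgebra.antipode k f) ∘ₗ HopfAlgebra.antipode k ∘ₗ HopfAlgebra.antipode k)
      (TensorProduct.comm k H R (lam.coact y))))
    (fun f f' y => by
      simp only [map_add, LinearMap.add_comp, TensorProduct.map_add_right, LinearMap.add_apply])
    (fun c f y => by
      simp only [map_smul, LinearMap.smul_comp, TensorProduct.map_smul_right,
        LinearMap.smul_apply])
    (fun f y y' => by simp only [map_add])
    (fun c f y => by simp only [map_smul]))

end

end RightModuleAlgebra

section Compatible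

open HopfAlgebra (antipode)

variable {k H L R : Type*} [CommRing k] [Ring H] [HopfAlgebra k H]
  [Ring L] [Algebra k L] [Ring R] [Algebra k R]
variable (A : LeftModuleAlgebra k H L) (ρ : RightComodule k H L)
  (B : RightModuleAlgebra k H R) (lam : LeftComodule k H R)
  (φ : L ≃ₐ[k] Rᵐᵒᵖ) (θ : R ≃ₐ[k] Lᵐᵒᵖ)

/-- `φ (f ▹ x) = φ x ◃ S f` -/
def ActionsCompatVia : Prop :=
  ∀ f x, antiLin φ (A.act f x) = B.act (antiLin φ x) (antipode k f)

/-- `φ(x)₋₁ ⊗ φ(x)₀ = S(x₁) ⊗ φ(x₀)` -/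
def CoactionsCompatVia : Prop :=
  ∀ x, lam.coact (antiLin φ x) = TensorProduct.map (antipode k) (antiLin φ).toLinearMap
    (TensorProduct.comm k L H (ρ.coact x))

/-- `θ (y ◃ f) = S f ▹ θ y` -/
def ActionsCompatVia' : Prop :=
  ∀ y f, antiLin θ (B.act y f) = A.act (antipode k f) (antiLin θ y)

/-- `θ(y)₀ ⊗ θ(y)₁ = θ(y₀) ⊗ S(y₋₁)` -/
def CoactionsCompatVia' : Prop :=
  ∀ y, ρ.coact (antiLin θ y) = TensorProduct.map (antiLin θ).toLinearMap (antipode k)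
    (TensorProduct.comm k H R (lam.coact y))

/-- The structure maps on `L ♯ H` in which the left bialgebroid part, the antipode and the formula
for `Δ_R` are the standard ones and `α_R`, `β_R`, `ε_R` are given. -/
def leftSmashData (αR βR : R →ₗ[k] A.Smash) (εR : A.Smash →ₗ[k] R) :
    HopfAlgebroidData k L R A.Smash where
  αL := A.inl
  βL := A.target ρ
  ΔL := A.coprod _
  εL := A.counit
  αR := αR
  βR := βR
  ΔR := A.coprod _
  εR := εR
  τ := A.antipode ρ

/-- The structure maps on `H ♯ R` in which the right bialgebroid part, the antipode and the formula
for `Δ_L` are the standard ones and `α_L`, `β_L`, `ε_L` are given. -/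
def rightSmashData (αL βL : L →ₗ[k] B.Smash) (εL : B.Smash →ₗ[k] L) :
    HopfAlgebroidData k L R B.Smash where
  αL := αL
  βL := βL
  ΔL := B.coprod _
  εL := εL
  αR := B.inr
  βR := B.target lam
  ΔR := B.coprod _
  εR := B.counit
  τ := B.antipode lam

/-- The structure maps on `L ♯ H` defined via `φ`:
`α_R y = S(y₋₁) · φ⁻¹(y₀)`, `β_R y = φ⁻¹(y) ♯ 1`, `ε_R (x ♯ f) = φ(x) ◃ f`. -/
def leftDataVia : HopfAlgebroidData k L R A.Smash :=
  leftSmashData A ρ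
    (A.hMul ∘ₗ TensorProduct.map (antipode k) (antiLin φ).symm.toLinearMap ∘ₗ lam.coact)
    (A.inl ∘ₗ (antiLin φ).symm.toLinearMap)
    (A.lift (B.act ∘ₗ (antiLin φ).toLinearMap))

/-- The structure maps on `H ♯ R` defined via `φ`:
`α_L x = lam(φ(x))`, `β_L x = 1 ♯ (φ(x₀) ◃ x₁)`, `ε_L (f ♯ y) = (f S(y₋₁)) ▹ φ⁻¹(y₀)`. -/
def rightDataVia : HopfAlgebroidData k L R B.Smash :=
  rightSmashData B lam
    (B.target lam ∘ₗ (antiLin φ).toLinearMap)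
    (B.inr ∘ₗ TensorProduct.lift B.act ∘ₗ (antiLin φ).toLinearMap.rTensor H ∘ₗ ρ.coact)
    (B.lift (LinearMap.mk₂ k
      (fun f y => TensorProduct.lift A.act (TensorProduct.map
        (LinearMap.mul k H f ∘ₗ antipode k) (antiLin φ).symm.toLinearMap (lam.coact y)))
      (fun f f' y => by
        simp only [map_add, LinearMap.add_comp, TensorProduct.map_add_left, LinearMap.add_apply])
      (fun c f y => by
        simp only [map_smul, LinearMap.smul_comp, TensorProduct.map_smul_left,
          LinearMap.smul_apply])
      (fun f y y' => by simp only [map_add])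
      (fun c f y => by simp only [map_smul])))

/-- The structure maps on `L ♯ H` defined via `θ`: `α_R y = ρ(θ(y))`,
`β_R y = (y₋₁ ▹ θ(y₀)) ♯ 1`, `ε_R (x ♯ f) = θ⁻¹(x₀) ◃ (S(x₁) f)`. -/
def leftDataVia' : HopfAlgebroidData k L R A.Smash :=
  leftSmashData A ρ
    (A.target ρ ∘ₗ (antiLin θ).toLinearMap)
    (A.inl ∘ₗ TensorProduct.lift A.act ∘ₗ (antiLin θ).toLinearMap.lTensor H ∘ₗ lam.coact)
    (A.lift (LinearMap.mk₂ k
      (fun x f => TensorProduct.lift B.act (TensorProduct.map (antiLin θ).symm.toLinearMap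
        ((LinearMap.mul k H).flip f ∘ₗ antipode k) (ρ.coact x)))
      (fun x x' f => by simp only [map_add])
      (fun c x f => by simp only [map_smul])
      (fun x f f' => by
        simp only [map_add, LinearMap.add_comp, TensorProduct.map_add_right, LinearMap.add_apply])
      (fun c x f => by
        simp only [map_smul, LinearMap.smul_comp, TensorProduct.map_smul_right,
          LinearMap.smul_apply])))

/-- The structure maps on `H ♯ R` defined via `θ`: `α_L x = θ⁻¹(x₀) · S(x₁)`,
`β_L x = 1 ♯ θ⁻¹(x)`, `ε_L (f ♯ y) = f ▹ θ(y)`. -/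
def rightDataVia' : HopfAlgebroidData k L R B.Smash :=
  rightSmashData B lam
    (B.mulH ∘ₗ TensorProduct.map (antiLin θ).symm.toLinearMap (antipode k) ∘ₗ ρ.coact)
    (B.inr ∘ₗ (antiLin θ).symm.toLinearMap)
    (B.lift (A.act.compl₂ (antiLin θ).toLinearMap))

end Compatible

end

end ScalarExt

open ScalarExt

/-! Through `Ψ` the two smash products become one algebra K that factors both as LH and as HR.
Inside K the image of ρ is a copy of R, and the copy of L is the image of λ, so the antiisomorphisms
θ and φ compare each base algebra with the target map of the other side. The whole theorem follows
from this picture, axiomatized as `IsSmashPair`.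

The key fact is that L and R commute in K. Applying the counit ε_L to ρ(ax) = ρ(x)ρ(a) gives braided
commutativity x₀(x₁ ▹ a) = ax, and coassociativity of ρ turns this into aρ(x) = ρ(x)a
(`inl_mul_target`). Applying ε_L to the commutation rule y f = f₁ (y ◃ f₂) gives f₁ ▹ θ(y ◃ f₂) =
ε(f) θ(y); convolution with S yields θ(y ◃ f) = S(f) ▹ θ(y), and similarly for φ. Substituted back
into the commutation rules, this is the Yetter-Drinfeld condition. The antipode is needed on one
side only, so its bijectivity plays no role.

The coproduct x f ↦ x f₁ ⊗ f₂ is a coassociative algebra map δ already over k. Hence every (mixed)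
coassociativity axiom reduces to the statement that δ descends to the balanced tensor products
(`mixedCoassoc_of_le_ker`). Descent follows from the congruences δ(x) ≡ x ⊗ 1 on L and δ(y) ≡ 1 ⊗ y
on R, together with the Takeuchi property of δ (`takeuchi_left`, `takeuchi_right`).

For part (2), τ(ρ(x)) = x and τ'(λ(y)) = y hold without any compatibility (`antipode_target`). With
Ψτ = τ'Ψ it follows that τ is x ↦ φ(x) on L, y ↦ θ(y) on R and S on H. Applying τ to ρ(x) = x₀x₁
gives x = S(x₁)φ(x₀), which is the compatibility of the coactions. That compatibility supplies the
congruences for δ over the second base algebra, and `IsSmashPair.isSymmetricHopfAlgebroid` then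
produces the Hopf algebroids. The structures via φ and via θ are two descriptions of one structure
transported along `Ψ`. -/

namespace ScalarExt

open scoped TensorProduct
open Coalgebra HopfAlgebra

/-! ### Sums over a decomposition of a tensor -/

section Decomposition

variable {k M N P Q X Y : Type*} [CommRing k] [AddCommGroup M] [Module k M]
  [AddCommGroup N] [Module k N] [AddCommGroup P] [Module k P] [AddCommGroup Q] [Module k Q]
  [AddCommGroup X] [Module k X] [AddCommGroup Y] [Module k Y]

/-- A chosen finite set of pairs `(x, y)` with `t = ∑ x ⊗ y`. -/
noncomputable def rep (t : M ⊗[k] N) : Finset (M × N) :=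
  (TensorProduct.exists_finset t).choose

theorem sum_rep (t : M ⊗[k] N) : ∑ p ∈ rep t, p.1 ⊗ₜ[k] p.2 = t :=
  (TensorProduct.exists_finset t).choose_spec.symm

variable (k) in
/-- `F` is additive and homogeneous in each of its two arguments. -/
structure IsBilin (F : M → N → P) : Prop where
  left : ∀ y, IsLinearMap k (fun x => F x y)
  right : ∀ x, IsLinearMap k (fun y => F x y)

variable (k) in
/-- `F` is additive and homogeneous in each of its three arguments. -/
structure IsTrilin (F : M → N → P → Q) : Prop where
  left : ∀ y z, IsLinearMap k (fun x => F x y z)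
  mid : ∀ x z, IsLinearMap k (fun y => F x y z)
  right : ∀ x y, IsLinearMap k (fun z => F x y z)

namespace IsBilin

variable {F : M → N → P}

/-- The linear map on the tensor product induced by `F`. -/
noncomputable def lin (hF : IsBilin k F) : M ⊗[k] N →ₗ[k] P :=
  TensorProduct.lift (LinearMap.mk₂ k F (fun _ _ y => (hF.left y).map_add _ _)
    (fun _ _ y => (hF.left y).map_smul _ _) (fun x _ _ => (hF.right x).map_add _ _)
    (fun _ x _ => (hF.right x).map_smul _ _))

theorem lin_tmul (hF : IsBilin k F) (x : M) (y : N) : hF.lin (x ⊗ₜ y) = F x y := by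
  simp [lin]

/-- The sum on the left depends on a choice only in appearance: a bilinear summand makes it the
value of a linear map at `t`. -/
theorem sum_rep_eq (hF : IsBilin k F) (t : M ⊗[k] N) :
    ∑ p ∈ rep t, F p.1 p.2 = hF.lin t := by
  conv_rhs => rw [← sum_rep t]
  simp [lin_tmul]

end IsBilin

/-- The default argument proves bilinearity of the summands that occur below, so a Sweedler
computation only has to name `F`. The same device recurs in the lemmas that follow. -/
theorem sum_rep_tmul (F : M → N → P) (x : M) (y : N) (hF : IsBilin k F := by
      constructor <;> intros <;> constructor <;> intros <;>
        simp [mul_add, add_mul, TensorProduct.add_tmul, TensorProduct.tmul_add,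
          ← TensorProduct.smul_tmul']) :
    ∑ p ∈ rep (x ⊗ₜ[k] y), F p.1 p.2 = F x y := by
  rw [hF.sum_rep_eq, hF.lin_tmul]

theorem sum_rep_map (F : M → N → P) (f : X →ₗ[k] M) (g : Y →ₗ[k] N) (t : X ⊗[k] Y)
    (hF : IsBilin k F := by
      constructor <;> intros <;> constructor <;> intros <;>
        simp [mul_add, add_mul, TensorProduct.add_tmul, TensorProduct.tmul_add,
          ← TensorProduct.smul_tmul']) :
    ∑ p ∈ rep (TensorProduct.map f g t), F p.1 p.2 = ∑ p ∈ rep t, F (f p.1) (g p.2) := by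
  rw [hF.sum_rep_eq]
  conv_lhs => rw [← sum_rep t]
  simp [hF.lin_tmul]

theorem sum_rep_comm (F : M → N → P) (t : N ⊗[k] M)
    (hF : IsBilin k F := by
      constructor <;> intros <;> constructor <;> intros <;>
        simp [mul_add, add_mul, TensorProduct.add_tmul, TensorProduct.tmul_add,
          ← TensorProduct.smul_tmul']) :
    ∑ p ∈ rep (TensorProduct.comm k N M t), F p.1 p.2 = ∑ p ∈ rep t, F p.2 p.1 := by
  rw [hF.sum_rep_eq]
  conv_lhs => rw [← sum_rep t]
  simp [hF.lin_tmul]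

/-- Two iterated decompositions of the same element of a triple tensor product. -/
theorem sum_rep_assoc (F : M → N → P → Q) {f : X →ₗ[k] M ⊗[k] N} {g : Y →ₗ[k] N ⊗[k] P}
    {t : X ⊗[k] P} {u : M ⊗[k] Y}
    (h : TensorProduct.assoc k M N P (f.rTensor P t) = g.lTensor M u)
    (hF : IsTrilin k F := by
      constructor <;> intros <;> constructor <;> intros <;>
        simp [mul_add, add_mul, TensorProduct.add_tmul, TensorProduct.tmul_add,
          ← TensorProduct.smul_tmul']) :
    ∑ p ∈ rep t, ∑ q ∈ rep (f p.1), F q.1 q.2 p.2 =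
      ∑ p ∈ rep u, ∑ q ∈ rep (g p.2), F p.1 q.1 q.2 := by
  have h₁ : ∀ x, IsBilin k (F x) := fun x => ⟨fun z => hF.mid x z, fun y => hF.right x y⟩
  -- The induced linear map on M ⊗ (N ⊗ P); the two iterated sums are its values on the two sides of
  -- `h`.
  have h₂ : IsBilin k (fun x => (h₁ x).lin) := by
    refine ⟨fun v => ?_, fun x => (h₁ x).lin.isLinear⟩
    rw [← sum_rep v]
    constructor <;> intros <;>
      simp [IsBilin.lin_tmul, (hF.left _ _).map_add, (hF.left _ _).map_smul,
        Finset.sum_add_distrib, Finset.smul_sum]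
  have h₃ : h₂.lin (TensorProduct.assoc k M N P (f.rTensor P t)) =
      ∑ p ∈ rep t, ∑ q ∈ rep (f p.1), F q.1 q.2 p.2 := by
    conv_lhs => rw [← sum_rep t]
    simp only [map_sum, LinearMap.rTensor_tmul]
    refine Finset.sum_congr rfl fun p _ => ?_
    conv_lhs => rw [← sum_rep (f p.1)]
    simp [TensorProduct.sum_tmul, IsBilin.lin_tmul]
  have h₄ : h₂.lin (g.lTensor M u) = ∑ p ∈ rep u, ∑ q ∈ rep (g p.2), F p.1 q.1 q.2 := by
    conv_lhs => rw [← sum_rep u]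
    simp only [map_sum, LinearMap.lTensor_tmul]
    refine Finset.sum_congr rfl fun p _ => ?_
    conv_lhs => rw [← sum_rep (g p.2)]
    simp [IsBilin.lin_tmul]
  rw [← h₃, ← h₄, h]

end Decomposition

/-! ### Sweedler calculus in coalgebras, bialgebras and Hopf algebras -/

section Sweedler

variable {k H M N : Type*} [CommRing k] [AddCommGroup M] [Module k M] [AddCommGroup N] [Module k N]

section Coalgebra

variable [AddCommGroup H] [Module k H] [Coalgebra k H]

variable (k) in
/-- The chosen decomposition `h₁ ⊗ h₂` of the coproduct. -/
noncomputable abbrev Δr (h : H) : Finset (H × H) := rep (comul (R := k) h)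

theorem sum_coassoc (F : H → H → H → M) (h : H) (hF : IsTrilin k F := by
      constructor <;> intros <;> constructor <;> intros <;>
        simp [mul_add, add_mul, TensorProduct.add_tmul, TensorProduct.tmul_add,
          ← TensorProduct.smul_tmul']) :
    ∑ p ∈ Δr k h, ∑ q ∈ Δr k p.1, F q.1 q.2 p.2 =
      ∑ p ∈ Δr k h, ∑ q ∈ Δr k p.2, F p.1 q.1 q.2 :=
  sum_rep_assoc F (coassoc_apply h) hF

theorem sum_counit_left (G : H → M) (h : H) (hG : IsLinearMap k G := by
      constructor <;> intros <;>
        simp [mul_add, add_mul, TensorProduct.add_tmul, TensorProduct.tmul_add,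
          ← TensorProduct.smul_tmul']) :
    ∑ p ∈ Δr k h, counit (R := k) p.1 • G p.2 = G h := by
  have := congrArg (TensorProduct.lift (LinearMap.lsmul k H)) (rTensor_counit_comul (R := k) h)
  rw [← sum_rep (comul (R := k) h)] at this
  simp only [map_sum, LinearMap.rTensor_tmul, TensorProduct.lift.tmul, LinearMap.lsmul_apply,
    one_smul] at this
  conv_rhs => rw [← this]
  -- Bundling `G` as a linear map lets it be pushed through the sum.
  change _ = hG.mk' G _
  simp

theorem sum_counit_right (G : H → M) (h : H) (hG : IsLinearMap k G := by
      constructor <;> intros <;>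
        simp [mul_add, add_mul, TensorProduct.add_tmul, TensorProduct.tmul_add,
          ← TensorProduct.smul_tmul']) :
    ∑ p ∈ Δr k h, counit (R := k) p.2 • G p.1 = G h := by
  have := congrArg (TensorProduct.lift (LinearMap.lsmul k H).flip)
    (lTensor_counit_comul (R := k) h)
  rw [← sum_rep (comul (R := k) h)] at this
  simp only [map_sum, LinearMap.lTensor_tmul, TensorProduct.lift.tmul, LinearMap.lsmul_apply,
    one_smul, LinearMap.flip_apply] at this
  conv_rhs => rw [← this]
  change _ = hG.mk' G _
  simp

end Coalgebra

section Bialgebra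

variable [Ring H] [Bialgebra k H]

theorem sum_comul_mul (F : H → H → M) (h g : H) (hF : IsBilin k F := by
      constructor <;> intros <;> constructor <;> intros <;>
        simp [mul_add, add_mul, TensorProduct.add_tmul, TensorProduct.tmul_add,
          ← TensorProduct.smul_tmul']) :
    ∑ p ∈ Δr k (h * g), F p.1 p.2 =
      ∑ p ∈ Δr k h, ∑ q ∈ Δr k g, F (p.1 * q.1) (p.2 * q.2) := by
  rw [hF.sum_rep_eq, Bialgebra.comul_mul]
  conv_lhs => rw [← sum_rep (comul (R := k) h), ← sum_rep (comul (R := k) g)]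
  simp [Finset.sum_mul_sum, hF.lin_tmul]

end Bialgebra

section HopfAlgebra

variable [Ring H] [HopfAlgebra k H]

theorem sum_antipode_mul (G : H → M) (h : H) (hG : IsLinearMap k G := by
      constructor <;> intros <;>
        simp [mul_add, add_mul, TensorProduct.add_tmul, TensorProduct.tmul_add,
          ← TensorProduct.smul_tmul']) :
    ∑ p ∈ Δr k h, G (antipode k p.1 * p.2) = counit (R := k) h • G 1 := by
  have := mul_antipode_rTensor_comul_apply (R := k) h
  rw [← sum_rep (comul (R := k) h)] at this
  simp only [map_sum, LinearMap.rTensor_tmul, LinearMap.mul'_apply] at this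
  rw [← hG.map_smul, ← Algebra.algebraMap_eq_smul_one, ← this]
  change _ = hG.mk' G _
  simp

theorem sum_mul_antipode (G : H → M) (h : H) (hG : IsLinearMap k G := by
      constructor <;> intros <;>
        simp [mul_add, add_mul, TensorProduct.add_tmul, TensorProduct.tmul_add,
          ← TensorProduct.smul_tmul']) :
    ∑ p ∈ Δr k h, G (p.1 * antipode k p.2) = counit (R := k) h • G 1 := by
  have := mul_antipode_lTensor_comul_apply (R := k) h
  rw [← sum_rep (comul (R := k) h)] at this
  simp only [map_sum, LinearMap.lTensor_tmul, LinearMap.mul'_apply] at this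
  rw [← hG.map_smul, ← Algebra.algebraMap_eq_smul_one, ← this]
  change _ = hG.mk' G _
  simp

/-- `S(h₁) h₂ ⊗ h₃ = 1 ⊗ h` -/
theorem sum_antipode_mul_left (F : H → H → M) (h : H) (hF : IsBilin k F := by
      constructor <;> intros <;> constructor <;> intros <;>
        simp [mul_add, add_mul, TensorProduct.add_tmul, TensorProduct.tmul_add,
          ← TensorProduct.smul_tmul']) :
    ∑ p ∈ Δr k h, ∑ q ∈ Δr k p.1, F (antipode k q.1 * q.2) p.2 = F 1 h := by
  simp only [fun x y => sum_antipode_mul (fun z => F z y) x (hF.left y)]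
  exact sum_counit_left _ _ (hF.right 1)

/-- `h₁ S(h₂) ⊗ h₃ = 1 ⊗ h` -/
theorem sum_mul_antipode_left (F : H → H → M) (h : H) (hF : IsBilin k F := by
      constructor <;> intros <;> constructor <;> intros <;>
        simp [mul_add, add_mul, TensorProduct.add_tmul, TensorProduct.tmul_add,
          ← TensorProduct.smul_tmul']) :
    ∑ p ∈ Δr k h, ∑ q ∈ Δr k p.1, F (q.1 * antipode k q.2) p.2 = F 1 h := by
  simp only [fun x y => sum_mul_antipode (fun z => F z y) x (hF.left y)]
  exact sum_counit_left _ _ (hF.right 1)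

/-- `h₁ ⊗ S(h₂) h₃ = h ⊗ 1` -/
theorem sum_antipode_mul_right (F : H → H → M) (h : H) (hF : IsBilin k F := by
      constructor <;> intros <;> constructor <;> intros <;>
        simp [mul_add, add_mul, TensorProduct.add_tmul, TensorProduct.tmul_add,
          ← TensorProduct.smul_tmul']) :
    ∑ p ∈ Δr k h, ∑ q ∈ Δr k p.2, F p.1 (antipode k q.1 * q.2) = F h 1 := by
  simp only [fun x y => sum_antipode_mul (fun z => F y z) x (hF.right y)]
  exact sum_counit_right (fun x => F x 1) _ (hF.left 1)

/-- `h₁ ⊗ h₂ S(h₃) = h ⊗ 1` -/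
theorem sum_mul_antipode_right (F : H → H → M) (h : H) (hF : IsBilin k F := by
      constructor <;> intros <;> constructor <;> intros <;>
        simp [mul_add, add_mul, TensorProduct.add_tmul, TensorProduct.tmul_add,
          ← TensorProduct.smul_tmul']) :
    ∑ p ∈ Δr k h, ∑ q ∈ Δr k p.2, F p.1 (q.1 * antipode k q.2) = F h 1 := by
  simp only [fun x y => sum_mul_antipode (fun z => F y z) x (hF.right y)]
  exact sum_counit_right (fun x => F x 1) _ (hF.left 1)

end HopfAlgebra

end Sweedler

/-! ### Algebras with two smash product factorizations -/

section SmashPair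

variable {k H L R K : Type*} [CommRing k] [Ring H] [HopfAlgebra k H]
  [Ring L] [Algebra k L] [Ring R] [Algebra k R] [Ring K] [Algebra k K]

/-- The algebra `K` is at the same time a smash product `L ♯ H`, through `x ♯ f ↦ αL x * ι f`, and
a smash product `H ♯ R`, through `f ♯ y ↦ ι f * αR y`, in which `L` and `R` commute. -/
structure IsSmashPair (A : LeftModuleAlgebra k H L) (B : RightModuleAlgebra k H R)
    (φ : L ≃ₗ[k] R) (θ : R ≃ₗ[k] L) (αL βL : L →ₗ[k] K) (αR βR : R →ₗ[k] K) (ι : H →ₗ[k] K)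
    (eL : K →ₗ[k] L) (eR : K →ₗ[k] R) : Prop where
  αL_one : αL 1 = 1
  αL_mul : ∀ a b, αL (a * b) = αL a * αL b
  αR_one : αR 1 = 1
  αR_mul : ∀ a b, αR (a * b) = αR a * αR b
  ι_one : ι 1 = 1
  ι_mul : ∀ f g, ι (f * g) = ι f * ι g
  φ_anti : IsAntiHom φ.toLinearMap
  θ_anti : IsAntiHom θ.toLinearMap
  ι_αL : ∀ f x, ι f * αL x = ∑ p ∈ Δr k f, αL (A.act p.1 x) * ι p.2
  αR_ι : ∀ y f, αR y * ι f = ∑ p ∈ Δr k f, ι p.1 * αR (B.act y p.2)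
  βL_θ : ∀ y, βL (θ y) = αR y
  βR_φ : ∀ x, βR (φ x) = αL x
  comm : ∀ x y, αL x * αR y = αR y * αL x
  exists_left : ∀ z, ∃ s : Finset (L × H), z = ∑ p ∈ s, αL p.1 * ι p.2
  exists_right : ∀ z, ∃ s : Finset (H × R), z = ∑ p ∈ s, ι p.1 * αR p.2
  eL_tmul : ∀ x f, eL (αL x * ι f) = counit (R := k) f • x
  eR_tmul : ∀ f y, eR (ι f * αR y) = counit (R := k) f • y
  eL_βL : ∀ x, eL (βL x) = x
  eR_βR : ∀ y, eR (βR y) = y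

namespace IsSmashPair

variable {A : LeftModuleAlgebra k H L} {B : RightModuleAlgebra k H R}
  {φ : L ≃ₗ[k] R} {θ : R ≃ₗ[k] L} {αL βL : L →ₗ[k] K} {αR βR : R →ₗ[k] K} {ι : H →ₗ[k] K}
  {eL : K →ₗ[k] L} {eR : K →ₗ[k] R}
  (hK : IsSmashPair A B φ θ αL βL αR βR ι eL eR)

include hK

/-- Only spanning by the products matters here, not the bijection with L ⊗ H; this lets the same
arguments serve both concrete smash products. -/
theorem ext_left {M : Type*} [AddCommGroup M] [Module k M] {F G : K →ₗ[k] M}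
    (h : ∀ x f, F (αL x * ι f) = G (αL x * ι f)) (z : K) : F z = G z := by
  obtain ⟨s, rfl⟩ := hK.exists_left z
  simp only [map_sum, h]

theorem ext_right {M : Type*} [AddCommGroup M] [Module k M] {F G : K →ₗ[k] M}
    (h : ∀ f y, F (ι f * αR y) = G (ι f * αR y)) (z : K) : F z = G z := by
  obtain ⟨s, rfl⟩ := hK.exists_right z
  simp only [map_sum, h]

theorem βL_apply (x : L) : βL x = αR (θ.symm x) := by
  rw [← hK.βL_θ, LinearEquiv.apply_symm_apply]

theorem βR_apply (y : R) : βR y = αL (φ.symm y) := by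
  rw [← hK.βR_φ, LinearEquiv.apply_symm_apply]

theorem θ_mul (a b : R) : θ (a * b) = θ b * θ a := hK.θ_anti.map_mul a b

theorem φ_mul (a b : L) : φ (a * b) = φ b * φ a := hK.φ_anti.map_mul a b

/-- βL is αR composed with the inverse of the antiisomorphism θ. -/
theorem βL_anti : IsAntiHom βL where
  map_one := by
    have : θ 1 = 1 := hK.θ_anti.map_one
    rw [← this, hK.βL_θ, hK.αR_one]
  map_mul a b := by
    obtain ⟨a, rfl⟩ := θ.surjective a
    obtain ⟨b, rfl⟩ := θ.surjective b
    rw [← hK.θ_mul, hK.βL_θ, hK.βL_θ, hK.βL_θ, hK.αR_mul]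

theorem βR_anti : IsAntiHom βR where
  map_one := by
    have : φ 1 = 1 := hK.φ_anti.map_one
    rw [← this, hK.βR_φ, hK.αL_one]
  map_mul a b := by
    obtain ⟨a, rfl⟩ := φ.surjective a
    obtain ⟨b, rfl⟩ := φ.surjective b
    rw [← hK.φ_mul, hK.βR_φ, hK.βR_φ, hK.βR_φ, hK.αL_mul]

theorem eL_αR (y : R) : eL (αR y) = θ y := by rw [← hK.βL_θ, hK.eL_βL]

theorem eR_αL (x : L) : eR (αL x) = φ x := by rw [← hK.βR_φ, hK.eR_βR]

theorem eL_αL (x : L) : eL (αL x) = x := by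
  simpa [hK.ι_one] using hK.eL_tmul x 1

theorem eR_αR (y : R) : eR (αR y) = y := by
  simpa [hK.ι_one] using hK.eR_tmul 1 y

/-- ε_L absorbs right multiplication by H through the counit. Together with the formulas below for
left multiplication by L, H and R, this determines ε_L on every product that occurs. -/
theorem eL_mul_ι (z : K) (g : H) : eL (z * ι g) = counit (R := k) g • eL z := by
  refine hK.ext_left (F := eL ∘ₗ LinearMap.mulRight k (ι g))
    (G := counit (R := k) g • eL) (fun x f => ?_) z
  simp [mul_assoc, ← hK.ι_mul, hK.eL_tmul, smul_smul, mul_comm]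

theorem eR_ι_mul (z : K) (g : H) : eR (ι g * z) = counit (R := k) g • eR z := by
  refine hK.ext_right (F := eR ∘ₗ LinearMap.mulLeft k (ι g))
    (G := counit (R := k) g • eR) (fun f x => ?_) z
  simp [← mul_assoc, ← hK.ι_mul, hK.eR_tmul, smul_smul]

theorem eL_αL_mul (a : L) (z : K) : eL (αL a * z) = a * eL z := by
  refine hK.ext_left (F := eL ∘ₗ LinearMap.mulLeft k (αL a))
    (G := LinearMap.mulLeft k a ∘ₗ eL) (fun x f => ?_) z
  simp [← mul_assoc, ← hK.αL_mul, hK.eL_tmul]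

theorem eR_mul_αR (a : R) (z : K) : eR (z * αR a) = eR z * a := by
  refine hK.ext_right (F := eR ∘ₗ LinearMap.mulRight k (αR a))
    (G := LinearMap.mulRight k a ∘ₗ eR) (fun x f => ?_) z
  simp [mul_assoc, ← hK.αR_mul, hK.eR_tmul]

/-- Moving g past x gives (g₁ ▹ x) g₂, and ε_L replaces g₂ by its counit. -/
theorem eL_ι_mul (g : H) (z : K) : eL (ι g * z) = A.act g (eL z) := by
  refine hK.ext_left (F := eL ∘ₗ LinearMap.mulLeft k (ι g))
    (G := A.act g ∘ₗ eL) (fun x f => ?_) z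
  simp only [LinearMap.comp_apply, LinearMap.mulLeft_apply, ← mul_assoc, hK.ι_αL, hK.eL_mul_ι]
  simp only [map_smul, map_sum, hK.eL_tmul, hK.eL_αL]
  rw [sum_counit_right (fun h => A.act h x)]

theorem eR_mul_ι (g : H) (z : K) : eR (z * ι g) = B.act (eR z) g := by
  refine hK.ext_right (F := eR ∘ₗ LinearMap.mulRight k (ι g))
    (G := B.act.flip g ∘ₗ eR) (fun f y => ?_) z
  simp only [LinearMap.comp_apply, LinearMap.mulRight_apply, mul_assoc, hK.αR_ι, hK.eR_ι_mul]
  simp only [map_smul, map_sum, hK.eR_tmul, hK.eR_αR, LinearMap.flip_apply]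
  rw [sum_counit_left (fun h => B.act y h)]

/-- Since y commutes with L, ε_L(y x f) = ε(f) x ε_L(y), and ε_L(y) = θ(y). -/
theorem eL_αR_mul (y : R) (z : K) : eL (αR y * z) = eL z * θ y := by
  refine hK.ext_left (F := eL ∘ₗ LinearMap.mulLeft k (αR y))
    (G := LinearMap.mulRight k (θ y) ∘ₗ eL) (fun x f => ?_) z
  simp [← mul_assoc, ← hK.comm, hK.eL_mul_ι, hK.eL_αL_mul, hK.eL_αR, hK.eL_αL]

theorem eR_mul_αL (x : L) (z : K) : eR (z * αL x) = φ x * eR z := by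
  refine hK.ext_right (F := eR ∘ₗ LinearMap.mulRight k (αL x))
    (G := LinearMap.mulLeft k (φ x) ∘ₗ eR) (fun f y => ?_) z
  simp [mul_assoc, ← hK.comm, hK.eR_ι_mul, hK.eR_mul_αR, hK.eR_αL, hK.eR_αR]

/-- For z = x f, the factor f stands at the far right on both sides and contributes only ε(f). This
is the action axiom for the counit of a left bialgebroid. -/
theorem eL_mul (w z : K) : eL (w * z) = eL (w * αL (eL z)) := by
  refine hK.ext_left (F := eL ∘ₗ LinearMap.mulLeft k w)
    (G := eL ∘ₗ LinearMap.mulLeft k w ∘ₗ αL ∘ₗ eL) (fun x f => ?_) z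
  simp [← mul_assoc, hK.eL_mul_ι, hK.eL_αL]

theorem eR_mul (w z : K) : eR (w * z) = eR (αR (eR w) * z) := by
  refine hK.ext_right (F := eR ∘ₗ LinearMap.mulRight k z)
    (G := eR ∘ₗ LinearMap.mulRight k z ∘ₗ αR ∘ₗ eR) (fun f x => ?_) w
  simp [mul_assoc, hK.eR_ι_mul, hK.eR_αR]

/-- `f₁ ▹ θ (y ◃ f₂) = ε(f) θ y` -/
theorem sum_act_θ (y : R) (f : H) :
    ∑ p ∈ Δr k f, A.act p.1 (θ (B.act y p.2)) = counit (R := k) f • θ y := by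
  have := congrArg eL (hK.αR_ι y f)
  simpa [hK.eL_mul_ι, hK.eL_ι_mul, hK.eL_αR] using this.symm

/-- `φ (f₁ ▹ x) ◃ f₂ = ε(f) φ x` -/
theorem sum_φ_act (x : L) (f : H) :
    ∑ p ∈ Δr k f, B.act (φ (A.act p.1 x)) p.2 = counit (R := k) f • φ x := by
  have := congrArg eR (hK.ι_αL f x)
  simpa [hK.eR_mul_ι, hK.eR_ι_mul, hK.eR_αL] using this.symm

/-- Insert S(f₁)f₂ in front of θ(y ◃ f₃) and collapse f₂ ▹ θ(y ◃ f₃) by `sum_act_θ`. -/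
theorem θ_act (y : R) (f : H) : θ (B.act y f) = A.act (antipode k f) (θ y) := by
  have h₁ := sum_antipode_mul_left (k := k) (fun a b => A.act a (θ (B.act y b))) f
  rw [A.one_act] at h₁
  rw [← h₁]
  simp only [A.mul_act]
  rw [sum_coassoc (fun a b c => A.act (antipode k a) (A.act b (θ (B.act y c))))]
  simp only [← map_sum, hK.sum_act_θ, map_smul]
  rw [sum_counit_right (fun a => A.act (antipode k a) (θ y))]

/-- Insert f₂S(f₃) behind φ(f₁ ▹ x) and collapse φ(f₁ ▹ x) ◃ f₂ by `sum_φ_act`. -/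
theorem φ_act (f : H) (x : L) : φ (A.act f x) = B.act (φ x) (antipode k f) := by
  have h₁ := sum_mul_antipode_right (k := k) (fun a b => B.act (φ (A.act a x)) b) f
  rw [B.act_one] at h₁
  rw [← h₁]
  simp only [B.act_mul]
  rw [← sum_coassoc (fun a b c => B.act (B.act (φ (A.act a x)) b) (antipode k c))]
  simp only [← LinearMap.sum_apply, ← map_sum, hK.sum_φ_act, map_smul]
  simp only [LinearMap.smul_apply]
  rw [sum_counit_left (fun a => B.act (φ x) (antipode k a))]

theorem θ_symm_act (f : H) (x : L) :
    B.act (θ.symm x) f = θ.symm (A.act (antipode k f) x) := by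
  rw [LinearEquiv.eq_symm_apply, hK.θ_act, LinearEquiv.apply_symm_apply]

theorem φ_symm_act (f : H) (y : R) :
    A.act f (φ.symm y) = φ.symm (B.act y (antipode k f)) := by
  rw [LinearEquiv.eq_symm_apply, hK.φ_act, LinearEquiv.apply_symm_apply]

/-- `f βL(x) = βL(f₂ ▹ x) f₁` -/
theorem ι_mul_βL (f : H) (x : L) :
    ι f * βL x = ∑ p ∈ Δr k f, βL (A.act p.2 x) * ι p.1 := by
  -- With βL = αR ∘ θ⁻¹, moving f₁ to the left on the right-hand side gives f₁ θ⁻¹(S(f₂)f₃ ▹ x),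
  -- where the last two legs cancel.
  simp only [hK.βL_apply, hK.αR_ι, hK.θ_symm_act, ← A.mul_act]
  rw [sum_coassoc (fun a b c => ι a * αR (θ.symm (A.act (antipode k b * c) x))),
    sum_antipode_mul_right (fun a b => ι a * αR (θ.symm (A.act b x))), A.one_act]

/-- `βR(y) f = f₂ βR(y ◃ f₁)` -/
theorem βR_mul_ι (f : H) (y : R) :
    βR y * ι f = ∑ p ∈ Δr k f, ι p.2 * βR (B.act y p.1) := by
  -- Mirror image: the right-hand side becomes φ⁻¹(y ◃ f₁S(f₂)) f₃.
  simp only [hK.βR_apply, hK.ι_αL, hK.φ_symm_act, ← B.act_mul]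
  rw [← sum_coassoc (fun a b c => αL (φ.symm (B.act y (a * antipode k b))) * ι c),
    sum_mul_antipode_left (fun a b => αL (φ.symm (B.act y a)) * ι b), B.act_one]

theorem comm_left (a b : L) : αL a * βL b = βL b * αL a := by
  rw [hK.βL_apply, hK.comm]

theorem comm_right (a b : R) : αR a * βR b = βR b * αR a := by
  rw [hK.βR_apply, hK.comm]

end IsSmashPair

end SmashPair

/-! ### Tensor products over the base algebras -/

section Quotients

variable {k A K M : Type*} [CommRing k] [Ring A] [Algebra k A] [Ring K] [Algebra k K]
  [AddCommGroup M] [Module k M]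

theorem mkQ_leftRel (α β : A →ₗ[k] K) (a : A) (x y : K) :
    (leftRel α β).mkQ ((β a * x) ⊗ₜ y) = (leftRel α β).mkQ (x ⊗ₜ (α a * y)) := by
  rw [← sub_eq_zero, ← map_sub, Submodule.mkQ_apply, Submodule.Quotient.mk_eq_zero]
  exact Submodule.subset_span ⟨a, x, y, rfl⟩

theorem mkQ_rightRel (α β : A →ₗ[k] K) (a : A) (x y : K) :
    (rightRel α β).mkQ ((x * α a) ⊗ₜ y) = (rightRel α β).mkQ (x ⊗ₜ (y * β a)) := by
  rw [← sub_eq_zero, ← map_sub, Submodule.mkQ_apply, Submodule.Quotient.mk_eq_zero]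
  exact Submodule.subset_span ⟨a, x, y, rfl⟩

theorem leftRel_le_ker {α β : A →ₗ[k] K} {f : K ⊗[k] K →ₗ[k] M}
    (h : ∀ a x y, f ((β a * x) ⊗ₜ y) = f (x ⊗ₜ (α a * y))) : leftRel α β ≤ LinearMap.ker f := by
  rw [leftRel, Submodule.span_le]
  rintro _ ⟨a, x, y, rfl⟩
  simp [h]

theorem rightRel_le_ker {α β : A →ₗ[k] K} {f : K ⊗[k] K →ₗ[k] M}
    (h : ∀ a x y, f ((x * α a) ⊗ₜ y) = f (x ⊗ₜ (y * β a))) : rightRel α β ≤ LinearMap.ker f := by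
  rw [rightRel, Submodule.span_le]
  rintro _ ⟨a, x, y, rfl⟩
  simp [h]

theorem congr_of_le_ker {P : Submodule k (K ⊗[k] K)} {f : K ⊗[k] K →ₗ[k] M}
    (h : P ≤ LinearMap.ker f) {u v : K ⊗[k] K} (huv : P.mkQ u = P.mkQ v) : f u = f v := by
  rw [← P.liftQ_mkQ f h, LinearMap.comp_apply, LinearMap.comp_apply, huv]

theorem leftRel_mul_right {α β : A →ₗ[k] K} {u v : K ⊗[k] K}
    (h : (leftRel α β).mkQ u = (leftRel α β).mkQ v) (s : K ⊗[k] K) :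
    (leftRel α β).mkQ (u * s) = (leftRel α β).mkQ (v * s) :=
  congrArg (leftTensorMulRight α β s) h

theorem rightRel_mul_left {α β : A →ₗ[k] K} {u v : K ⊗[k] K}
    (h : (rightRel α β).mkQ u = (rightRel α β).mkQ v) (s : K ⊗[k] K) :
    (rightRel α β).mkQ (s * u) = (rightRel α β).mkQ (s * v) :=
  congrArg (rightTensorMulLeft α β s) h

/-- Right multiplication always descends to K ⊗_A K, left multiplication by s does not. The
hypothesis says that s lies in the Takeuchi product; it handles the generator at x = y = 1, and
right multiplication by x ⊗ y gives the rest. -/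
theorem leftRel_mul_left {α β : A →ₗ[k] K} {s : K ⊗[k] K}
    (hs : ∀ a, (leftRel α β).mkQ (s * (β a ⊗ₜ 1)) = (leftRel α β).mkQ (s * (1 ⊗ₜ α a)))
    {u v : K ⊗[k] K} (h : (leftRel α β).mkQ u = (leftRel α β).mkQ v) :
    (leftRel α β).mkQ (s * u) = (leftRel α β).mkQ (s * v) := by
  refine congr_of_le_ker (f := (leftRel α β).mkQ ∘ₗ LinearMap.mulLeft k s)
    (leftRel_le_ker fun a x y => ?_) h
  simpa [mul_assoc] using leftRel_mul_right (hs a) (x ⊗ₜ y)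

theorem rightRel_mul_right {α β : A →ₗ[k] K} {s : K ⊗[k] K}
    (hs : ∀ a, (rightRel α β).mkQ ((α a ⊗ₜ 1) * s) = (rightRel α β).mkQ ((1 ⊗ₜ β a) * s))
    {u v : K ⊗[k] K} (h : (rightRel α β).mkQ u = (rightRel α β).mkQ v) :
    (rightRel α β).mkQ (u * s) = (rightRel α β).mkQ (v * s) := by
  refine congr_of_le_ker (f := (rightRel α β).mkQ ∘ₗ LinearMap.mulRight k s)
    (rightRel_le_ker fun a x y => ?_) h
  simpa [← mul_assoc] using rightRel_mul_left (hs a) (x ⊗ₜ y)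

theorem InducedComp.of_le_ker {P : Submodule k (K ⊗[k] K)} {f : K ⊗[k] K →ₗ[k] M}
    (h : P ≤ LinearMap.ker f) {Δ : K →ₗ[k] (K ⊗[k] K) ⧸ P} {δ : K →ₗ[k] K ⊗[k] K}
    (hΔ : Δ = P.mkQ ∘ₗ δ) {g : K →ₗ[k] M} (hg : ∀ z, f (δ z) = g z) : InducedComp f Δ g := by
  subst hΔ
  exact ⟨P.liftQ f h, P.liftQ_mkQ f h, LinearMap.ext hg⟩

theorem glueRight_mkQ (P Q : Submodule k (K ⊗[k] K)) (u : K ⊗[k] K) (z : K) :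
    glueRight P Q (P.mkQ u) z = (tripleRel P Q).mkQ (TensorProduct.assoc k K K K (u ⊗ₜ z)) := rfl

theorem glueLeft_mkQ (P Q : Submodule k (K ⊗[k] K)) (x : K) (u : K ⊗[k] K) :
    glueLeft P Q x (Q.mkQ u) = (tripleRel P Q).mkQ (x ⊗ₜ u) := rfl

/-- Both coproducts are reductions of one map that is coassociative over k, so only well-definedness
of the two tensor maps remains to be supplied. -/
theorem mixedCoassoc_of_le_ker {P Q : Submodule k (K ⊗[k] K)} {δ : K →ₗ[k] K ⊗[k] K}
    (hδ : ∀ z, TensorProduct.assoc k K K K (δ.rTensor K (δ z)) = δ.lTensor K (δ z))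
    (hQ : Q ≤ LinearMap.ker ((tripleRel P Q).mkQ ∘ₗ
      (TensorProduct.assoc k K K K).toLinearMap ∘ₗ δ.rTensor K))
    (hP : P ≤ LinearMap.ker ((tripleRel P Q).mkQ ∘ₗ δ.lTensor K)) :
    MixedCoassoc (P.mkQ ∘ₗ δ) (Q.mkQ ∘ₗ δ) :=
  ⟨Q.liftQ _ hQ, P.liftQ _ hP, fun _ _ => rfl, fun _ _ => rfl,
    LinearMap.ext fun z => congrArg (tripleRel P Q).mkQ (hδ z)⟩

/-- A relation of `Q` may be applied to the last two factors of a triple tensor whatever stands in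
the first. The three variants below treat multiplication on the other side and relations of `P` in
the first two factors. -/
theorem mkQ_tripleRel_assoc_mul_left (P Q : Submodule k (K ⊗[k] K)) (b c y : K)
    (h : ∀ v, Q.mkQ ((b * v) ⊗ₜ y) = Q.mkQ (v ⊗ₜ c)) (s : K ⊗[k] K) :
    (tripleRel P Q).mkQ (TensorProduct.assoc k K K K (((1 ⊗ₜ b) * s) ⊗ₜ y)) =
      (tripleRel P Q).mkQ (TensorProduct.assoc k K K K (s ⊗ₜ c)) := by
  induction s using TensorProduct.induction_on with
  | zero => simp
  | add s t hs ht => rw [mul_add, TensorProduct.add_tmul, TensorProduct.add_tmul, map_add, map_add,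
      map_add, map_add, hs, ht]
  | tmul u v =>
    rw [Algebra.TensorProduct.tmul_mul_tmul, one_mul, TensorProduct.assoc_tmul,
      TensorProduct.assoc_tmul, ← glueLeft_mkQ, h, glueLeft_mkQ]

theorem mkQ_tripleRel_assoc_mul_right (P Q : Submodule k (K ⊗[k] K)) (b c y : K)
    (h : ∀ v, Q.mkQ ((v * b) ⊗ₜ y) = Q.mkQ (v ⊗ₜ c)) (s : K ⊗[k] K) :
    (tripleRel P Q).mkQ (TensorProduct.assoc k K K K ((s * (1 ⊗ₜ b)) ⊗ₜ y)) =
      (tripleRel P Q).mkQ (TensorProduct.assoc k K K K (s ⊗ₜ c)) := by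
  induction s using TensorProduct.induction_on with
  | zero => simp
  | add s t hs ht => rw [add_mul, TensorProduct.add_tmul, TensorProduct.add_tmul, map_add, map_add,
      map_add, map_add, hs, ht]
  | tmul u v =>
    rw [Algebra.TensorProduct.tmul_mul_tmul, mul_one, TensorProduct.assoc_tmul,
      TensorProduct.assoc_tmul, ← glueLeft_mkQ, h, glueLeft_mkQ]

theorem mkQ_tripleRel_mul_left (P Q : Submodule k (K ⊗[k] K)) (b c x : K)
    (h : ∀ v, P.mkQ (x ⊗ₜ (b * v)) = P.mkQ (c ⊗ₜ v)) (s : K ⊗[k] K) :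
    (tripleRel P Q).mkQ (x ⊗ₜ ((b ⊗ₜ 1) * s)) = (tripleRel P Q).mkQ (c ⊗ₜ s) := by
  induction s using TensorProduct.induction_on with
  | zero => simp
  | add s t hs ht => rw [mul_add, TensorProduct.tmul_add, TensorProduct.tmul_add, map_add, map_add,
      hs, ht]
  | tmul u v =>
    rw [Algebra.TensorProduct.tmul_mul_tmul, one_mul, ← TensorProduct.assoc_tmul,
      ← TensorProduct.assoc_tmul, ← glueRight_mkQ, h, glueRight_mkQ]

theorem mkQ_tripleRel_mul_right (P Q : Submodule k (K ⊗[k] K)) (b c x : K)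
    (h : ∀ v, P.mkQ (x ⊗ₜ (v * b)) = P.mkQ (c ⊗ₜ v)) (s : K ⊗[k] K) :
    (tripleRel P Q).mkQ (x ⊗ₜ (s * (b ⊗ₜ 1))) = (tripleRel P Q).mkQ (c ⊗ₜ s) := by
  induction s using TensorProduct.induction_on with
  | zero => simp
  | add s t hs ht => rw [add_mul, TensorProduct.tmul_add, TensorProduct.tmul_add, map_add, map_add,
      hs, ht]
  | tmul u v =>
    rw [Algebra.TensorProduct.tmul_mul_tmul, mul_one, ← TensorProduct.assoc_tmul,
      ← TensorProduct.assoc_tmul, ← glueRight_mkQ, h, glueRight_mkQ]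

/-- The map Δ ⊗ id descends when Δ carries the factor β(a) into its second leg, the one adjacent to
y, where it can be traded for α(a) acting on y. -/
theorem leftRel_le_ker_assoc {P : Submodule k (K ⊗[k] K)} {α β : A →ₗ[k] K}
    {δ : K →ₗ[k] K ⊗[k] K} (h : ∀ a z, P.mkQ (δ (β a * z)) = P.mkQ ((1 ⊗ₜ β a) * δ z)) :
    leftRel α β ≤ LinearMap.ker ((tripleRel P (leftRel α β)).mkQ ∘ₗ
      (TensorProduct.assoc k K K K).toLinearMap ∘ₗ δ.rTensor K) := by
  refine leftRel_le_ker fun a x y => ?_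
  change (tripleRel P _).mkQ (TensorProduct.assoc k K K K (δ (β a * x) ⊗ₜ y)) =
    (tripleRel P _).mkQ (TensorProduct.assoc k K K K (δ x ⊗ₜ (α a * y)))
  rw [← glueRight_mkQ, h, glueRight_mkQ]
  exact mkQ_tripleRel_assoc_mul_left _ _ _ _ _ (fun v => mkQ_leftRel α β a v y) _

theorem rightRel_le_ker_assoc {P : Submodule k (K ⊗[k] K)} {α β : A →ₗ[k] K}
    {δ : K →ₗ[k] K ⊗[k] K} (h : ∀ a z, P.mkQ (δ (z * α a)) = P.mkQ (δ z * (1 ⊗ₜ α a))) :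
    rightRel α β ≤ LinearMap.ker ((tripleRel P (rightRel α β)).mkQ ∘ₗ
      (TensorProduct.assoc k K K K).toLinearMap ∘ₗ δ.rTensor K) := by
  refine rightRel_le_ker fun a x y => ?_
  change (tripleRel P _).mkQ (TensorProduct.assoc k K K K (δ (x * α a) ⊗ₜ y)) =
    (tripleRel P _).mkQ (TensorProduct.assoc k K K K (δ x ⊗ₜ (y * β a)))
  rw [← glueRight_mkQ, h, glueRight_mkQ]
  exact mkQ_tripleRel_assoc_mul_right _ _ _ _ _ (fun v => mkQ_rightRel α β a v y) _

/-- Dually, id ⊗ Δ descends when Δ keeps α(a) in its first leg. -/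
theorem leftRel_le_ker_lTensor {Q : Submodule k (K ⊗[k] K)} {α β : A →ₗ[k] K}
    {δ : K →ₗ[k] K ⊗[k] K} (h : ∀ a z, Q.mkQ (δ (α a * z)) = Q.mkQ ((α a ⊗ₜ 1) * δ z)) :
    leftRel α β ≤ LinearMap.ker ((tripleRel (leftRel α β) Q).mkQ ∘ₗ δ.lTensor K) := by
  refine leftRel_le_ker fun a x y => ?_
  change (tripleRel _ Q).mkQ ((β a * x) ⊗ₜ δ y) = (tripleRel _ Q).mkQ (x ⊗ₜ δ (α a * y))
  rw [← glueLeft_mkQ _ _ x, h, glueLeft_mkQ]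
  exact (mkQ_tripleRel_mul_left _ _ _ _ _ (fun v => (mkQ_leftRel α β a x v).symm) _).symm

theorem rightRel_le_ker_lTensor {Q : Submodule k (K ⊗[k] K)} {α β : A →ₗ[k] K}
    {δ : K →ₗ[k] K ⊗[k] K} (h : ∀ a z, Q.mkQ (δ (z * β a)) = Q.mkQ (δ z * (β a ⊗ₜ 1))) :
    rightRel α β ≤ LinearMap.ker ((tripleRel (rightRel α β) Q).mkQ ∘ₗ δ.lTensor K) := by
  refine rightRel_le_ker fun a x y => ?_
  change (tripleRel _ Q).mkQ ((x * α a) ⊗ₜ δ y) = (tripleRel _ Q).mkQ (x ⊗ₜ δ (y * β a))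
  rw [← glueLeft_mkQ _ _ x, h, glueLeft_mkQ]
  exact (mkQ_tripleRel_mul_right _ _ _ _ _ (fun v => (mkQ_rightRel α β a x v).symm) _).symm

end Quotients

/-! ### Bialgebroids and Hopf algebroids from two smash product factorizations -/

section Coproduct

variable {k H L R K : Type*} [CommRing k] [Ring H] [HopfAlgebra k H]
  [Ring L] [Algebra k L] [Ring R] [Algebra k R] [Ring K] [Algebra k K]

/-- `δ` is a coassociative algebra map that extends the coproduct of `H`. -/
structure IsSmashCoprod (ι : H →ₗ[k] K) (δ : K →ₐ[k] K ⊗[k] K) : Prop where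
  coassoc : ∀ z, TensorProduct.assoc k K K K (δ.toLinearMap.rTensor K (δ z)) =
    δ.toLinearMap.lTensor K (δ z)
  map_ι : ∀ f, δ (ι f) = ∑ p ∈ Δr k f, ι p.1 ⊗ₜ ι p.2

/-- Modulo `P`, `δ` is given by `x ↦ x ⊗ 1` on `L` and by `y ↦ 1 ⊗ y` on `R`, and multiplication
by its values is well defined modulo `P`. -/
structure IsCoprodMod (αL : L →ₗ[k] K) (αR : R →ₗ[k] K) (δ : K →ₐ[k] K ⊗[k] K)
    (P : Submodule k (K ⊗[k] K)) : Prop where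
  map_αL : ∀ x, P.mkQ (δ (αL x)) = P.mkQ (αL x ⊗ₜ 1)
  map_αR : ∀ y, P.mkQ (δ (αR y)) = P.mkQ (1 ⊗ₜ αR y)
  mul_left : ∀ z {u v}, P.mkQ u = P.mkQ v → P.mkQ (δ z * u) = P.mkQ (δ z * v)
  mul_right : ∀ z {u v}, P.mkQ u = P.mkQ v → P.mkQ (u * δ z) = P.mkQ (v * δ z)

namespace IsCoprodMod

variable {αL : L →ₗ[k] K} {αR : R →ₗ[k] K} {ι : H →ₗ[k] K} {δ : K →ₐ[k] K ⊗[k] K}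
  {P : Submodule k (K ⊗[k] K)} (hP : IsCoprodMod αL αR δ P)

include hP

theorem map_αL_mul (x : L) (z : K) : P.mkQ (δ (αL x * z)) = P.mkQ ((αL x ⊗ₜ 1) * δ z) := by
  rw [map_mul δ, hP.mul_right z (hP.map_αL x)]

theorem map_mul_αL (x : L) (z : K) : P.mkQ (δ (z * αL x)) = P.mkQ (δ z * (αL x ⊗ₜ 1)) := by
  rw [map_mul δ, hP.mul_left z (hP.map_αL x)]

theorem map_αR_mul (y : R) (z : K) : P.mkQ (δ (αR y * z)) = P.mkQ ((1 ⊗ₜ αR y) * δ z) := by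
  rw [map_mul δ, hP.mul_right z (hP.map_αR y)]

theorem map_mul_αR (y : R) (z : K) : P.mkQ (δ (z * αR y)) = P.mkQ (δ z * (1 ⊗ₜ αR y)) := by
  rw [map_mul δ, hP.mul_left z (hP.map_αR y)]

theorem map_αL_ι (hι : IsSmashCoprod ι δ) (x : L) (f : H) :
    P.mkQ (δ (αL x * ι f)) = P.mkQ (∑ p ∈ Δr k f, (αL x * ι p.1) ⊗ₜ ι p.2) := by
  rw [hP.map_αL_mul, hι.map_ι, Finset.mul_sum]
  simp

theorem map_ι_αR (hι : IsSmashCoprod ι δ) (f : H) (y : R) :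
    P.mkQ (δ (ι f * αR y)) = P.mkQ (∑ p ∈ Δr k f, ι p.1 ⊗ₜ (ι p.2 * αR y)) := by
  rw [hP.map_mul_αR, hι.map_ι, Finset.sum_mul]
  simp

end IsCoprodMod

namespace IsSmashPair

variable {A : LeftModuleAlgebra k H L} {B : RightModuleAlgebra k H R}
  {φ : L ≃ₗ[k] R} {θ : R ≃ₗ[k] L} {αL βL : L →ₗ[k] K} {αR βR : R →ₗ[k] K} {ι : H →ₗ[k] K}
  {eL : K →ₗ[k] L} {eR : K →ₗ[k] R}
  (hK : IsSmashPair A B φ θ αL βL αR βR ι eL eR) {δ : K →ₐ[k] K ⊗[k] K}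
  (hδ : IsSmashCoprod ι δ)

include hδ

theorem mixedCoassoc_left_right (h : IsCoprodMod αL αR δ (leftRel αL βL))
    (h' : IsCoprodMod αL αR δ (rightRel αR βR)) :
    MixedCoassoc ((leftRel αL βL).mkQ ∘ₗ δ.toLinearMap)
      ((rightRel αR βR).mkQ ∘ₗ δ.toLinearMap) :=
  mixedCoassoc_of_le_ker hδ.coassoc (rightRel_le_ker_assoc h.map_mul_αR)
    (leftRel_le_ker_lTensor h'.map_αL_mul)

include hK

/-- The values of `δ` lie in the Takeuchi product over `L`. -/
theorem takeuchi_left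
    (hL : ∀ x, (leftRel αL βL).mkQ (δ (αL x)) = (leftRel αL βL).mkQ (αL x ⊗ₜ 1)) (z : K) (a : L) :
    (leftRel αL βL).mkQ (δ z * (βL a ⊗ₜ 1)) = (leftRel αL βL).mkQ (δ z * (1 ⊗ₜ αL a)) := by
  refine hK.ext_left
    (F := (leftRel αL βL).mkQ ∘ₗ LinearMap.mulRight k (βL a ⊗ₜ 1) ∘ₗ δ.toLinearMap)
    (G := (leftRel αL βL).mkQ ∘ₗ LinearMap.mulRight k (1 ⊗ₜ αL a) ∘ₗ δ.toLinearMap)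
    (fun x f => ?_) z
  change (leftRel αL βL).mkQ (δ _ * _) = (leftRel αL βL).mkQ (δ _ * _)
  -- On H: f₁βL(a) ⊗ f₂ = βL(f₂ ▹ a)f₁ ⊗ f₃ ≡ f₁ ⊗ (f₂ ▹ a)f₃ = f₁ ⊗ f₂a.
  have h₁ : (leftRel αL βL).mkQ (δ (ι f) * (βL a ⊗ₜ 1)) =
      (leftRel αL βL).mkQ (δ (ι f) * (1 ⊗ₜ αL a)) := by
    simp only [hδ.map_ι, Finset.sum_mul, Algebra.TensorProduct.tmul_mul_tmul, mul_one, hK.ι_mul_βL,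
      hK.ι_αL, TensorProduct.sum_tmul, TensorProduct.tmul_sum, map_sum, mkQ_leftRel]
    generalize (leftRel αL βL).mkQ = π
    exact sum_coassoc (fun b c d => π (ι b ⊗ₜ (αL (A.act c a) * ι d))) f
  rw [map_mul δ, mul_assoc, mul_assoc, leftRel_mul_right (hL x), leftRel_mul_right (hL x)]
  -- Left multiplication by αL(x) ⊗ 1 preserves the relations because αL(x) commutes with the image
  -- of βL.
  refine leftRel_mul_left (fun b => ?_) h₁
  have := mkQ_leftRel αL βL b (αL x) 1
  simpa [hK.comm_left] using this

/-- The values of `δ` lie in the Takeuchi product over `R`. -/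
theorem takeuchi_right
    (hR : ∀ y, (rightRel αR βR).mkQ (δ (αR y)) = (rightRel αR βR).mkQ (1 ⊗ₜ αR y)) (z : K) (a : R) :
    (rightRel αR βR).mkQ ((αR a ⊗ₜ 1) * δ z) = (rightRel αR βR).mkQ ((1 ⊗ₜ βR a) * δ z) := by
  refine hK.ext_right
    (F := (rightRel αR βR).mkQ ∘ₗ LinearMap.mulLeft k (αR a ⊗ₜ 1) ∘ₗ δ.toLinearMap)
    (G := (rightRel αR βR).mkQ ∘ₗ LinearMap.mulLeft k (1 ⊗ₜ βR a) ∘ₗ δ.toLinearMap)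
    (fun f y => ?_) z
  change (rightRel αR βR).mkQ (_ * δ _) = (rightRel αR βR).mkQ (_ * δ _)
  -- On H: af₁ ⊗ f₂ = f₁(a ◃ f₂) ⊗ f₃ ≡ f₁ ⊗ f₃βR(a ◃ f₂) = f₁ ⊗ βR(a)f₂.
  have h₁ : (rightRel αR βR).mkQ ((αR a ⊗ₜ 1) * δ (ι f)) =
      (rightRel αR βR).mkQ ((1 ⊗ₜ βR a) * δ (ι f)) := by
    simp only [hδ.map_ι, Finset.mul_sum, Algebra.TensorProduct.tmul_mul_tmul, one_mul,
      hK.βR_mul_ι, hK.αR_ι, TensorProduct.sum_tmul, TensorProduct.tmul_sum, map_sum, mkQ_rightRel]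
    generalize (rightRel αR βR).mkQ = π
    exact sum_coassoc (fun b c d => π (ι b ⊗ₜ (ι d * βR (B.act a c)))) f
  rw [map_mul δ, ← mul_assoc, ← mul_assoc, rightRel_mul_left (hR y), rightRel_mul_left (hR y)]
  refine rightRel_mul_right (fun b => ?_) h₁
  have := mkQ_rightRel αR βR b 1 (αR y)
  simpa [hK.comm_right] using this

theorem isCoprodMod_left
    (hL : ∀ x, (leftRel αL βL).mkQ (δ (αL x)) = (leftRel αL βL).mkQ (αL x ⊗ₜ 1))
    (hR : ∀ y, (leftRel αL βL).mkQ (δ (αR y)) = (leftRel αL βL).mkQ (1 ⊗ₜ αR y)) :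
    IsCoprodMod αL αR δ (leftRel αL βL) where
  map_αL := hL
  map_αR := hR
  mul_left z _ _ h := leftRel_mul_left (hK.takeuchi_left hδ hL z) h
  mul_right _ _ _ h := leftRel_mul_right h _

theorem isCoprodMod_right
    (hL : ∀ x, (rightRel αR βR).mkQ (δ (αL x)) = (rightRel αR βR).mkQ (αL x ⊗ₜ 1))
    (hR : ∀ y, (rightRel αR βR).mkQ (δ (αR y)) = (rightRel αR βR).mkQ (1 ⊗ₜ αR y)) :
    IsCoprodMod αL αR δ (rightRel αR βR) where
  map_αL := hL
  map_αR := hR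
  mul_left _ _ _ h := rightRel_mul_left h _
  mul_right z _ _ h := rightRel_mul_right (hK.takeuchi_right hδ hR z) h

theorem mixedCoassoc_left_left (h : IsCoprodMod αL αR δ (leftRel αL βL)) :
    MixedCoassoc ((leftRel αL βL).mkQ ∘ₗ δ.toLinearMap)
      ((leftRel αL βL).mkQ ∘ₗ δ.toLinearMap) :=
  mixedCoassoc_of_le_ker hδ.coassoc
    (leftRel_le_ker_assoc fun a _ => by rw [hK.βL_apply]; exact h.map_αR_mul _ _)
    (leftRel_le_ker_lTensor h.map_αL_mul)

theorem mixedCoassoc_right_right (h : IsCoprodMod αL αR δ (rightRel αR βR)) :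
    MixedCoassoc ((rightRel αR βR).mkQ ∘ₗ δ.toLinearMap)
      ((rightRel αR βR).mkQ ∘ₗ δ.toLinearMap) :=
  mixedCoassoc_of_le_ker hδ.coassoc (rightRel_le_ker_assoc h.map_mul_αR)
    (rightRel_le_ker_lTensor fun a _ => by rw [hK.βR_apply]; exact h.map_mul_αL _ _)

theorem mixedCoassoc_right_left (h : IsCoprodMod αL αR δ (leftRel αL βL))
    (h' : IsCoprodMod αL αR δ (rightRel αR βR)) :
    MixedCoassoc ((rightRel αR βR).mkQ ∘ₗ δ.toLinearMap)
      ((leftRel αL βL).mkQ ∘ₗ δ.toLinearMap) :=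
  mixedCoassoc_of_le_ker hδ.coassoc
    (leftRel_le_ker_assoc fun a _ => by rw [hK.βL_apply]; exact h'.map_αR_mul _ _)
    (rightRel_le_ker_lTensor fun a _ => by rw [hK.βR_apply]; exact h.map_mul_αL _ _)

/-- The counit axioms compare linear maps on K, so they are checked on x f, where δ may be replaced
by x f₁ ⊗ f₂ as soon as the map applied afterwards kills the relations. -/
theorem isLeftBialgebroid (h : IsCoprodMod αL αR δ (leftRel αL βL)) {Δ : K →ₗ[k] LeftTensor αL βL}
    (hΔ : Δ = (leftRel αL βL).mkQ ∘ₗ δ.toLinearMap) : IsLeftBialgebroid αL βL Δ eL where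
  source_one := hK.αL_one
  source_mul := hK.αL_mul
  target := hK.βL_anti
  commute := hK.comm_left
  comul_bimod a b := by
    refine .of_le_ker (leftRel_le_ker fun c x y => ?_) hΔ fun z => ?_
    · simp only [LinearMap.comp_apply, LinearMap.mulLeft_apply, Algebra.TensorProduct.tmul_mul_tmul,
        ← mul_assoc]
      rw [hK.comm_left, ← hK.comm_left c b, mul_assoc, mkQ_leftRel, mul_assoc]
    · simp only [hΔ, LinearMap.comp_apply, LinearMap.mulLeft_apply, AlgHom.toLinearMap_apply]
      rw [hK.βL_apply, map_mul δ]
      -- Bimodule linearity amounts to δ(a y) ≡ a ⊗ y for a in L and y = βL(b) in R.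
      refine leftRel_mul_right (Eq.symm ?_) _
      rw [map_mul δ, h.mul_left _ (h.map_αR _), leftRel_mul_right (h.map_αL a)]
      simp
  counit_bimod a b x := by
    rw [mul_assoc, hK.eL_αL_mul, hK.βL_apply, hK.eL_αR_mul, LinearEquiv.apply_symm_apply, mul_assoc]
  coassoc := by
    subst hΔ
    exact hK.mixedCoassoc_left_left hδ h
  counit_left := by
    have hker : leftRel αL βL ≤ LinearMap.ker (LinearMap.mul' k K ∘ₗ (αL ∘ₗ eL).rTensor K) :=
      leftRel_le_ker fun a x y => by
        simp [hK.βL_apply, hK.eL_αR_mul, hK.αL_mul, mul_assoc]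
    refine .of_le_ker hker hΔ (hK.ext_left (F := LinearMap.mul' k K ∘ₗ (αL ∘ₗ eL).rTensor K ∘ₗ
      δ.toLinearMap) (G := LinearMap.id) fun x f => ?_)
    refine (congr_of_le_ker hker (h.map_αL_ι hδ x f)).trans ?_
    simp only [map_sum, LinearMap.comp_apply, LinearMap.rTensor_tmul, LinearMap.mul'_apply,
      hK.eL_tmul, map_smul, smul_mul_assoc, LinearMap.id_apply]
    exact sum_counit_left (fun g => αL x * ι g) f
  counit_right := by
    have hker : leftRel αL βL ≤ LinearMap.ker (LinearMap.mul' k K ∘ₗ (βL ∘ₗ eL).rTensor K ∘ₗ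
        (TensorProduct.comm k K K).toLinearMap) :=
      leftRel_le_ker fun a x y => by
        simp [hK.eL_αL_mul, hK.βL_anti.map_mul, mul_assoc]
    refine .of_le_ker hker hΔ (hK.ext_left (F := LinearMap.mul' k K ∘ₗ (βL ∘ₗ eL).rTensor K ∘ₗ
      (TensorProduct.comm k K K).toLinearMap ∘ₗ δ.toLinearMap) (G := LinearMap.id) fun x f => ?_)
    refine (congr_of_le_ker hker (h.map_αL_ι hδ x f)).trans ?_
    have hι : ∀ f, eL (ι f) = counit (R := k) f • 1 := fun f => by
      simpa [hK.αL_one] using hK.eL_tmul 1 f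
    simp only [map_sum, LinearMap.comp_apply, LinearEquiv.coe_coe, TensorProduct.comm_tmul,
      LinearMap.rTensor_tmul, LinearMap.mul'_apply, hι, map_smul, smul_mul_assoc,
      LinearMap.id_apply, hK.βL_anti.map_one, one_mul]
    exact sum_counit_right (fun g => αL x * ι g) f
  comul_action := by
    -- The action is left multiplication by δ(x). It descends by the Takeuchi property, and it is
    -- multiplicative because δ is an algebra map over k.
    have hker : ∀ x, leftRel αL βL ≤ (leftRel αL βL).comap (LinearMap.mulLeft k (δ x)) := fun x u hu => by
      have h₁ : (leftRel αL βL).mkQ u = (leftRel αL βL).mkQ 0 := by simpa using hu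
      simpa using h.mul_left x h₁
    refine ⟨LinearMap.mk₂ k (fun x t => (leftRel αL βL).mapQ _ (LinearMap.mulLeft k (δ x))
      (hker x) t) ?_ ?_ (fun x s t => map_add _ _ _) (fun c x t => map_smul _ _ _), ?_, ?_, ?_⟩
    · intro x y t
      obtain ⟨t, rfl⟩ := (leftRel αL βL).mkQ_surjective t
      simp [add_mul]
    · intro c x t
      obtain ⟨t, rfl⟩ := (leftRel αL βL).mkQ_surjective t
      simp
    · intro x s
      rw [hΔ]
      rfl
    · intro t
      obtain ⟨t, rfl⟩ := (leftRel αL βL).mkQ_surjective t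
      simp
    · intro x y t
      obtain ⟨t, rfl⟩ := (leftRel αL βL).mkQ_surjective t
      simp
  counit_action_one a := by rw [one_mul, hK.eL_αL]
  counit_action_mul x y a := by rw [mul_assoc, hK.eL_mul]

theorem isRightBialgebroid (h : IsCoprodMod αL αR δ (rightRel αR βR))
    {Δ : K →ₗ[k] RightTensor αR βR}
    (hΔ : Δ = (rightRel αR βR).mkQ ∘ₗ δ.toLinearMap) : IsRightBialgebroid αR βR Δ eR where
  source_one := hK.αR_one
  source_mul := hK.αR_mul
  target := hK.βR_anti
  commute := hK.comm_right
  comul_bimod a b := by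
    refine .of_le_ker (rightRel_le_ker fun c x y => ?_) hΔ fun z => ?_
    · simp only [LinearMap.comp_apply, LinearMap.mulRight_apply,
        Algebra.TensorProduct.tmul_mul_tmul, mul_assoc]
      rw [hK.comm_right, ← hK.comm_right a c, ← mul_assoc x, mkQ_rightRel, mul_assoc]
    · simp only [hΔ, LinearMap.comp_apply, LinearMap.mulRight_apply, AlgHom.toLinearMap_apply]
      rw [hK.βR_apply, map_mul δ z]
      refine rightRel_mul_left (Eq.symm ?_) _
      rw [map_mul δ, h.mul_right _ (h.map_αR _), rightRel_mul_left (h.map_αL _)]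
      simp
  counit_bimod a b x := by
    rw [hK.comm_right, ← mul_assoc, hK.eR_mul_αR, hK.βR_apply, hK.eR_mul_αL,
      LinearEquiv.apply_symm_apply]
  coassoc := by
    subst hΔ
    exact hK.mixedCoassoc_right_right hδ h
  counit_left := by
    have hker : rightRel αR βR ≤ LinearMap.ker (LinearMap.mul' k K ∘ₗ (βR ∘ₗ eR).lTensor K ∘ₗ
        (TensorProduct.comm k K K).toLinearMap) :=
      rightRel_le_ker fun a x y => by
        simp [hK.eR_mul_αR, hK.βR_anti.map_mul, mul_assoc]
    refine .of_le_ker hker hΔ (hK.ext_right (F := LinearMap.mul' k K ∘ₗ (βR ∘ₗ eR).lTensor K ∘ₗ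
      (TensorProduct.comm k K K).toLinearMap ∘ₗ δ.toLinearMap) (G := LinearMap.id) fun f y => ?_)
    refine (congr_of_le_ker hker (h.map_ι_αR hδ f y)).trans ?_
    have hι : ∀ f, eR (ι f) = counit (R := k) f • 1 := fun f => by
      simpa [hK.αR_one] using hK.eR_tmul f 1
    simp only [map_sum, LinearMap.comp_apply, LinearEquiv.coe_coe, TensorProduct.comm_tmul,
      LinearMap.lTensor_tmul, LinearMap.mul'_apply, hι, map_smul, mul_smul_comm,
      LinearMap.id_apply, hK.βR_anti.map_one, mul_one]
    exact sum_counit_left (fun g => ι g * αR y) f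
  counit_right := by
    have hker : rightRel αR βR ≤ LinearMap.ker (LinearMap.mul' k K ∘ₗ (αR ∘ₗ eR).lTensor K) :=
      rightRel_le_ker fun a x y => by
        simp [hK.βR_apply, hK.eR_mul_αL, hK.αR_mul, mul_assoc]
    refine .of_le_ker hker hΔ (hK.ext_right (F := LinearMap.mul' k K ∘ₗ (αR ∘ₗ eR).lTensor K ∘ₗ
      δ.toLinearMap) (G := LinearMap.id) fun f y => ?_)
    refine (congr_of_le_ker hker (h.map_ι_αR hδ f y)).trans ?_
    simp only [map_sum, LinearMap.comp_apply, LinearMap.lTensor_tmul, LinearMap.mul'_apply,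
      hK.eR_tmul, map_smul, mul_smul_comm, LinearMap.id_apply]
    exact sum_counit_right (fun g => ι g * αR y) f
  comul_action := by
    have hker : ∀ x, rightRel αR βR ≤ (rightRel αR βR).comap (LinearMap.mulRight k (δ x)) :=
      fun x u hu => by
        have h₁ : (rightRel αR βR).mkQ u = (rightRel αR βR).mkQ 0 := by simpa using hu
        simpa using h.mul_right x h₁
    refine ⟨LinearMap.mk₂ k (fun t x => (rightRel αR βR).mapQ _ (LinearMap.mulRight k (δ x))
      (hker x) t) (fun s t x => map_add _ _ _) (fun c t x => map_smul _ _ _) ?_ ?_, ?_, ?_, ?_⟩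
    · intro t x y
      obtain ⟨t, rfl⟩ := (rightRel αR βR).mkQ_surjective t
      simp [mul_add]
    · intro c t x
      obtain ⟨t, rfl⟩ := (rightRel αR βR).mkQ_surjective t
      simp
    · intro s x
      rw [hΔ]
      rfl
    · intro t
      obtain ⟨t, rfl⟩ := (rightRel αR βR).mkQ_surjective t
      simp
    · intro t x y
      obtain ⟨t, rfl⟩ := (rightRel αR βR).mkQ_surjective t
      simp
  counit_action_one a := by rw [mul_one, hK.eR_αR]
  counit_action_mul a x y := by rw [← mul_assoc, hK.eR_mul]

omit hδ in
/-- `S(f₁) y f₂ = y ◃ f` -/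
theorem antipode_αR_ι (f : H) (y : R) :
    ∑ p ∈ Δr k f, ι (antipode k p.1) * (αR y * ι p.2) = αR (B.act y f) := by
  simp only [hK.αR_ι, Finset.mul_sum, ← mul_assoc, ← hK.ι_mul]
  rw [← sum_coassoc (fun a b c => ι (antipode k a * b) * αR (B.act y c)),
    sum_antipode_mul_left (fun a b => ι a * αR (B.act y b)), hK.ι_one, one_mul]

omit hδ in
/-- `y S(f) = S(f₂) (y ◃ S(f₁))` -/
theorem αR_antipode (f : H) (y : R) : αR y * ι (antipode k f) =
    ∑ p ∈ Δr k f, ι (antipode k p.2) * αR (B.act y (antipode k p.1)) := by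
  -- S(g) y = (y ◃ g₁) S(g₂) comes from inserting g₂S(g₃), which avoids a formula for the coproduct
  -- of S(g). The claim then follows by cancelling S(f₁)f₂.
  have h : ∀ y g, ι (antipode k g) * αR y =
      ∑ q ∈ Δr k g, αR (B.act y q.1) * ι (antipode k q.2) := fun y g => by
    have h₁ := sum_mul_antipode_right (k := k) (fun a b => ι (antipode k a) * (αR y * ι b)) g
    rw [hK.ι_one, mul_one] at h₁
    rw [← h₁, ← sum_coassoc (fun a b c => ι (antipode k a) * (αR y * ι (b * antipode k c)))]
    simp only [hK.ι_mul, ← mul_assoc, ← Finset.sum_mul]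
    simp only [mul_assoc, ← hK.antipode_αR_ι, Finset.sum_mul]
  simp only [h, ← B.act_mul]
  rw [← sum_coassoc (fun a b c => αR (B.act y (antipode k a * b)) * ι (antipode k c)),
    sum_antipode_mul_left (fun a b => αR (B.act y a) * ι (antipode k b)), B.act_one]

omit hδ in
-- It suffices to reverse products whose left factor is in L or in H. On L this is
-- antimultiplicativity of φ. For f in H, the crossing relation with L must be respected, and this
-- is `αR_antipode` combined with φ(f ▹ x) = φ(x) ◃ S(f).
theorem antipode_anti {τ : K →ₗ[k] K} (hτ : ∀ x f, τ (αL x * ι f) = ι (antipode k f) * αR (φ x)) :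
    IsAntiHom τ where
  map_one := by
    have h := hτ 1 1
    have hφ : φ 1 = 1 := hK.φ_anti.map_one
    rwa [hK.αL_one, hK.ι_one, one_mul, antipode_one, hK.ι_one, one_mul, hφ, hK.αR_one] at h
  map_mul := by
    have h₁ : ∀ x z, τ (αL x * z) = τ z * αR (φ x) := fun x z => by
      refine hK.ext_left (F := τ ∘ₗ LinearMap.mulLeft k (αL x))
        (G := LinearMap.mulRight k (αR (φ x)) ∘ₗ τ) (fun y f => ?_) z
      simp [← mul_assoc, ← hK.αL_mul, hτ, hK.φ_mul, hK.αR_mul]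
    have hι : ∀ f, τ (ι f) = ι (antipode k f) := fun f => by
      have h := hτ 1 f
      have hφ : φ 1 = 1 := hK.φ_anti.map_one
      rwa [hK.αL_one, one_mul, hφ, hK.αR_one, mul_one] at h
    have h₂ : ∀ f g, τ (ι f * ι g) = τ (ι g) * ι (antipode k f) := fun f g => by
      rw [← hK.ι_mul, hι, hι, antipode_mul_antidistrib, hK.ι_mul]
    have h₄ : ∀ f z, τ (ι f * z) = τ z * ι (antipode k f) := fun f z => by
      refine hK.ext_left (F := τ ∘ₗ LinearMap.mulLeft k (ι f))
        (G := LinearMap.mulRight k (ι (antipode k f)) ∘ₗ τ) (fun y g => ?_) z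
      simp only [LinearMap.comp_apply, LinearMap.mulRight_apply, LinearMap.mulLeft_apply,
        ← mul_assoc, hK.ι_αL, Finset.sum_mul, map_sum]
      simp only [mul_assoc, h₁, h₂, hK.φ_act, hK.αR_antipode, Finset.mul_sum]
    intro w z
    refine hK.ext_left (F := τ ∘ₗ LinearMap.mulRight k z)
      (G := LinearMap.mulLeft k (τ z) ∘ₗ τ) (fun x f => ?_) w
    simp only [LinearMap.comp_apply, LinearMap.mulRight_apply, LinearMap.mulLeft_apply, mul_assoc,
      h₁, h₄, hι]

end IsSmashPair

/-- Structure maps that come from two factorizations of the total algebra as a smash product, with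
a common coproduct, form a symmetric Hopf algebroid. -/
theorem IsSmashPair.isSymmetricHopfAlgebroid
    {A : LeftModuleAlgebra k H L} {B : RightModuleAlgebra k H R} {φ : L ≃ₗ[k] R} {θ : R ≃ₗ[k] L}
    {ι : H →ₗ[k] K} {D : HopfAlgebroidData k L R K}
    (hK : IsSmashPair A B φ θ D.αL D.βL D.αR D.βR ι D.εL D.εR) {δ : K →ₐ[k] K ⊗[k] K}
    (hδ : IsSmashCoprod ι δ)
    (hL : IsCoprodMod D.αL D.αR δ (leftRel D.αL D.βL))
    (hR : IsCoprodMod D.αL D.αR δ (rightRel D.αR D.βR))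
    (hΔL : D.ΔL = (leftRel D.αL D.βL).mkQ ∘ₗ δ.toLinearMap)
    (hΔR : D.ΔR = (rightRel D.αR D.βR).mkQ ∘ₗ δ.toLinearMap)
    (hτ : IsAntiHom D.τ) (hτι : ∀ f, D.τ (ι f) = ι (antipode k f))
    (hτL : ∀ x, D.τ (D.αL x) = D.αR (φ x)) (hτR : ∀ y, D.τ (D.αR y) = D.αL (θ y)) :
    IsSymmetricHopfAlgebroid D where
  left := hK.isLeftBialgebroid hδ hL hΔL
  right := hK.isRightBialgebroid hδ hR hΔR
  antipode := hτ
  αL_εL_βR y := by rw [hK.βR_apply, hK.eL_αL]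
  βL_εL_αR y := by rw [hK.eL_αR, hK.βL_θ]
  αR_εR_βL x := by rw [hK.βL_apply, hK.eR_αR]
  βR_εR_αL x := by rw [hK.eR_αL, hK.βR_φ]
  coassoc_RL := by
    rw [hΔL, hΔR]
    exact hK.mixedCoassoc_right_left hδ hL hR
  coassoc_LR := by
    rw [hΔL, hΔR]
    exact IsSmashPair.mixedCoassoc_left_right hδ hL hR
  τ_βL x := by rw [hK.βL_apply, hτR, LinearEquiv.apply_symm_apply]
  τ_βR y := by rw [hK.βR_apply, hτL, LinearEquiv.apply_symm_apply]
  antipode_left := by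
    have hker : leftRel D.αL D.βL ≤ LinearMap.ker (LinearMap.mul' k K ∘ₗ D.τ.rTensor K) :=
      leftRel_le_ker fun a x y => by
        simp [hτ.map_mul, hK.βL_apply, hτR, mul_assoc]
    refine .of_le_ker hker hΔL (hK.ext_left (F := LinearMap.mul' k K ∘ₗ D.τ.rTensor K ∘ₗ
      δ.toLinearMap) (G := D.αR ∘ₗ D.εR) fun x f => ?_)
    refine (congr_of_le_ker hker (hL.map_αL_ι hδ x f)).trans ?_
    -- S(f₁) φ(x) f₂ = S(f₁)f₂ (φ(x) ◃ f₃) = φ(x) ◃ f.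
    simp only [map_sum, LinearMap.comp_apply, LinearMap.rTensor_tmul, LinearMap.mul'_apply,
      hτ.map_mul, hτι, hτL, mul_assoc, hK.αR_ι, hK.eR_mul_ι, hK.eR_αL, Finset.mul_sum]
    simp only [← mul_assoc, ← hK.ι_mul]
    rw [← sum_coassoc (fun a b c => ι (antipode k a * b) * D.αR (B.act (φ x) c)),
      sum_antipode_mul_left (fun a b => ι a * D.αR (B.act (φ x) b)), hK.ι_one, one_mul]
  antipode_right := by
    have hker : rightRel D.αR D.βR ≤ LinearMap.ker (LinearMap.mul' k K ∘ₗ D.τ.lTensor K) :=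
      rightRel_le_ker fun a x y => by
        simp [hτ.map_mul, hK.βR_apply, hτL, mul_assoc]
    refine .of_le_ker hker hΔR (hK.ext_left (F := LinearMap.mul' k K ∘ₗ D.τ.lTensor K ∘ₗ
      δ.toLinearMap) (G := D.αL ∘ₗ D.εL) fun x f => ?_)
    refine (congr_of_le_ker hker (hR.map_αL_ι hδ x f)).trans ?_
    simp only [map_sum, LinearMap.comp_apply, LinearMap.lTensor_tmul, LinearMap.mul'_apply,
      hτι, mul_assoc, ← hK.ι_mul, hK.eL_tmul]
    rw [sum_mul_antipode (fun a => D.αL x * ι a), hK.ι_one, mul_one, map_smul]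

end Coproduct

/-! ### The smash product algebras -/

namespace LeftModuleAlgebra

section Bialgebra

variable {k H L : Type*} [CommRing k] [Ring H] [Bialgebra k H] [Ring L] [Algebra k L]
variable (A : LeftModuleAlgebra k H L)

theorem of_tmul_mul_of_tmul (a b : L) (f g : H) : A.of (a ⊗ₜ f) * A.of (b ⊗ₜ g) =
    ∑ p ∈ Δr k f, A.of ((a * A.act p.1 b) ⊗ₜ (p.2 * g)) := by
  rw [of_mul_of]
  conv_lhs => rw [← sum_rep (comul (R := k) f)]
  simp

theorem inl_apply (x : L) : A.inl x = A.of (x ⊗ₜ 1) := rfl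

theorem inr_apply (f : H) : A.inr f = A.of (1 ⊗ₜ f) := rfl

theorem inl_one : A.inl 1 = 1 := rfl

theorem inr_one : A.inr 1 = 1 := rfl

theorem inl_mul_of (a b : L) (g : H) : A.inl a * A.of (b ⊗ₜ g) = A.of ((a * b) ⊗ₜ g) := by
  rw [inl_apply, mul_def]
  simp [smashMul_tmul, diag_tmul, Algebra.TensorProduct.one_def, A.one_act]

theorem inl_mul_inr (x : L) (f : H) : A.inl x * A.inr f = A.of (x ⊗ₜ f) := by
  rw [inr_apply, inl_mul_of, mul_one]

theorem inl_mul (a b : L) : A.inl (a * b) = A.inl a * A.inl b := (A.inl_mul_of a b 1).symm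

theorem of_diag (f : H) (t : L ⊗[k] H) : A.of (A.diag f t) = A.inr f * A.of t := by
  have h : LinearMap.mul k L 1 = LinearMap.id := by ext; simp
  rw [inr_apply, mul_def]
  simp [smashMul_tmul, h]

theorem inr_mul_inl (f : H) (x : L) :
    A.inr f * A.inl x = ∑ p ∈ Δr k f, A.inl (A.act p.1 x) * A.inr p.2 := by
  rw [inr_apply, inl_apply, of_tmul_mul_of_tmul]
  simp [inl_mul_inr]

theorem of_mul_inr (x : L) (f g : H) : A.of (x ⊗ₜ f) * A.inr g = A.of (x ⊗ₜ (f * g)) := by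
  rw [inr_apply, of_tmul_mul_of_tmul]
  simp only [A.act_one, mul_smul_comm, mul_one, ← TensorProduct.smul_tmul', map_smul]
  exact sum_counit_left (fun f => A.of (x ⊗ₜ (f * g))) f

theorem inr_mul (f g : H) : A.inr (f * g) = A.inr f * A.inr g := (A.of_mul_inr 1 f g).symm

theorem of_eq_sum (t : L ⊗[k] H) : A.of t = ∑ p ∈ rep t, A.inl p.1 * A.inr p.2 := by
  conv_lhs => rw [← sum_rep t]
  simp [inl_mul_inr]

theorem target_apply (ρ : RightComodule k H L) (x : L) :
    A.target ρ x = ∑ p ∈ rep (ρ.coact x), A.inl p.1 * A.inr p.2 := A.of_eq_sum _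

theorem eq_sum (z : A.Smash) : ∃ s : Finset (L × H), z = ∑ p ∈ s, A.inl p.1 * A.inr p.2 :=
  ⟨_, A.of_eq_sum (A.of.symm z)⟩

theorem ext_inl_inr {M : Type*} [AddCommGroup M] [Module k M] {F G : A.Smash →ₗ[k] M}
    (h : ∀ x f, F (A.inl x * A.inr f) = G (A.inl x * A.inr f)) (z : A.Smash) : F z = G z := by
  obtain ⟨s, rfl⟩ := A.eq_sum z
  simp only [map_sum, h]

theorem lift_inl_mul_inr {M : Type*} [AddCommGroup M] [Module k M] (F : L →ₗ[k] H →ₗ[k] M)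
    (x : L) (f : H) : A.lift F (A.inl x * A.inr f) = F x f := by
  rw [inl_mul_inr]
  simp [lift]

theorem counit_inl_mul_inr (x : L) (f : H) :
    A.counit (A.inl x * A.inr f) = Coalgebra.counit (R := k) f • x :=
  A.lift_inl_mul_inr _ x f

theorem counit_inl_mul (a : L) (z : A.Smash) : A.counit (A.inl a * z) = a * A.counit z := by
  refine A.ext_inl_inr (F := A.counit ∘ₗ LinearMap.mulLeft k (A.inl a))
    (G := LinearMap.mulLeft k a ∘ₗ A.counit) (fun x f => ?_) z
  simp [← mul_assoc, ← inl_mul, counit_inl_mul_inr]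

theorem counit_inr_mul (g : H) (z : A.Smash) : A.counit (A.inr g * z) = A.act g (A.counit z) := by
  refine A.ext_inl_inr (F := A.counit ∘ₗ LinearMap.mulLeft k (A.inr g))
    (G := A.act g ∘ₗ A.counit) (fun x f => ?_) z
  simp only [LinearMap.comp_apply, LinearMap.mulLeft_apply, ← mul_assoc, inr_mul_inl,
    Finset.sum_mul, map_sum]
  simp only [mul_assoc, ← inr_mul, counit_inl_mul_inr, Bialgebra.counit_mul, mul_comm, mul_smul,
    map_smul]
  rw [← Finset.smul_sum, sum_counit_right (fun h => A.act h x)]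

theorem sum_coact_counit {M : Type*} [AddCommGroup M] [Module k M] (ρ : RightComodule k H L)
    (G : L →ₗ[k] M) (x : L) :
    ∑ p ∈ rep (ρ.coact x), Coalgebra.counit (R := k) p.2 • G p.1 = G x := by
  conv_rhs => rw [← ρ.counit_coact x, ← sum_rep (ρ.coact x)]
  simp

theorem counit_target (ρ : RightComodule k H L) (x : L) : A.counit (A.target ρ x) = x := by
  simp only [target_apply, map_sum, counit_inl_mul_inr]
  exact sum_coact_counit ρ LinearMap.id x

/-- The coproduct of `L ♯ H`, as a linear map to the tensor product over `k`. -/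
noncomputable def comulLin : A.Smash →ₗ[k] A.Smash ⊗[k] A.Smash :=
  TensorProduct.map A.of.toLinearMap A.inr ∘ₗ (TensorProduct.assoc k L H H).symm.toLinearMap ∘ₗ
    (comul (R := k) (A := H)).lTensor L ∘ₗ A.of.symm.toLinearMap

theorem comulLin_inl_mul_inr (x : L) (f : H) : A.comulLin (A.inl x * A.inr f) =
    ∑ p ∈ Δr k f, (A.inl x * A.inr p.1) ⊗ₜ A.inr p.2 := by
  rw [inl_mul_inr]
  simp only [comulLin, LinearMap.comp_apply, LinearEquiv.coe_coe, LinearEquiv.symm_apply_apply,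
    LinearMap.lTensor_tmul]
  conv_lhs => rw [← sum_rep (comul (R := k) f)]
  simp [TensorProduct.tmul_sum, inl_mul_inr]

theorem comulLin_inl (x : L) : A.comulLin (A.inl x) = A.inl x ⊗ₜ 1 := by
  have h := A.comulLin_inl_mul_inr x 1
  rw [inr_one, mul_one] at h
  rw [h, Δr, Bialgebra.comul_one, Algebra.TensorProduct.one_def,
    sum_rep_tmul (fun a b => (A.inl x * A.inr a) ⊗ₜ[k] A.inr b), inr_one, mul_one]

theorem comulLin_inr (f : H) : A.comulLin (A.inr f) =
    ∑ p ∈ Δr k f, A.inr p.1 ⊗ₜ A.inr p.2 := by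
  simpa [inl_one] using A.comulLin_inl_mul_inr 1 f

theorem comulLin_mul_inr (z : A.Smash) (g : H) :
    A.comulLin (z * A.inr g) = A.comulLin z * A.comulLin (A.inr g) := by
  refine A.ext_inl_inr (F := A.comulLin ∘ₗ LinearMap.mulRight k (A.inr g))
    (G := LinearMap.mulRight k (A.comulLin (A.inr g)) ∘ₗ A.comulLin) (fun x f => ?_) z
  simp only [LinearMap.comp_apply, LinearMap.mulRight_apply, mul_assoc, ← inr_mul,
    comulLin_inl_mul_inr, comulLin_inr]
  rw [sum_comul_mul (fun a b => (A.inl x * A.inr a) ⊗ₜ[k] A.inr b)]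
  simp [Finset.sum_mul_sum, mul_assoc, inr_mul]

theorem comulLin_inl_mul (x : L) (z : A.Smash) :
    A.comulLin (A.inl x * z) = (A.inl x ⊗ₜ 1) * A.comulLin z := by
  refine A.ext_inl_inr (F := A.comulLin ∘ₗ LinearMap.mulLeft k (A.inl x))
    (G := LinearMap.mulLeft k (A.inl x ⊗ₜ 1) ∘ₗ A.comulLin) (fun y f => ?_) z
  simp [← mul_assoc, ← inl_mul, comulLin_inl_mul_inr]

/-- The crucial case of multiplicativity over k: f y = (f₁ ▹ y)f₂ is sent to (f₁ ▹ y)f₂ ⊗ f₃, which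
is f₁y ⊗ f₂ by coassociativity. -/
theorem comulLin_mul_inl (z : A.Smash) (y : L) :
    A.comulLin (z * A.inl y) = A.comulLin z * (A.inl y ⊗ₜ 1) := by
  refine A.ext_inl_inr (F := A.comulLin ∘ₗ LinearMap.mulRight k (A.inl y))
    (G := LinearMap.mulRight k (A.inl y ⊗ₜ 1) ∘ₗ A.comulLin) (fun x f => ?_) z
  simp only [LinearMap.comp_apply, LinearMap.mulRight_apply, mul_assoc, comulLin_inl_mul]
  congr 1
  simp only [inr_mul_inl, map_sum, comulLin_inl_mul_inr, comulLin_inr, Finset.sum_mul,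
    Algebra.TensorProduct.tmul_mul_tmul, mul_one, TensorProduct.sum_tmul]
  exact (sum_coassoc (fun a b c => (A.inl (A.act a y) * A.inr b) ⊗ₜ[k] A.inr c) f).symm

/-- The coproduct of `L ♯ H`, as an algebra map to the tensor product over `k`. -/
noncomputable def comulHom : A.Smash →ₐ[k] A.Smash ⊗[k] A.Smash :=
  AlgHom.ofLinearMap A.comulLin (by rw [← A.inl_one, comulLin_inl]; rfl) fun w z => by
    refine A.ext_inl_inr (F := A.comulLin ∘ₗ LinearMap.mulLeft k w)
      (G := LinearMap.mulLeft k (A.comulLin w) ∘ₗ A.comulLin) (fun x f => ?_) z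
    simp only [LinearMap.comp_apply, LinearMap.mulLeft_apply, ← mul_assoc, comulLin_mul_inr,
      comulLin_mul_inl, comulLin_inl]

theorem comulHom_apply (z : A.Smash) : A.comulHom z = A.comulLin z := rfl

theorem coprod_eq (P : Submodule k (A.Smash ⊗[k] A.Smash)) :
    A.coprod P = P.mkQ ∘ₗ A.comulHom.toLinearMap := rfl

/-- Coassociativity of ρ. This form exhibits target elements in the first leg, ready to be moved
across a balanced tensor product. -/
theorem comulLin_target (ρ : RightComodule k H L) (x : L) : A.comulLin (A.target ρ x) =
    ∑ p ∈ rep (ρ.coact x), A.target ρ p.1 ⊗ₜ A.inr p.2 := by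
  simp only [target_apply, map_sum, comulLin_inl_mul_inr, TensorProduct.sum_tmul]
  exact (sum_rep_assoc (fun a b c => (A.inl a * A.inr b) ⊗ₜ[k] A.inr c) (ρ.coassoc x)).symm

section Target

variable {A} {ρ : RightComodule k H L} (hρ : IsAntiHom (A.target ρ))

include hρ

/-- Apply the counit to ρ(ax) = ρ(x)ρ(a); it retracts ρ and turns left multiplication by H into the
action. -/
theorem sum_mul_act (a x : L) : ∑ p ∈ rep (ρ.coact x), p.1 * A.act p.2 a = a * x := by
  have h := congrArg A.counit (hρ.map_mul a x)
  rw [counit_target, A.target_apply ρ x] at h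
  simpa [Finset.sum_mul, mul_assoc, counit_inl_mul, counit_inr_mul, counit_target] using h.symm

/-- ρ(x)a = x₀(x₁ ▹ a)x₂, and coassociativity groups the first two factors into a x₀ by braided
commutativity. -/
theorem inl_mul_target (a x : L) : A.inl a * A.target ρ x = A.target ρ x * A.inl a := by
  simp only [target_apply, Finset.sum_mul, Finset.mul_sum, mul_assoc, inr_mul_inl]
  simp only [← mul_assoc, ← inl_mul]
  rw [← sum_rep_assoc (fun b c d => A.inl (b * A.act c a) * A.inr d) (ρ.coassoc x)]
  simp only [← Finset.sum_mul, ← map_sum, sum_mul_act hρ]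

/-- In ρ(xy) = ρ(y) x₀x₁ the factor x₀ commutes with ρ(y), which leaves x₀y₀y₁x₁. -/
theorem rightComoduleAlgebraProperty : RightComoduleAlgebraProperty ρ := by
  refine ⟨fun x y => A.of.injective ?_, A.of.injective hρ.map_one⟩
  refine (hρ.map_mul x y).trans ?_
  rw [← sum_rep (ρ.coact x), ← sum_rep (ρ.coact y), A.target_apply ρ x]
  simp only [Finset.mul_sum, ← mul_assoc, ← inl_mul_target hρ]
  simp only [target_apply, TensorProduct.sum_tmul, TensorProduct.tmul_sum, map_sum,
    TensorProduct.tensorTensorTensorComm_tmul, TensorProduct.map_tmul, LinearMap.mul'_apply,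
    LinearMap.comp_apply, LinearEquiv.coe_coe, TensorProduct.comm_tmul, ← inl_mul_inr, inl_mul,
    inr_mul, Finset.sum_mul, Finset.mul_sum, mul_assoc]
  exact Finset.sum_comm

theorem leftRightBraidedCommutative : LeftRightBraidedCommutative A ρ := fun a x => by
  rw [← sum_mul_act hρ a x]
  conv_lhs => rw [← sum_rep (ρ.coact x)]
  simp

end Target

/-- The two sides of the Yetter-Drinfeld condition are f ρ(x) and ρ(f₂ ▹ x) f₁, read in L ⊗ H. -/
theorem leftRightYDCondition_of {ρ : RightComodule k H L}
    (h : ∀ f x, A.inr f * A.target ρ x =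
      ∑ p ∈ Δr k f, A.target ρ (A.act p.2 x) * A.inr p.1) : LeftRightYDCondition A ρ := by
  have aux : ∀ t g, A.of ((LinearMap.mul' k H).lTensor L (TensorProduct.assoc k L H H (t ⊗ₜ g))) =
      A.of t * A.inr g := fun t g => by
    induction t using TensorProduct.induction_on with
    | zero => simp
    | add s t hs ht => simp only [TensorProduct.add_tmul, map_add, hs, ht, add_mul]
    | tmul x f => rw [of_mul_inr]; rfl
  intro f x
  apply A.of.injective
  refine (A.of_diag f (ρ.coact x)).trans ((h f x).trans ?_)
  conv_rhs => rw [← sum_rep (comul (R := k) f)]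
  simp only [map_sum, TensorProduct.comm_tmul, LinearMap.rTensor_tmul, aux]
  rfl

end Bialgebra

section HopfAlgebra

variable {k H L : Type*} [CommRing k] [Ring H] [HopfAlgebra k H] [Ring L] [Algebra k L]
variable (A : LeftModuleAlgebra k H L) (ρ : RightComodule k H L)

theorem isSmashCoprod : IsSmashCoprod A.inr A.comulHom where
  coassoc := by
    refine A.ext_inl_inr (F := (TensorProduct.assoc k _ _ _).toLinearMap ∘ₗ
      A.comulHom.toLinearMap.rTensor A.Smash ∘ₗ A.comulLin)
      (G := A.comulHom.toLinearMap.lTensor A.Smash ∘ₗ A.comulLin) fun x f => ?_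
    simp only [LinearMap.comp_apply, comulLin_inl_mul_inr, map_sum, LinearMap.rTensor_tmul,
      LinearMap.lTensor_tmul, AlgHom.toLinearMap_apply, comulHom_apply, comulLin_inr,
      TensorProduct.sum_tmul, TensorProduct.tmul_sum, LinearEquiv.coe_coe,
      TensorProduct.assoc_tmul]
    exact sum_coassoc (fun a b c => (A.inl x * A.inr a) ⊗ₜ[k] (A.inr b ⊗ₜ[k] A.inr c)) f
  map_ι := A.comulLin_inr

theorem antipode_inl_mul_inr (x : L) (f : H) : A.antipode ρ (A.inl x * A.inr f) =
    ∑ p ∈ rep (ρ.coact x),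
      A.inr (HopfAlgebra.antipode k f * HopfAlgebra.antipode k (HopfAlgebra.antipode k p.2)) *
        A.inl p.1 := by
  rw [antipode, lift_inl_mul_inr, LinearMap.mk₂_apply]
  conv_lhs => rw [← sum_rep (ρ.coact x)]
  simp [hMul]

theorem antipode_inl (x : L) : A.antipode ρ (A.inl x) =
    ∑ p ∈ rep (ρ.coact x),
      A.inr (HopfAlgebra.antipode k (HopfAlgebra.antipode k p.2)) * A.inl p.1 := by
  simpa [inr_one] using A.antipode_inl_mul_inr ρ x 1

theorem antipode_mul_inr (x : L) (f : H) : A.antipode ρ (A.inl x * A.inr f) =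
    A.inr (HopfAlgebra.antipode k f) * A.antipode ρ (A.inl x) := by
  rw [antipode_inl, antipode_inl_mul_inr, Finset.mul_sum]
  simp only [inr_mul, mul_assoc]

/-- S(x₂)S²(x₁) = S(S(x₁)x₂) collapses to the counit; this is what the square of S in the definition
of τ is for. -/
theorem antipode_target (x : L) : A.antipode ρ (A.target ρ x) = A.inl x := by
  simp only [target_apply, map_sum, antipode_inl_mul_inr]
  rw [sum_rep_assoc (fun a b c => A.inr (HopfAlgebra.antipode k c *
    HopfAlgebra.antipode k (HopfAlgebra.antipode k b)) * A.inl a) (ρ.coassoc x)]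
  simp only [← antipode_mul_antidistrib]
  simp only [fun x y => sum_antipode_mul (k := k)
    (fun g => A.inr (HopfAlgebra.antipode k g) * A.inl x) y]
  rw [HopfAlgebra.antipode_one, inr_one]
  simpa using sum_coact_counit ρ A.inl x

end HopfAlgebra

end LeftModuleAlgebra

/-! ### The smash product H ♯ R, mirror image of L ♯ H -/

namespace RightModuleAlgebra

section Bialgebra

variable {k H R : Type*} [CommRing k] [Ring H] [Bialgebra k H] [Ring R] [Algebra k R]
variable (B : RightModuleAlgebra k H R)

theorem of_tmul_mul_of_tmul (f g : H) (a b : R) : B.of (f ⊗ₜ a) * B.of (g ⊗ₜ b) =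
    ∑ p ∈ Δr k g, B.of ((f * p.1) ⊗ₜ (B.act a p.2 * b)) := by
  rw [of_mul_of]
  conv_lhs => rw [← sum_rep (comul (R := k) g)]
  simp

theorem inl_apply (f : H) : B.inl f = B.of (f ⊗ₜ 1) := rfl

theorem inr_apply (y : R) : B.inr y = B.of (1 ⊗ₜ y) := rfl

theorem inl_one : B.inl 1 = 1 := rfl

theorem inr_one : B.inr 1 = 1 := rfl

theorem of_mul_inr (f : H) (a b : R) : B.of (f ⊗ₜ a) * B.inr b = B.of (f ⊗ₜ (a * b)) := by
  rw [inr_apply, mul_def]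
  simp [smashMul_tmul, diag_tmul, Algebra.TensorProduct.one_def, B.act_one]

theorem inl_mul_inr (f : H) (y : R) : B.inl f * B.inr y = B.of (f ⊗ₜ y) := by
  rw [inl_apply, of_mul_inr, one_mul]

theorem inr_mul (a b : R) : B.inr (a * b) = B.inr a * B.inr b := (B.of_mul_inr 1 a b).symm

theorem of_diag (f : H) (t : H ⊗[k] R) : B.of (B.diag f t) = B.of t * B.inl f := by
  have h : (LinearMap.mul k R).flip 1 = LinearMap.id := by ext; simp
  rw [inl_apply, mul_def]
  simp [smashMul_tmul, h]

theorem inr_mul_inl (y : R) (f : H) :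
    B.inr y * B.inl f = ∑ p ∈ Δr k f, B.inl p.1 * B.inr (B.act y p.2) := by
  rw [inr_apply, inl_apply, of_tmul_mul_of_tmul]
  simp [inl_mul_inr]

theorem inl_mul_of (f g : H) (y : R) : B.inl f * B.of (g ⊗ₜ y) = B.of ((f * g) ⊗ₜ y) := by
  rw [inl_apply, of_tmul_mul_of_tmul]
  simp only [B.one_act, smul_mul_assoc, one_mul, TensorProduct.tmul_smul, map_smul]
  exact sum_counit_right (fun g => B.of ((f * g) ⊗ₜ y)) g

theorem inl_mul (f g : H) : B.inl (f * g) = B.inl f * B.inl g := (B.inl_mul_of f g 1).symm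

theorem of_eq_sum (t : H ⊗[k] R) : B.of t = ∑ p ∈ rep t, B.inl p.1 * B.inr p.2 := by
  conv_lhs => rw [← sum_rep t]
  simp [inl_mul_inr]

theorem target_apply (lam : LeftComodule k H R) (y : R) :
    B.target lam y = ∑ p ∈ rep (lam.coact y), B.inl p.1 * B.inr p.2 := B.of_eq_sum _

theorem eq_sum (z : B.Smash) : ∃ s : Finset (H × R), z = ∑ p ∈ s, B.inl p.1 * B.inr p.2 :=
  ⟨_, B.of_eq_sum (B.of.symm z)⟩

theorem ext_inl_inr {M : Type*} [AddCommGroup M] [Module k M] {F G : B.Smash →ₗ[k] M}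
    (h : ∀ f y, F (B.inl f * B.inr y) = G (B.inl f * B.inr y)) (z : B.Smash) : F z = G z := by
  obtain ⟨s, rfl⟩ := B.eq_sum z
  simp only [map_sum, h]

theorem lift_inl_mul_inr {M : Type*} [AddCommGroup M] [Module k M] (F : H →ₗ[k] R →ₗ[k] M)
    (f : H) (y : R) : B.lift F (B.inl f * B.inr y) = F f y := by
  rw [inl_mul_inr]
  simp [lift]

theorem counit_inl_mul_inr (f : H) (y : R) :
    B.counit (B.inl f * B.inr y) = Coalgebra.counit (R := k) f • y :=
  B.lift_inl_mul_inr _ f y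

theorem counit_mul_inr (a : R) (z : B.Smash) : B.counit (z * B.inr a) = B.counit z * a := by
  refine B.ext_inl_inr (F := B.counit ∘ₗ LinearMap.mulRight k (B.inr a))
    (G := LinearMap.mulRight k a ∘ₗ B.counit) (fun f y => ?_) z
  simp [mul_assoc, ← inr_mul, counit_inl_mul_inr]

theorem counit_mul_inl (g : H) (z : B.Smash) : B.counit (z * B.inl g) = B.act (B.counit z) g := by
  refine B.ext_inl_inr (F := B.counit ∘ₗ LinearMap.mulRight k (B.inl g))
    (G := B.act.flip g ∘ₗ B.counit) (fun f y => ?_) z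
  simp only [LinearMap.comp_apply, LinearMap.mulRight_apply, mul_assoc, inr_mul_inl,
    Finset.mul_sum, map_sum]
  simp only [← mul_assoc, ← inl_mul, counit_inl_mul_inr, Bialgebra.counit_mul, mul_smul,
    map_smul, LinearMap.flip_apply]
  rw [← Finset.smul_sum, sum_counit_left (fun h => B.act y h)]

theorem sum_counit_coact {M : Type*} [AddCommGroup M] [Module k M] (lam : LeftComodule k H R)
    (G : R →ₗ[k] M) (y : R) :
    ∑ p ∈ rep (lam.coact y), Coalgebra.counit (R := k) p.1 • G p.2 = G y := by
  conv_rhs => rw [← lam.counit_coact y, ← sum_rep (lam.coact y)]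
  simp

theorem counit_target (lam : LeftComodule k H R) (y : R) : B.counit (B.target lam y) = y := by
  simp only [target_apply, map_sum, counit_inl_mul_inr]
  exact sum_counit_coact lam LinearMap.id y

/-- The coproduct of `H ♯ R`, as a linear map to the tensor product over `k`. -/
noncomputable def comulLin : B.Smash →ₗ[k] B.Smash ⊗[k] B.Smash :=
  TensorProduct.map B.inl B.of.toLinearMap ∘ₗ (TensorProduct.assoc k H H R).toLinearMap ∘ₗ
    (comul (R := k) (A := H)).rTensor R ∘ₗ B.of.symm.toLinearMap

theorem comulLin_inl_mul_inr (f : H) (y : R) : B.comulLin (B.inl f * B.inr y) =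
    ∑ p ∈ Δr k f, B.inl p.1 ⊗ₜ (B.inl p.2 * B.inr y) := by
  rw [inl_mul_inr]
  simp only [comulLin, LinearMap.comp_apply, LinearEquiv.coe_coe, LinearEquiv.symm_apply_apply,
    LinearMap.rTensor_tmul]
  conv_lhs => rw [← sum_rep (comul (R := k) f)]
  simp [TensorProduct.sum_tmul, inl_mul_inr]

theorem comulLin_inr (y : R) : B.comulLin (B.inr y) = 1 ⊗ₜ B.inr y := by
  have h := B.comulLin_inl_mul_inr 1 y
  rw [inl_one, one_mul] at h
  rw [h, Δr, Bialgebra.comul_one, Algebra.TensorProduct.one_def,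
    sum_rep_tmul (fun a b => B.inl a ⊗ₜ[k] (B.inl b * B.inr y)), inl_one, one_mul]

theorem comulLin_inl (f : H) : B.comulLin (B.inl f) =
    ∑ p ∈ Δr k f, B.inl p.1 ⊗ₜ B.inl p.2 := by
  simpa [inr_one] using B.comulLin_inl_mul_inr f 1

theorem comulLin_inl_mul (g : H) (z : B.Smash) :
    B.comulLin (B.inl g * z) = B.comulLin (B.inl g) * B.comulLin z := by
  refine B.ext_inl_inr (F := B.comulLin ∘ₗ LinearMap.mulLeft k (B.inl g))
    (G := LinearMap.mulLeft k (B.comulLin (B.inl g)) ∘ₗ B.comulLin) (fun f y => ?_) z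
  simp only [LinearMap.comp_apply, LinearMap.mulLeft_apply, ← mul_assoc, ← inl_mul,
    comulLin_inl_mul_inr, comulLin_inl]
  rw [sum_comul_mul (fun a b => B.inl a ⊗ₜ[k] (B.inl b * B.inr y))]
  simp [Finset.sum_mul_sum, mul_assoc, inl_mul]

theorem comulLin_mul_inr (z : B.Smash) (y : R) :
    B.comulLin (z * B.inr y) = B.comulLin z * (1 ⊗ₜ B.inr y) := by
  refine B.ext_inl_inr (F := B.comulLin ∘ₗ LinearMap.mulRight k (B.inr y))
    (G := LinearMap.mulRight k (1 ⊗ₜ B.inr y) ∘ₗ B.comulLin) (fun f x => ?_) z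
  simp [mul_assoc, ← inr_mul, comulLin_inl_mul_inr]

theorem comulLin_inr_mul (y : R) (z : B.Smash) :
    B.comulLin (B.inr y * z) = (1 ⊗ₜ B.inr y) * B.comulLin z := by
  refine B.ext_inl_inr (F := B.comulLin ∘ₗ LinearMap.mulLeft k (B.inr y))
    (G := LinearMap.mulLeft k (1 ⊗ₜ B.inr y) ∘ₗ B.comulLin) (fun f x => ?_) z
  simp only [LinearMap.comp_apply, LinearMap.mulLeft_apply, ← mul_assoc, comulLin_mul_inr]
  congr 1
  simp only [inr_mul_inl, map_sum, comulLin_inl_mul_inr, comulLin_inl, Finset.mul_sum,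
    Algebra.TensorProduct.tmul_mul_tmul, one_mul, TensorProduct.tmul_sum]
  exact sum_coassoc (fun a b c => B.inl a ⊗ₜ[k] (B.inl b * B.inr (B.act y c))) f

/-- The coproduct of `H ♯ R`, as an algebra map to the tensor product over `k`. -/
noncomputable def comulHom : B.Smash →ₐ[k] B.Smash ⊗[k] B.Smash :=
  AlgHom.ofLinearMap B.comulLin (by rw [← B.inr_one, comulLin_inr]; rfl) fun w z => by
    refine B.ext_inl_inr (F := B.comulLin ∘ₗ LinearMap.mulRight k z)
      (G := LinearMap.mulRight k (B.comulLin z) ∘ₗ B.comulLin) (fun f y => ?_) w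
    simp only [LinearMap.comp_apply, LinearMap.mulRight_apply, mul_assoc, comulLin_inl_mul,
      comulLin_inr_mul, comulLin_inr]

theorem comulHom_apply (z : B.Smash) : B.comulHom z = B.comulLin z := rfl

theorem coprod_eq (P : Submodule k (B.Smash ⊗[k] B.Smash)) :
    B.coprod P = P.mkQ ∘ₗ B.comulHom.toLinearMap := rfl

theorem comulLin_target (lam : LeftComodule k H R) (y : R) : B.comulLin (B.target lam y) =
    ∑ p ∈ rep (lam.coact y), B.inl p.1 ⊗ₜ B.target lam p.2 := by
  simp only [target_apply, map_sum, comulLin_inl_mul_inr, TensorProduct.tmul_sum]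
  exact sum_rep_assoc (fun a b c => B.inl a ⊗ₜ[k] (B.inl b * B.inr c)) (lam.coassoc y)

section Target

variable {B} {lam : LeftComodule k H R} (hlam : IsAntiHom (B.target lam))

include hlam

theorem sum_act_mul (a y : R) : ∑ p ∈ rep (lam.coact y), B.act a p.1 * p.2 = y * a := by
  have h := congrArg B.counit (hlam.map_mul y a)
  rw [counit_target, B.target_apply lam y] at h
  simpa [Finset.mul_sum, ← mul_assoc, counit_mul_inl, counit_mul_inr, counit_target] using h.symm

theorem inr_mul_target (a y : R) : B.inr a * B.target lam y = B.target lam y * B.inr a := by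
  simp only [target_apply, Finset.sum_mul, Finset.mul_sum, ← mul_assoc, inr_mul_inl]
  simp only [mul_assoc, ← inr_mul]
  rw [sum_rep_assoc (fun b c d => B.inl b * B.inr (B.act a c * d)) (lam.coassoc y)]
  simp only [← Finset.mul_sum, ← map_sum, sum_act_mul hlam]

theorem leftComoduleAlgebraProperty : LeftComoduleAlgebraProperty lam := by
  refine ⟨fun x y => B.of.injective ?_, B.of.injective hlam.map_one⟩
  refine (hlam.map_mul x y).trans ?_
  rw [← sum_rep (lam.coact x), ← sum_rep (lam.coact y), B.target_apply lam y]
  simp only [Finset.sum_mul, mul_assoc, inr_mul_target hlam]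
  simp only [target_apply, TensorProduct.sum_tmul, TensorProduct.tmul_sum, map_sum,
    TensorProduct.tensorTensorTensorComm_tmul, TensorProduct.map_tmul, LinearMap.mul'_apply,
    LinearMap.comp_apply, LinearEquiv.coe_coe, TensorProduct.comm_tmul, ← inl_mul_inr, inl_mul,
    inr_mul, Finset.sum_mul, Finset.mul_sum, mul_assoc]

theorem rightLeftBraidedCommutative : RightLeftBraidedCommutative B lam := fun a y => by
  rw [← sum_act_mul hlam a y]
  conv_lhs => rw [← sum_rep (lam.coact y)]
  simp

end Target

theorem rightLeftYDCondition_of {lam : LeftComodule k H R}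
    (h : ∀ f y, B.target lam y * B.inl f =
      ∑ p ∈ Δr k f, B.inl p.2 * B.target lam (B.act y p.1)) : RightLeftYDCondition B lam := by
  have aux : ∀ t g, B.of ((LinearMap.mul' k H).rTensor R
      ((TensorProduct.assoc k H H R).symm (g ⊗ₜ t))) = B.inl g * B.of t := fun t g => by
    induction t using TensorProduct.induction_on with
    | zero => simp
    | add s t hs ht => simp only [TensorProduct.tmul_add, map_add, hs, ht, mul_add]
    | tmul f y => rw [inl_mul_of]; rfl
  intro f y
  apply B.of.injective
  refine (B.of_diag f (lam.coact y)).trans ((h f y).trans ?_)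
  conv_rhs => rw [← sum_rep (comul (R := k) f)]
  simp only [map_sum, TensorProduct.comm_tmul, LinearMap.lTensor_tmul, aux]
  rfl

end Bialgebra

section HopfAlgebra

variable {k H R : Type*} [CommRing k] [Ring H] [HopfAlgebra k H] [Ring R] [Algebra k R]
variable (B : RightModuleAlgebra k H R) (lam : LeftComodule k H R)

theorem isSmashCoprod : IsSmashCoprod B.inl B.comulHom where
  coassoc := by
    refine B.ext_inl_inr (F := (TensorProduct.assoc k _ _ _).toLinearMap ∘ₗ
      B.comulHom.toLinearMap.rTensor B.Smash ∘ₗ B.comulLin)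
      (G := B.comulHom.toLinearMap.lTensor B.Smash ∘ₗ B.comulLin) fun f y => ?_
    simp only [LinearMap.comp_apply, comulLin_inl_mul_inr, map_sum, LinearMap.rTensor_tmul,
      LinearMap.lTensor_tmul, AlgHom.toLinearMap_apply, comulHom_apply, comulLin_inl,
      TensorProduct.sum_tmul, TensorProduct.tmul_sum, LinearEquiv.coe_coe,
      TensorProduct.assoc_tmul]
    exact sum_coassoc (fun a b c => B.inl a ⊗ₜ[k] (B.inl b ⊗ₜ[k] (B.inl c * B.inr y))) f
  map_ι := B.comulLin_inl

theorem antipode_inl_mul_inr (f : H) (y : R) : B.antipode lam (B.inl f * B.inr y) =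
    ∑ p ∈ rep (lam.coact y), B.inr p.2 *
      B.inl (HopfAlgebra.antipode k (HopfAlgebra.antipode k p.1) * HopfAlgebra.antipode k f) := by
  rw [antipode, lift_inl_mul_inr, LinearMap.mk₂_apply]
  conv_lhs => rw [← sum_rep (lam.coact y)]
  simp [mulH]

theorem antipode_inr (y : R) : B.antipode lam (B.inr y) =
    ∑ p ∈ rep (lam.coact y),
      B.inr p.2 * B.inl (HopfAlgebra.antipode k (HopfAlgebra.antipode k p.1)) := by
  simpa [inl_one] using B.antipode_inl_mul_inr lam 1 y

theorem antipode_inl_mul (f : H) (y : R) : B.antipode lam (B.inl f * B.inr y) =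
    B.antipode lam (B.inr y) * B.inl (HopfAlgebra.antipode k f) := by
  rw [antipode_inr, antipode_inl_mul_inr, Finset.sum_mul]
  simp only [inl_mul, mul_assoc]

/-- Here S²(y₋₁)S(y₋₂) = S(y₋₂S(y₋₁)) collapses. -/
theorem antipode_target (y : R) : B.antipode lam (B.target lam y) = B.inr y := by
  simp only [target_apply, map_sum, antipode_inl_mul_inr]
  rw [← sum_rep_assoc (fun a b c => B.inr c * B.inl (HopfAlgebra.antipode k
    (HopfAlgebra.antipode k b) * HopfAlgebra.antipode k a)) (lam.coassoc y)]
  simp only [← antipode_mul_antidistrib]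
  simp only [fun x y => sum_mul_antipode (k := k)
    (fun g => B.inr x * B.inl (HopfAlgebra.antipode k g)) y]
  rw [HopfAlgebra.antipode_one, inl_one]
  simpa using sum_counit_coact lam B.inr y

end HopfAlgebra

end RightModuleAlgebra

/-! ### Antiisomorphisms from a common image -/

section AntiEquiv

variable {k P Q K : Type*} [CommRing k] [Ring P] [Algebra k P] [Ring Q] [Algebra k Q]
  [Ring K] [Algebra k K]

theorem isAntiHom_antiLin (φ : P ≃ₐ[k] Qᵐᵒᵖ) : IsAntiHom (antiLin φ).toLinearMap where
  map_one := by simp [antiLin]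
  map_mul a b := by simp [antiLin]

/-- As `e` retracts `j`, the map must be `e ∘ i`. Equality of the images gives `j ∘ e ∘ i = i`, and
injectivity of `j` carries antimultiplicativity over from K. -/
theorem existsUnique_antiEquiv {i : P →ₗ[k] K} {j : Q →ₗ[k] K} {e : K →ₗ[k] Q}
    (he : ∀ y, e (j y) = y) (hi : Function.Injective i) (hi₁ : i 1 = 1)
    (hi₂ : ∀ a b, i (a * b) = i a * i b) (hj : IsAntiHom j) (h : Set.range i = Set.range j) :
    ∃! φ : P ≃ₐ[k] Qᵐᵒᵖ, ∀ x, i x = j (antiLin φ x) := by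
  have hje : ∀ x, j (e (i x)) = i x := fun x => by
    obtain ⟨y, hy⟩ : i x ∈ Set.range j := h ▸ Set.mem_range_self x
    rw [← hy, he]
  have hjinj : Function.Injective j := Function.LeftInverse.injective he
  let F : P →ₐ[k] Qᵐᵒᵖ := AlgHom.ofLinearMap
    ((MulOpposite.opLinearEquiv k).toLinearMap ∘ₗ e ∘ₗ i)
    (by
      have h1 : e 1 = 1 := by rw [← hj.map_one, he]
      simp [hi₁, h1])
    (fun a b => by
      apply MulOpposite.unop_injective
      apply hjinj
      simp [hj.map_mul, hje, ← hi₂])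
  have hF : Function.Bijective F := by
    refine ⟨fun a b hab => hi ?_, fun y => ?_⟩
    · rw [← hje a, ← hje b]
      exact congrArg (fun y => j (MulOpposite.unop y)) hab
    · obtain ⟨x, hx⟩ : j y.unop ∈ Set.range i := h ▸ Set.mem_range_self _
      refine ⟨x, ?_⟩
      change MulOpposite.op (e (i x)) = y
      rw [hx, he, MulOpposite.op_unop]
  refine ⟨AlgEquiv.ofBijective F hF, fun x => (hje x).symm, fun ψ hψ => ?_⟩
  ext x
  apply MulOpposite.unop_injective
  apply hjinj
  exact (hψ x).symm.trans (hje x).symm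

end AntiEquiv

/-! ### Smash product algebras identified by an isomorphism -/

namespace IsSmashPair

section

variable {k H L R K K' : Type*} [CommRing k] [Ring H] [HopfAlgebra k H]
  [Ring L] [Algebra k L] [Ring R] [Algebra k R] [Ring K] [Algebra k K] [Ring K'] [Algebra k K']
  {A : LeftModuleAlgebra k H L} {B : RightModuleAlgebra k H R}
  {φ : L ≃ₗ[k] R} {θ : R ≃ₗ[k] L} {αL βL : L →ₗ[k] K} {αR βR : R →ₗ[k] K} {ι : H →ₗ[k] K}
  {eL : K →ₗ[k] L} {eR : K →ₗ[k] R}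

theorem map (hK : IsSmashPair A B φ θ αL βL αR βR ι eL eR) (Ψ : K ≃ₐ[k] K')
    {αL' βL' : L →ₗ[k] K'} {αR' βR' : R →ₗ[k] K'} {ι' : H →ₗ[k] K'}
    {eL' : K' →ₗ[k] L} {eR' : K' →ₗ[k] R} (hαL : ∀ x, αL' x = Ψ (αL x))
    (hβL : ∀ x, βL' x = Ψ (βL x)) (hαR : ∀ y, αR' y = Ψ (αR y)) (hβR : ∀ y, βR' y = Ψ (βR y))
    (hι : ∀ f, ι' f = Ψ (ι f)) (heL : ∀ z, eL' (Ψ z) = eL z) (heR : ∀ z, eR' (Ψ z) = eR z) :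
    IsSmashPair A B φ θ αL' βL' αR' βR' ι' eL' eR' where
  αL_one := by rw [hαL, hK.αL_one, map_one]
  αL_mul a b := by simp only [hαL, hK.αL_mul, map_mul]
  αR_one := by rw [hαR, hK.αR_one, map_one]
  αR_mul a b := by simp only [hαR, hK.αR_mul, map_mul]
  ι_one := by rw [hι, hK.ι_one, map_one]
  ι_mul a b := by simp only [hι, hK.ι_mul, map_mul]
  φ_anti := hK.φ_anti
  θ_anti := hK.θ_anti
  ι_αL f x := by simp only [hι, hαL, ← map_mul, ← map_sum, hK.ι_αL]
  αR_ι y f := by simp only [hι, hαR, ← map_mul, ← map_sum, hK.αR_ι]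
  βL_θ y := by rw [hβL, hαR, hK.βL_θ]
  βR_φ x := by rw [hβR, hαL, hK.βR_φ]
  comm x y := by simp only [hαL, hαR, ← map_mul, hK.comm]
  exists_left z := by
    obtain ⟨s, hs⟩ := hK.exists_left (Ψ.symm z)
    refine ⟨s, ?_⟩
    rw [← Ψ.apply_symm_apply z, hs]
    simp only [hαL, hι, map_sum, map_mul]
  exists_right z := by
    obtain ⟨s, hs⟩ := hK.exists_right (Ψ.symm z)
    refine ⟨s, ?_⟩
    rw [← Ψ.apply_symm_apply z, hs]
    simp only [hαR, hι, map_sum, map_mul]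
  eL_tmul x f := by rw [hαL, hι, ← map_mul, heL, hK.eL_tmul]
  eR_tmul f y := by rw [hαR, hι, ← map_mul, heR, hK.eR_tmul]
  eL_βL x := by rw [hβL, heL, hK.eL_βL]
  eR_βR y := by rw [hβR, heR, hK.eR_βR]

variable (hK : IsSmashPair A B φ θ αL βL αR βR ι eL eR)

include hK

section Right

variable {ρ : RightComodule k H L}
  (hβL : ∀ x, βL x = ∑ p ∈ rep (ρ.coact x), αL p.1 * ι p.2)

include hβL

/-- `βL(x₀) S(x₁) = x` -/
theorem sum_βL_antipode (x : L) :
    ∑ p ∈ rep (ρ.coact x), βL p.1 * ι (antipode k p.2) = αL x := by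
  simp only [hβL, Finset.sum_mul, mul_assoc, ← hK.ι_mul]
  rw [sum_rep_assoc (fun a b c => αL a * ι (b * antipode k c)) (ρ.coassoc x)]
  simp only [fun x y => sum_mul_antipode (k := k) (fun g => αL x * ι g) y, hK.ι_one, mul_one]
  exact LeftModuleAlgebra.sum_coact_counit ρ αL x

/-- Apply ε_R to βL(x) = x₀x₁. The next lemma applies it to βL(x₀)S(x₁) = x. -/
theorem sum_act_φ_coact (x : L) :
    ∑ p ∈ rep (ρ.coact x), B.act (φ p.1) p.2 = θ.symm x := by
  have h := congrArg eR (hβL x)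
  rw [hK.βL_apply, hK.eR_αR] at h
  simp [h, hK.eR_mul_ι, hK.eR_αL]

theorem sum_act_θ_symm_coact (x : L) :
    ∑ p ∈ rep (ρ.coact x), B.act (θ.symm p.1) (antipode k p.2) = φ x := by
  have h := congrArg eR (hK.sum_βL_antipode hβL x)
  simpa [hK.βL_apply, hK.eR_mul_ι, hK.eR_αL, hK.eR_αR] using h

end Right

section Left

variable {lam : LeftComodule k H R}
  (hβR : ∀ y, βR y = ∑ p ∈ rep (lam.coact y), ι p.1 * αR p.2)

include hβR

/-- `S(y₋₁) βR(y₀) = y` -/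
theorem sum_antipode_βR (y : R) :
    ∑ p ∈ rep (lam.coact y), ι (antipode k p.1) * βR p.2 = αR y := by
  simp only [hβR, Finset.mul_sum, ← mul_assoc, ← hK.ι_mul]
  rw [← sum_rep_assoc (fun a b c => ι (antipode k a * b) * αR c) (lam.coassoc y)]
  simp only [fun x y => sum_antipode_mul (k := k) (fun g => ι g * αR x) y, hK.ι_one, one_mul]
  exact RightModuleAlgebra.sum_counit_coact lam αR y

theorem sum_act_θ_coact (y : R) :
    ∑ p ∈ rep (lam.coact y), A.act p.1 (θ p.2) = φ.symm y := by
  have h := congrArg eL (hβR y)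
  rw [hK.βR_apply, hK.eL_αL] at h
  simp [h, hK.eL_ι_mul, hK.eL_αR]

theorem sum_act_φ_symm_coact (y : R) :
    ∑ p ∈ rep (lam.coact y), A.act (antipode k p.1) (φ.symm p.2) = θ y := by
  have h := congrArg eL (hK.sum_antipode_βR hβR y)
  simpa [hK.βR_apply, hK.eL_ι_mul, hK.eL_αL, hK.eL_αR] using h

end Left

end

end IsSmashPair

/-! ### The two smash products identified by `Ψ`: Yetter-Drinfeld structures and bialgebroids -/

section Identification

variable {k H L R : Type*} [CommRing k] [Ring H] [HopfAlgebra k H]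
  [Ring L] [Algebra k L] [Ring R] [Algebra k R]
  {A : LeftModuleAlgebra k H L} {ρ : RightComodule k H L}
  {B : RightModuleAlgebra k H R} {lam : LeftComodule k H R}
  (hρ : IsAntiHom (A.target ρ)) (hlam : IsAntiHom (B.target lam))
  {Ψ : A.Smash ≃ₐ[k] B.Smash} (hH : ∀ f : H, Ψ (A.inr f) = B.inl f)
  {φ : L ≃ₐ[k] Rᵐᵒᵖ} {θ : R ≃ₐ[k] Lᵐᵒᵖ}
  (hφ : ∀ x, Ψ (A.inl x) = B.target lam (antiLin φ x))
  (hθ : ∀ y, Ψ.symm (B.inr y) = A.target ρ (antiLin θ y))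

theorem symm_inl (hH : ∀ f : H, Ψ (A.inr f) = B.inl f) (f : H) : Ψ.symm (B.inl f) = A.inr f := by
  rw [← hH, AlgEquiv.symm_apply_apply]

include hφ in
theorem symm_target (y : R) : Ψ.symm (B.target lam y) = A.inl ((antiLin φ).symm y) := by
  rw [AlgEquiv.symm_apply_eq, hφ, LinearEquiv.apply_symm_apply]

include hθ in
theorem map_target (x : L) : Ψ (A.target ρ x) = B.inr ((antiLin θ).symm x) := by
  rw [← AlgEquiv.eq_symm_apply, hθ, LinearEquiv.apply_symm_apply]

include hρ hH hφ hθ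

/-- R and its counit are pulled back along `Ψ`. The commutation of L with R holds because the pulled
back R is the image of ρ. -/
theorem isSmashPair_left : IsSmashPair A B (antiLin φ) (antiLin θ) A.inl (A.target ρ)
    (Ψ.symm.toLinearMap ∘ₗ B.inr) (A.inl ∘ₗ (antiLin φ).symm.toLinearMap) A.inr A.counit
    (B.counit ∘ₗ Ψ.toLinearMap) where
  αL_one := A.inl_one
  αL_mul := A.inl_mul
  αR_one := by simp [B.inr_one]
  αR_mul a b := by simp [B.inr_mul]
  ι_one := A.inr_one
  ι_mul := A.inr_mul
  φ_anti := isAntiHom_antiLin φ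
  θ_anti := isAntiHom_antiLin θ
  ι_αL := A.inr_mul_inl
  αR_ι y f := by
    simp only [LinearMap.comp_apply, AlgEquiv.toLinearMap_apply, ← symm_inl hH, ← map_mul,
      ← map_sum, B.inr_mul_inl]
  βL_θ y := (hθ y).symm
  βR_φ x := by simp
  comm x y := by
    simp only [LinearMap.comp_apply, AlgEquiv.toLinearMap_apply, hθ]
    exact LeftModuleAlgebra.inl_mul_target hρ _ _
  exists_left := A.eq_sum
  exists_right z := by
    obtain ⟨s, hs⟩ := B.eq_sum (Ψ z)
    refine ⟨s, ?_⟩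
    rw [← Ψ.symm_apply_apply z, hs]
    simp [symm_inl hH]
  eL_tmul := A.counit_inl_mul_inr
  eR_tmul f y := by simp [hH, B.counit_inl_mul_inr]
  eL_βL := A.counit_target ρ
  eR_βR y := by simp [hφ, B.counit_target]

theorem isSmashPair_right : IsSmashPair A B (antiLin φ) (antiLin θ)
    (B.target lam ∘ₗ (antiLin φ).toLinearMap) (B.inr ∘ₗ (antiLin θ).symm.toLinearMap) B.inr
    (B.target lam) B.inl (A.counit ∘ₗ Ψ.symm.toLinearMap) B.counit := by
  refine (isSmashPair_left hρ hH hφ hθ).map Ψ ?_ ?_ ?_ ?_ ?_ ?_ ?_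
  · simp [hφ]
  · simp [map_target hθ]
  · simp
  · simp [hφ]
  · simp [hH]
  · simp
  · simp

omit hρ hθ in
theorem left_βR_apply (y : R) : (A.inl ∘ₗ (antiLin φ).symm.toLinearMap) y =
    ∑ p ∈ rep (lam.coact y), A.inr p.1 * (Ψ.symm.toLinearMap ∘ₗ B.inr) p.2 := by
  change A.inl ((antiLin φ).symm y) = _
  rw [← symm_target hφ, B.target_apply]
  simp [symm_inl hH]

omit hρ hφ in
theorem right_βL_apply (x : L) (hφ : ∀ x, Ψ (A.inl x) = B.target lam (antiLin φ x)) :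
    (B.inr ∘ₗ (antiLin θ).symm.toLinearMap) x =
      ∑ p ∈ rep (ρ.coact x), (B.target lam ∘ₗ (antiLin φ).toLinearMap) p.1 * B.inl p.2 := by
  change B.inr ((antiLin θ).symm x) = _
  rw [← map_target hθ, A.target_apply]
  simp [hH, hφ]

theorem isBraidedCommLeftRightYD : IsBraidedCommLeftRightYD A ρ where
  yetterDrinfeld := A.leftRightYDCondition_of (isSmashPair_left hρ hH hφ hθ).ι_mul_βL
  comoduleAlgebra := LeftModuleAlgebra.rightComoduleAlgebraProperty hρ
  braidedComm := LeftModuleAlgebra.leftRightBraidedCommutative hρ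

include hlam in
theorem isBraidedCommRightLeftYD : IsBraidedCommRightLeftYD B lam where
  yetterDrinfeld := B.rightLeftYDCondition_of (isSmashPair_right hρ hH hφ hθ).βR_mul_ι
  comoduleAlgebra := RightModuleAlgebra.leftComoduleAlgebraProperty hlam
  braidedComm := RightModuleAlgebra.rightLeftBraidedCommutative hlam

omit hρ hH hφ in
theorem mkQ_comulHom_target {P : Submodule k (A.Smash ⊗[k] A.Smash)}
    (h : ∀ x, P.mkQ (∑ p ∈ rep (ρ.coact x), A.target ρ p.1 ⊗ₜ A.inr p.2) =
      P.mkQ (1 ⊗ₜ A.target ρ x)) (y : R) :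
    P.mkQ (A.comulHom ((Ψ.symm.toLinearMap ∘ₗ B.inr) y)) =
      P.mkQ (1 ⊗ₜ (Ψ.symm.toLinearMap ∘ₗ B.inr) y) := by
  simp only [LinearMap.comp_apply, AlgEquiv.toLinearMap_apply, hθ, A.comulHom_apply,
    A.comulLin_target, h]

/-- ρ is the target map of this tensor product, so δ(ρ(x)) = ρ(x₀) ⊗ x₁ ≡ 1 ⊗ x₀x₁ = 1 ⊗ ρ(x). -/
theorem isCoprodMod_left_left : IsCoprodMod A.inl (Ψ.symm.toLinearMap ∘ₗ B.inr) A.comulHom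
    (leftRel A.inl (A.target ρ)) := by
  refine (isSmashPair_left hρ hH hφ hθ).isCoprodMod_left A.isSmashCoprod
    (fun x => by rw [A.comulHom_apply, A.comulLin_inl]) (mkQ_comulHom_target hθ fun x => ?_)
  rw [A.target_apply, TensorProduct.tmul_sum, map_sum, map_sum]
  refine Finset.sum_congr rfl fun p _ => ?_
  rw [← mkQ_leftRel, mul_one]

/-- y₋₁ ⊗ λ(y₀) ≡ y₋₁y₀ ⊗ 1 = λ(y) ⊗ 1. -/
theorem isCoprodMod_right_right : IsCoprodMod (B.target lam ∘ₗ (antiLin φ).toLinearMap) B.inr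
    B.comulHom (rightRel B.inr (B.target lam)) := by
  refine (isSmashPair_right hρ hH hφ hθ).isCoprodMod_right B.isSmashCoprod (fun x => ?_)
    (fun y => by rw [B.comulHom_apply, B.comulLin_inr])
  simp only [LinearMap.comp_apply, LinearEquiv.coe_coe, B.comulHom_apply, B.comulLin_target]
  rw [B.target_apply, TensorProduct.sum_tmul, map_sum, map_sum]
  refine Finset.sum_congr rfl fun p _ => ?_
  rw [mkQ_rightRel, one_mul]

theorem isLeftBialgebroid_smash :
    IsLeftBialgebroid A.inl (A.target ρ) (A.coprod _) A.counit :=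
  (isSmashPair_left hρ hH hφ hθ).isLeftBialgebroid A.isSmashCoprod
    (isCoprodMod_left_left hρ hH hφ hθ) (A.coprod_eq _)

theorem isRightBialgebroid_smash :
    IsRightBialgebroid B.inr (B.target lam) (B.coprod _) B.counit :=
  (isSmashPair_right hρ hH hφ hθ).isRightBialgebroid B.isSmashCoprod
    (isCoprodMod_right_right hρ hH hφ hθ) (B.coprod_eq _)

end Identification

/-! ### The structures via φ and θ, and the symmetric Hopf algebroids -/

section Compatible

variable {k H L R : Type*} [CommRing k] [Ring H] [HopfAlgebra k H]
  [Ring L] [Algebra k L] [Ring R] [Algebra k R]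
  {A : LeftModuleAlgebra k H L} {ρ : RightComodule k H L}
  {B : RightModuleAlgebra k H R} {lam : LeftComodule k H R}
  (hρ : IsAntiHom (A.target ρ)) (hlam : IsAntiHom (B.target lam))
  {Ψ : A.Smash ≃ₐ[k] B.Smash} (hH : ∀ f : H, Ψ (A.inr f) = B.inl f)
  {φ : L ≃ₐ[k] Rᵐᵒᵖ} {θ : R ≃ₐ[k] Lᵐᵒᵖ}
  (hφ : ∀ x, Ψ (A.inl x) = B.target lam (antiLin φ x))
  (hθ : ∀ y, Ψ.symm (B.inr y) = A.target ρ (antiLin θ y))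

variable (ρ Ψ φ) in
/-- The structure maps on `L ♯ H` obtained from those of `H ♯ R` through `Ψ`. -/
noncomputable def leftSmashDataOfEquiv : HopfAlgebroidData k L R A.Smash :=
  leftSmashData A ρ (Ψ.symm.toLinearMap ∘ₗ B.inr) (A.inl ∘ₗ (antiLin φ).symm.toLinearMap)
    (B.counit ∘ₗ Ψ.toLinearMap)

variable (lam Ψ φ θ) in
/-- The structure maps on `H ♯ R` obtained from those of `L ♯ H` through `Ψ`. -/
noncomputable def rightSmashDataOfEquiv : HopfAlgebroidData k L R B.Smash :=
  rightSmashData B lam (B.target lam ∘ₗ (antiLin φ).toLinearMap)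
    (B.inr ∘ₗ (antiLin θ).symm.toLinearMap) (A.counit ∘ₗ Ψ.symm.toLinearMap)

include hρ hH hφ hθ

/-- α_R is S(y₋₁)βR(y₀) = y, and ε_R is determined by ε_R(x f) = φ(x) ◃ f. Agreement with the
transported structure needs no condition on the antipodes. -/
theorem leftDataVia_eq : leftDataVia A ρ B lam φ = leftSmashDataOfEquiv ρ Ψ φ := by
  have hK := isSmashPair_left hρ hH hφ hθ
  have h₁ : A.hMul ∘ₗ TensorProduct.map (antipode k) (antiLin φ).symm.toLinearMap ∘ₗ lam.coact =
      Ψ.symm.toLinearMap ∘ₗ B.inr := by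
    ext y
    rw [← hK.sum_antipode_βR (left_βR_apply hH hφ) y]
    simp only [LinearMap.comp_apply]
    conv_lhs => rw [← sum_rep (lam.coact y)]
    simp [LeftModuleAlgebra.hMul]
  have h₂ : A.lift (B.act ∘ₗ (antiLin φ).toLinearMap) = B.counit ∘ₗ Ψ.toLinearMap := by
    ext z
    refine A.ext_inl_inr (fun x f => ?_) z
    rw [A.lift_inl_mul_inr, hK.eR_mul_ι, hK.eR_αL]
    rfl
  rw [leftDataVia, h₁, h₂]
  rfl

/-- This rests on φ⁻¹(y) = y₋₁ ▹ θ(y₀) and φ(x) = θ⁻¹(x₀) ◃ S(x₁). -/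
theorem leftDataVia'_eq : leftDataVia' A ρ B lam θ = leftSmashDataOfEquiv ρ Ψ φ := by
  have hK := isSmashPair_left hρ hH hφ hθ
  have h₁ : A.target ρ ∘ₗ (antiLin θ).toLinearMap = Ψ.symm.toLinearMap ∘ₗ B.inr := by
    ext y
    exact (hθ y).symm
  have h₂ : TensorProduct.lift A.act ∘ₗ (antiLin θ).toLinearMap.lTensor H ∘ₗ lam.coact =
      (antiLin φ).symm.toLinearMap := by
    ext y
    refine Eq.trans ?_ (hK.sum_act_θ_coact (left_βR_apply hH hφ) y)
    simp only [LinearMap.comp_apply]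
    conv_lhs => rw [← sum_rep (lam.coact y)]
    simp
  rw [leftDataVia', h₁, h₂, leftSmashDataOfEquiv]
  congr 1
  ext z
  refine A.ext_inl_inr (fun x f => ?_) z
  rw [A.lift_inl_mul_inr, hK.eR_mul_ι, hK.eR_αL, LinearMap.mk₂_apply,
    ← hK.sum_act_θ_symm_coact (A.target_apply ρ) x]
  conv_lhs => rw [← sum_rep (ρ.coact x)]
  simp [B.act_mul]

theorem rightDataVia_eq : rightDataVia A ρ B lam φ = rightSmashDataOfEquiv lam Ψ φ θ := by
  have hK := isSmashPair_right hρ hH hφ hθ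
  have hK' := isSmashPair_left hρ hH hφ hθ
  have h₁ : TensorProduct.lift B.act ∘ₗ (antiLin φ).toLinearMap.rTensor H ∘ₗ ρ.coact =
      (antiLin θ).symm.toLinearMap := by
    ext x
    refine Eq.trans ?_ (hK'.sum_act_φ_coact (A.target_apply ρ) x)
    simp only [LinearMap.comp_apply]
    conv_lhs => rw [← sum_rep (ρ.coact x)]
    simp
  rw [rightDataVia, h₁, rightSmashDataOfEquiv]
  congr 1
  ext z
  refine B.ext_inl_inr (fun f y => ?_) z
  rw [B.lift_inl_mul_inr, hK.eL_ι_mul, hK.eL_αR, LinearMap.mk₂_apply,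
    ← hK.sum_act_φ_symm_coact (B.target_apply lam) y]
  conv_lhs => rw [← sum_rep (lam.coact y)]
  simp [A.mul_act]

theorem rightDataVia'_eq : rightDataVia' A ρ B lam θ = rightSmashDataOfEquiv lam Ψ φ θ := by
  have hK := isSmashPair_right hρ hH hφ hθ
  have h₁ : B.mulH ∘ₗ TensorProduct.map (antiLin θ).symm.toLinearMap (antipode k) ∘ₗ ρ.coact =
      B.target lam ∘ₗ (antiLin φ).toLinearMap := by
    ext x
    rw [← hK.sum_βL_antipode (fun x => right_βL_apply hH hθ x hφ) x]
    simp only [LinearMap.comp_apply]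
    conv_lhs => rw [← sum_rep (ρ.coact x)]
    simp [RightModuleAlgebra.mulH]
  have h₂ : B.lift (A.act.compl₂ (antiLin θ).toLinearMap) = A.counit ∘ₗ Ψ.symm.toLinearMap := by
    ext z
    refine B.ext_inl_inr (fun f y => ?_) z
    rw [B.lift_inl_mul_inr, hK.eL_ι_mul, hK.eL_αR]
    rfl
  rw [rightDataVia', h₁, h₂]
  rfl

/-! ### Consequences of the compatibility of τ and τ' -/

section Antipode

variable (hτ : ∀ z, Ψ (A.antipode ρ z) = B.antipode lam (Ψ z))

include hτ

omit hρ hH hθ in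
-- Ψτ(x) = τ'Ψ(x) = τ'(λ(φ(x))) = φ(x).
theorem antipode_inl_eq (x : L) :
    A.antipode ρ (A.inl x) = (Ψ.symm.toLinearMap ∘ₗ B.inr) (antiLin φ x) := by
  change _ = Ψ.symm (B.inr (antiLin φ x))
  rw [AlgEquiv.eq_symm_apply, hτ, hφ, B.antipode_target]

omit hρ hH hφ hτ in
theorem antipode_symm_inr (y : R) :
    A.antipode ρ ((Ψ.symm.toLinearMap ∘ₗ B.inr) y) = A.inl (antiLin θ y) := by
  change A.antipode ρ (Ψ.symm (B.inr y)) = _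
  rw [hθ, A.antipode_target]

omit hρ hH hφ in
theorem right_antipode_inr (y : R) : B.antipode lam (B.inr y) = Ψ (A.inl (antiLin θ y)) := by
  rw [← antipode_symm_inr hθ y, hτ]
  simp

omit hρ hH hφ hθ hτ in
theorem left_antipode_inr (f : H) :
    A.antipode ρ (A.inr f) = A.inr (antipode k f) * A.antipode ρ (A.inl 1) := by
  rw [← A.antipode_mul_inr, A.inl_one, one_mul]

omit hρ hH hθ in
/-- `x = S(x₁) φ(x₀)` in `H ♯ R` -/
theorem inl_eq_sum (x : L) : A.inl x = ∑ p ∈ rep (ρ.coact x),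
    A.inr (antipode k p.2) * (Ψ.symm.toLinearMap ∘ₗ B.inr) (antiLin φ p.1) := by
  -- Write x as τ(ρ(x)) and expand ρ(x) = x₀x₁ under τ.
  rw [← A.antipode_target ρ x, A.target_apply]
  simp only [map_sum, A.antipode_mul_inr, antipode_inl_eq hφ hτ]

omit hρ hH hφ in
/-- `y = θ(y₀) S(y₋₁)` in `L ♯ H` -/
theorem inr_eq_sum (y : R) : B.inr y = ∑ p ∈ rep (lam.coact y),
    Ψ (A.inl (antiLin θ p.2)) * B.inl (antipode k p.1) := by
  rw [← B.antipode_target lam y, B.target_apply]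
  simp only [map_sum, B.antipode_inl_mul, right_antipode_inr hθ hτ]

omit hρ hθ in
-- In H ♯ R the element x is λ(φ(x)), so x = S(x₁)φ(x₀) is the asserted identity in H ⊗ R.
theorem coactionsCompatVia : CoactionsCompatVia ρ lam φ := fun x => by
  apply B.of.injective
  refine (hφ x).symm.trans ?_
  rw [inl_eq_sum hφ hτ x]
  conv_rhs => rw [← sum_rep (ρ.coact x)]
  simp [hH, B.inl_mul_inr]

omit hρ hφ in
theorem coactionsCompatVia' : CoactionsCompatVia' ρ lam θ := fun y => by
  apply A.of.injective
  refine (hθ y).symm.trans ?_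
  rw [inr_eq_sum hθ hτ y]
  conv_rhs => rw [← sum_rep (lam.coact y)]
  simp [symm_inl hH, A.inl_mul_inr]

/-- `x₁ φ⁻¹(θ⁻¹(x₀)) = x₀ x₁` -/
theorem sum_inr_mul_inl (x : L) : ∑ p ∈ rep (ρ.coact x),
    A.inr p.2 * A.inl ((antiLin φ).symm ((antiLin θ).symm p.1)) = A.target ρ x := by
  obtain ⟨y, rfl⟩ := (antiLin θ).surjective x
  have hK := isSmashPair_left hρ hH hφ hθ
  -- For x = θ(y), compatibility gives x₀ ⊗ x₁ = θ(y₀) ⊗ S(y₋₁), so the claim becomes S(y₋₁)φ⁻¹(y₀)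
  -- = y.
  have h := hK.sum_antipode_βR (left_βR_apply hH hφ) y
  rw [coactionsCompatVia' hH hθ hτ y,
    sum_rep_map (fun a b => A.inr b * A.inl ((antiLin φ).symm ((antiLin θ).symm a))),
    sum_rep_comm (fun a b => A.inr (antipode k b) *
      A.inl ((antiLin φ).symm ((antiLin θ).symm ((antiLin θ).toLinearMap a)))), ← hθ]
  simpa using h

/-- `θ⁻¹(φ⁻¹(y₀)) y₋₁ = y₋₁ y₀` -/
theorem sum_inr_mul_inl' (y : R) : ∑ p ∈ rep (lam.coact y),
    B.inr ((antiLin θ).symm ((antiLin φ).symm p.2)) * B.inl p.1 = B.target lam y := by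
  obtain ⟨x, rfl⟩ := (antiLin φ).surjective y
  have hK := isSmashPair_right hρ hH hφ hθ
  have h := hK.sum_βL_antipode (fun x => right_βL_apply hH hθ x hφ) x
  rw [coactionsCompatVia hH hφ hτ x,
    sum_rep_map (fun a b => B.inr ((antiLin θ).symm ((antiLin φ).symm b)) * B.inl a),
    sum_rep_comm (fun a b => B.inr ((antiLin θ).symm ((antiLin φ).symm
      ((antiLin φ).toLinearMap b))) * B.inl (antipode k a))]
  simpa using h

/-- Over R the element ρ(x₀) is the source of θ⁻¹(x₀), so ρ(x₀) ⊗ x₁ ≡ 1 ⊗ x₁φ⁻¹(θ⁻¹(x₀)), and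
`sum_inr_mul_inl` identifies the second leg with ρ(x). This is where compatibility of the coactions
enters the Hopf algebroid axioms. -/
theorem isCoprodMod_left_right : IsCoprodMod A.inl (Ψ.symm.toLinearMap ∘ₗ B.inr) A.comulHom
    (rightRel (Ψ.symm.toLinearMap ∘ₗ B.inr) (A.inl ∘ₗ (antiLin φ).symm.toLinearMap)) := by
  refine (isSmashPair_left hρ hH hφ hθ).isCoprodMod_right A.isSmashCoprod
    (fun x => by rw [A.comulHom_apply, A.comulLin_inl]) (mkQ_comulHom_target hθ fun x => ?_)
  rw [← sum_inr_mul_inl hρ hH hφ hθ hτ x, TensorProduct.tmul_sum, map_sum, map_sum]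
  refine Finset.sum_congr rfl fun p _ => ?_
  have h := mkQ_rightRel (Ψ.symm.toLinearMap ∘ₗ B.inr) (A.inl ∘ₗ (antiLin φ).symm.toLinearMap)
    ((antiLin θ).symm p.1) 1 (A.inr p.2)
  rw [one_mul, LinearMap.comp_apply, AlgEquiv.toLinearMap_apply, hθ,
    LinearEquiv.apply_symm_apply] at h
  exact h

theorem isCoprodMod_right_left : IsCoprodMod (B.target lam ∘ₗ (antiLin φ).toLinearMap) B.inr
    B.comulHom (leftRel (B.target lam ∘ₗ (antiLin φ).toLinearMap)
      (B.inr ∘ₗ (antiLin θ).symm.toLinearMap)) := by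
  refine (isSmashPair_right hρ hH hφ hθ).isCoprodMod_left B.isSmashCoprod (fun x => ?_)
    (fun y => by rw [B.comulHom_apply, B.comulLin_inr])
  simp only [LinearMap.comp_apply, LinearEquiv.coe_coe, B.comulHom_apply, B.comulLin_target]
  generalize antiLin φ x = y
  rw [← sum_inr_mul_inl' hρ hH hφ hθ hτ y, TensorProduct.sum_tmul, map_sum, map_sum]
  refine Finset.sum_congr rfl fun p _ => ?_
  have h := mkQ_leftRel (B.target lam ∘ₗ (antiLin φ).toLinearMap)
    (B.inr ∘ₗ (antiLin θ).symm.toLinearMap) ((antiLin φ).symm p.2) (B.inl p.1) 1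
  simp only [mul_one, LinearMap.comp_apply, LinearEquiv.coe_coe,
    LinearEquiv.apply_symm_apply] at h
  exact h.symm

theorem left_antipode_anti : IsAntiHom (A.antipode ρ) :=
  (isSmashPair_left hρ hH hφ hθ).antipode_anti fun x f => by
    rw [A.antipode_mul_inr, antipode_inl_eq hφ hτ]

theorem left_antipode_inr_eq (f : H) : A.antipode ρ (A.inr f) = A.inr (antipode k f) := by
  have h := (left_antipode_anti hρ hH hφ hθ hτ).map_one
  rw [left_antipode_inr, A.inl_one, h, mul_one]

/-- τ' is the conjugate of τ by `Ψ`. -/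
theorem right_antipode_anti : IsAntiHom (B.antipode lam) := by
  have h : ∀ z, B.antipode lam z = Ψ (A.antipode ρ (Ψ.symm z)) := fun z => by
    rw [hτ, AlgEquiv.apply_symm_apply]
  have h' := left_antipode_anti hρ hH hφ hθ hτ
  exact ⟨by rw [h, map_one, h'.map_one, map_one], fun a b => by
    rw [h, h, h, map_mul, h'.map_mul, map_mul]⟩

theorem isSymmetricHopfAlgebroid_left :
    IsSymmetricHopfAlgebroid (leftSmashDataOfEquiv ρ Ψ φ) :=
  IsSmashPair.isSymmetricHopfAlgebroid (D := leftSmashDataOfEquiv ρ Ψ φ)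
    (isSmashPair_left hρ hH hφ hθ) A.isSmashCoprod (isCoprodMod_left_left hρ hH hφ hθ)
    (isCoprodMod_left_right hρ hH hφ hθ hτ) rfl rfl (left_antipode_anti hρ hH hφ hθ hτ)
    (left_antipode_inr_eq hρ hH hφ hθ hτ) (antipode_inl_eq hφ hτ) (antipode_symm_inr hθ)

theorem isSymmetricHopfAlgebroid_right :
    IsSymmetricHopfAlgebroid (rightSmashDataOfEquiv lam Ψ φ θ) := by
  refine IsSmashPair.isSymmetricHopfAlgebroid (D := rightSmashDataOfEquiv lam Ψ φ θ)
    (isSmashPair_right hρ hH hφ hθ) B.isSmashCoprod (isCoprodMod_right_left hρ hH hφ hθ hτ)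
    (isCoprodMod_right_right hρ hH hφ hθ) rfl rfl (right_antipode_anti hρ hH hφ hθ hτ)
    (fun f => ?_) (fun x => B.antipode_target lam _) fun y => ?_
  · change B.antipode lam (B.inl f) = _
    rw [← hH, ← hτ, left_antipode_inr_eq hρ hH hφ hθ hτ, hH]
  · exact (right_antipode_inr hθ hτ y).trans (hφ _)

/-- The coproducts of the two smash products need not correspond over k: on L one gives λ(y) ⊗ 1,
the other y₋₁ ⊗ λ(y₀), with y = φ(x). They agree modulo either set of relations, by the congruence
for δ on x f. -/
theorem isHopfAlgebroidIso :
    IsHopfAlgebroidIso (leftSmashDataOfEquiv ρ Ψ φ) (rightSmashDataOfEquiv lam Ψ φ θ) Ψ where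
  αL := hφ
  βL := map_target hθ
  εL z := congrArg A.counit (Ψ.symm_apply_apply z)
  ΔL := by
    refine .of_le_ker (leftRel_le_ker fun a x y => ?_) (A.coprod_eq _)
      (A.ext_inl_inr (F := (leftRel (rightSmashDataOfEquiv lam Ψ φ θ).αL
        (rightSmashDataOfEquiv lam Ψ φ θ).βL).mkQ ∘ₗ
          TensorProduct.map Ψ.toLinearMap Ψ.toLinearMap ∘ₗ A.comulHom.toLinearMap) fun x f => ?_)
    · simp only [LinearMap.comp_apply, TensorProduct.map_tmul, AlgEquiv.toLinearMap_apply, map_mul]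
      have h₁ : Ψ (A.target ρ a) =
          (rightSmashDataOfEquiv lam Ψ φ θ).βL a := map_target hθ a
      have h₂ : Ψ (A.inl a) =
          (rightSmashDataOfEquiv lam Ψ φ θ).αL a := hφ a
      rw [h₁, h₂, mkQ_leftRel]
    · have h := (isCoprodMod_right_left hρ hH hφ hθ hτ).map_αL_ι B.isSmashCoprod x f
      have e : Ψ (A.inl x * A.inr f) = B.target lam (antiLin φ x) * B.inl f := by
        rw [map_mul, hφ, hH]
      refine Eq.trans ?_ (h.symm.trans (congrArg (rightSmashDataOfEquiv lam Ψ φ θ).ΔL e.symm))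
      simp only [LinearMap.comp_apply, AlgHom.toLinearMap_apply, A.comulHom_apply,
        A.comulLin_inl_mul_inr, map_sum, TensorProduct.map_tmul, AlgEquiv.toLinearMap_apply,
        map_mul, hφ, hH]
      rfl
  αR y := Ψ.apply_symm_apply _
  βR y := by
    change Ψ (A.inl ((antiLin φ).symm y)) = B.target lam y
    rw [hφ, LinearEquiv.apply_symm_apply]
  εR z := rfl
  ΔR := by
    refine .of_le_ker (rightRel_le_ker fun a x y => ?_) (A.coprod_eq _)
      (A.ext_inl_inr (F := (rightRel (rightSmashDataOfEquiv lam Ψ φ θ).αR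
        (rightSmashDataOfEquiv lam Ψ φ θ).βR).mkQ ∘ₗ
          TensorProduct.map Ψ.toLinearMap Ψ.toLinearMap ∘ₗ A.comulHom.toLinearMap) fun x f => ?_)
    · simp only [LinearMap.comp_apply, TensorProduct.map_tmul, AlgEquiv.toLinearMap_apply, map_mul]
      have h₁ : Ψ (Ψ.symm (B.inr a)) =
          (rightSmashDataOfEquiv lam Ψ φ θ).αR a := Ψ.apply_symm_apply _
      have h₂ : Ψ (A.inl ((antiLin φ).symm.toLinearMap a)) =
          (rightSmashDataOfEquiv lam Ψ φ θ).βR a := by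
        change Ψ (A.inl ((antiLin φ).symm a)) = B.target lam a
        rw [hφ, LinearEquiv.apply_symm_apply]
      rw [h₁, h₂, mkQ_rightRel]
    · have h := (isCoprodMod_right_right hρ hH hφ hθ).map_αL_ι B.isSmashCoprod x f
      have e : Ψ (A.inl x * A.inr f) = B.target lam (antiLin φ x) * B.inl f := by
        rw [map_mul, hφ, hH]
      refine Eq.trans ?_ (h.symm.trans (congrArg (rightSmashDataOfEquiv lam Ψ φ θ).ΔR e.symm))
      simp only [LinearMap.comp_apply, AlgHom.toLinearMap_apply, A.comulHom_apply,
        A.comulLin_inl_mul_inr, map_sum, TensorProduct.map_tmul, AlgEquiv.toLinearMap_apply,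
        map_mul, hφ, hH]
      rfl
  τ := hτ

end Antipode

end Compatible

end ScalarExt

/-! ### The theorem -/

theorem theorem4p10 {k H L R : Type*} [Field k] [Ring H] [HopfAlgebra k H]
    [Ring L] [Algebra k L] [Ring R] [Algebra k R]
    (A : LeftModuleAlgebra k H L) (ρ : RightComodule k H L)
    (B : RightModuleAlgebra k H R) (lam : LeftComodule k H R)
    (hρ : IsAntiHom (A.target ρ)) (hlam : IsAntiHom (B.target lam))
    (Ψ : A.Smash ≃ₐ[k] B.Smash)
    (hH : ∀ f : H, Ψ (A.inr f) = B.inl f)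
    (hL : Ψ '' Set.range A.inl = Set.range (B.target lam))
    (hR : Ψ.symm '' Set.range B.inr = Set.range (A.target ρ)) :
    (∃! φ : L ≃ₐ[k] Rᵐᵒᵖ, ∀ x, Ψ (A.inl x) = B.target lam (antiLin φ x)) ∧
    (∃! θ : R ≃ₐ[k] Lᵐᵒᵖ, ∀ y, Ψ.symm (B.inr y) = A.target ρ (antiLin θ y)) ∧
    ∀ (φ : L ≃ₐ[k] Rᵐᵒᵖ) (θ : R ≃ₐ[k] Lᵐᵒᵖ),
      (∀ x, Ψ (A.inl x) = B.target lam (antiLin φ x)) →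
      (∀ y, Ψ.symm (B.inr y) = A.target ρ (antiLin θ y)) →
      IsBraidedCommLeftRightYD A ρ ∧ IsBraidedCommRightLeftYD B lam ∧
      ActionsCompatVia A B φ ∧ ActionsCompatVia' A B θ ∧
      IsLeftBialgebroid A.inl (A.target ρ) (A.coprod _) A.counit ∧
      IsRightBialgebroid B.inr (B.target lam) (B.coprod _) B.counit ∧
      ((∀ z, Ψ (A.antipode ρ z) = B.antipode lam (Ψ z)) →
        CoactionsCompatVia ρ lam φ ∧ CoactionsCompatVia' ρ lam θ ∧
        IsSymmetricHopfAlgebroid (leftDataVia A ρ B lam φ) ∧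
        IsSymmetricHopfAlgebroid (leftDataVia' A ρ B lam θ) ∧
        IsSymmetricHopfAlgebroid (rightDataVia A ρ B lam φ) ∧
        IsSymmetricHopfAlgebroid (rightDataVia' A ρ B lam θ) ∧
        leftDataVia A ρ B lam φ = leftDataVia' A ρ B lam θ ∧
        rightDataVia A ρ B lam φ = rightDataVia' A ρ B lam θ ∧
        IsHopfAlgebroidIso (leftDataVia A ρ B lam φ) (rightDataVia A ρ B lam φ) Ψ) := by
  have hinl : Function.Injective A.inl := Function.LeftInverse.injective (g := A.counit) fun x => by
    simpa [A.inr_one] using A.counit_inl_mul_inr x 1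
  have hinr : Function.Injective B.inr := Function.LeftInverse.injective (g := B.counit) fun y => by
    simpa [B.inl_one] using B.counit_inl_mul_inr 1 y
  refine ⟨existsUnique_antiEquiv (i := Ψ.toLinearMap ∘ₗ A.inl) (B.counit_target lam)
      (Ψ.injective.comp hinl) (by simp [A.inl_one]) (fun a b => by simp [A.inl_mul]) hlam ?_,
    existsUnique_antiEquiv (i := Ψ.symm.toLinearMap ∘ₗ B.inr) (A.counit_target ρ)
      (Ψ.symm.injective.comp hinr) (by simp [B.inr_one]) (fun a b => by simp [B.inr_mul]) hρ ?_,
    fun φ θ hφ hθ => ?_⟩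
  · rw [← hL, ← Set.range_comp]
    rfl
  · rw [← hR, ← Set.range_comp]
    rfl
  have hK := isSmashPair_left hρ hH hφ hθ
  refine ⟨isBraidedCommLeftRightYD hρ hH hφ hθ, isBraidedCommRightLeftYD hρ hlam hH hφ hθ,
    hK.φ_act, hK.θ_act, isLeftBialgebroid_smash hρ hH hφ hθ, isRightBialgebroid_smash hρ hH hφ hθ,
    fun hτ => ?_⟩
  -- All four structures become one of the two transported ones, so the coincidences are reflexive.
  rw [leftDataVia_eq hρ hH hφ hθ, leftDataVia'_eq hρ hH hφ hθ, rightDataVia_eq hρ hH hφ hθ,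
    rightDataVia'_eq hρ hH hφ hθ]
  have h₁ := isSymmetricHopfAlgebroid_left hρ hH hφ hθ hτ
  have h₂ := isSymmetricHopfAlgebroid_right hρ hH hφ hθ hτ
  exact ⟨coactionsCompatVia hH hφ hτ, coactionsCompatVia' hH hθ hτ, h₁, h₁, h₂, h₂,
    rfl, rfl, isHopfAlgebroidIso hρ hH hφ hθ hτ⟩
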